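/- Let $d\ge 2$, $H\in(0,1)$, $T>0$, and let $B=(B_t)_{t\ge 0}$ be a (measurable) $d$-dimensional fractional Brownian motion with Hurst parameter $H$, i.e. a centred $\mathbb R^d$-valued Gaussian process with $$\mathbb E(B^i_tB^j_s)=\frac{\delta_{ij}}2\left(t^{2H}+s^{2H}-|t-s|^{2H}\right),\qquad s,t\ge 0,\ 1\le i,j\le d.$$ For $\varepsilon>0$ let $p_\varepsilon(x)=(2\pi\varepsilon)^{-d/2}e^{-|x|^2/(2\varepsilon)}$ be the heat kernel on $\mathbb R^d$, and let $$I_\varepsilon=\int_0^T\!\int_0^t p_\varepsilon(B_t-B_s)\,ds\,dt .$$ Then $I_\varepsilon\in L^2$ for every $\varepsilon>0$, and the following hold. (i) If $H<1/d$, then $I_\varepsilon$ converges in $L^2$ as $\varepsilon\downarrow 0$. (ii) If $1/d<H<3/(2d)$, then $I_\varepsilon-T\,C_{H,d}\,\varepsilon^{-d/2+1/(2H)}$ converges in $L^2$ as $\varepsilon\downarrow 0$, where $C_{H,d}=(2\pi)^{-d/2}\int_0^\infty(z^{2H}+1)^{-d/2}\,dz<\infty$. (iii) If $1/d=H<3/(2d)$,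 then $I_\varepsilon-\dfrac{T}{2H(2\pi)^{d/2}}\log(1/\varepsilon)$ converges in $L^2$ as $\varepsilon\downarrow 0$. (iv) If $H\ge 3/(2d)$, then $I_\varepsilon-\mathbb E(I_\varepsilon)$ does not converge in $L^2$ as $\varepsilon\downarrow 0$. Consequently $I_\varepsilon-\mathbb E(I_\varepsilon)$ converges in $L^2$ as $\varepsilon\downarrow 0$ (to the renormalized self-intersection local time) if and only if $H<3/(2d)$. -/

import Mathlib

open MeasureTheory ProbabilityTheory Filter Topology
open scoped NNReal ENNReal

/-- A `d`-dimensional fractional Brownian motion with Hurst parameter `H` under `P`: a centred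
Gaussian process `(B t)_{t ≥ 0}` with values in `ℝ^d` and covariance
`E[B_t^i B_s^j] = (δ_{ij} / 2) (t^{2H} + s^{2H} - |t - s|^{2H})`. -/
structure IsFractionalBrownianMotion {Ω : Type*} [MeasurableSpace Ω] {d : ℕ} (H : ℝ)
    (B : ℝ≥0 → Ω → EuclideanSpace ℝ (Fin d)) (P : Measure Ω) : Prop where
  /-- The process is (jointly) Gaussian. -/
  gaussian : IsGaussianProcess B P
  /-- The process is centred. -/
  mean_zero : ∀ (t : ℝ≥0) (i : Fin d), ∫ ω, B t ω i ∂P = 0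
  /-- The covariance function. -/
  covariance : ∀ (s t : ℝ≥0) (i j : Fin d),
    ∫ ω, B t ω i * B s ω j ∂P =
      (if i = j then (1 : ℝ) else 0) / 2 *
        ((t : ℝ) ^ (2 * H) + (s : ℝ) ^ (2 * H) - |(t : ℝ) - (s : ℝ)| ^ (2 * H))

/-- The process `B` has a jointly measurable version in `(t, ω)`, up to null sets of
`dt ⊗ P` on `[0, ∞) × Ω`. This holds for instance if almost all paths of `B` are continuous and
every `B t` is a random variable. -/
def JointlyAEMeasurable {Ω : Type*} [MeasurableSpace Ω] {d : ℕ}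
    (B : ℝ≥0 → Ω → EuclideanSpace ℝ (Fin d)) (P : Measure Ω) : Prop :=
  AEMeasurable (fun q : ℝ × Ω => B q.1.toNNReal q.2)
    (((volume : Measure ℝ).restrict (Set.Ici 0)).prod P)

/-- The heat kernel `p_ε(x) = (2πε)^{-d/2} exp(-|x|² / (2ε))` on `ℝ^d`. -/
noncomputable def heatKernel {d : ℕ} (ε : ℝ) (x : EuclideanSpace ℝ (Fin d)) : ℝ :=
  (2 * Real.pi * ε) ^ (-(d : ℝ) / 2) * Real.exp (-‖x‖ ^ 2 / (2 * ε))

/-- The approximated self-intersection local time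
`I_ε = ∫_0^T ∫_0^t p_ε(B_t - B_s) ds dt`. -/
noncomputable def approxSelfIntersectionLocalTime {Ω : Type*} {d : ℕ}
    (B : ℝ≥0 → Ω → EuclideanSpace ℝ (Fin d)) (T ε : ℝ) (ω : Ω) : ℝ :=
  ∫ t in (0 : ℝ)..T, ∫ s in (0 : ℝ)..t, heatKernel ε (B t.toNNReal ω - B s.toNNReal ω)

/-- The constant `C_{H,d} = (2π)^{-d/2} ∫_0^∞ (z^{2H} + 1)^{-d/2} dz`. -/
noncomputable def renormalizationConstant (H : ℝ) (d : ℕ) : ℝ :=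
  (2 * Real.pi) ^ (-(d : ℝ) / 2) *
    ∫ z in Set.Ioi (0 : ℝ), (z ^ (2 * H) + 1) ^ (-(d : ℝ) / 2)

/-- The family `(F ε)_{ε > 0}` of random variables in `L²(P)` converges in `L²(P)` as `ε ↓ 0`. -/
def ConvergesInL2 {Ω : Type*} [MeasurableSpace Ω] (P : Measure Ω) (F : ℝ → Ω → ℝ) : Prop :=
  (∀ ε : ℝ, 0 < ε → MemLp (F ε) 2 P) ∧
    ∃ Z : Ω → ℝ, MemLp Z 2 P ∧
      Tendsto (fun ε : ℝ => eLpNorm (fun ω => F ε ω - Z ω) 2 P) (𝓝[>] (0 : ℝ)) (𝓝 0)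

/-! Put `α = d/2`. For increments `p = (t, s)` and `q = (t', s')` let `λ`, `ρ`, `μ` be their scalar
variances and covariance (`incCov`). Writing heat kernels as Fourier integrals reduces moments to
Gaussian characteristic functions. The mean of `I_ε` is `(2π)^{-d/2} ∫ (ε + λ)^{-α}`, and the
covariance of `I_ε` and `I_η` is `(2π)^{-d}` times the integral over pairs `(p, q)` of `((ε + λ)(η +
ρ) - μ²)^{-α} - ((ε + λ)(η + ρ))^{-α}` (`covKernel`). The problem thus splits into the behaviour of
the mean and that of this integral.

Centred part: in the Hilbert space `L²`, joint convergence of the covariances as `(ε, η) → (0, 0)`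
gives the Cauchy property (`convergesInL2_of_tendsto_integral_mul`). At `ε = η = 0` the kernel is
homogeneous of degree `-4Hα = -2Hd` in time. The four times form three gaps, so the expected
threshold is `4Hα = 3`, that is `H = 3/(2d)`. Below it, the kernel is dominated, uniformly in `ε,
η`, by a multiple of the product of the three gaps to the power `-4Hα/3 > -1`
(`incDet_pos_and_detBound_le`), which is integrable (`integrable_pathSum`). At or above it,
interlaced increments of comparable length `u` contribute at least a multiple of `∫ u^{2 - 4Hα} du =
∞` (`lintegral_covKernel_eq_top`), and Fatou's lemma rules out convergence of the variances.

The domination needs lower bounds for `λρ - μ²`. These come from the Mandelbrot–van Ness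
representation `∫ (x_+^{H-1/2} kernels) dW`: the noise used only by the later increment is
independent of the earlier one, which gives `le_incDet_of_le`, and time reversal gives
`le_incDet_of_ge`. Only the kernels in `L²(ℝ)` are used, not a stochastic integral.

Mean: with `u = t - s` it is `∫_0^T ∫_0^t (ε + u^{2H})^{-α} du dt`. Scaling by `ε^{1/(2H)}`
separates the cases `Hd < 1`, `Hd > 1`, `Hd = 1`: convergence, a power divergence, a logarithm.
Adding a convergent deterministic term to the centred family then gives the stated renormalizations
(`convergesInL2_of_tendsto_mean`). -/

/-- The covariance `E[(β_t - β_s)(β_t' - β_s')]` of two increments of a one-dimensional fractional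
Brownian motion, with `p = (t, s)` and `q = (t', s')`. -/
noncomputable def incCov (H : ℝ) (p q : ℝ × ℝ) : ℝ :=
  (|p.1 - q.2| ^ (2 * H) + |p.2 - q.1| ^ (2 * H) - |p.1 - q.1| ^ (2 * H)
    - |p.2 - q.2| ^ (2 * H)) / 2

/-! ### The Mandelbrot–van Ness kernels and local nondeterminism. -/

/-- The kernel `x_+^{H - 1/2}` of the Mandelbrot–van Ness representation. -/
noncomputable def mvnKernel (H x : ℝ) : ℝ := if 0 < x then x ^ (H - 1 / 2) else 0

/-- The integrand of the increment `(t, s)` in the Mandelbrot–van Ness representation. -/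
noncomputable def mvnInc (H : ℝ) (p : ℝ × ℝ) (u : ℝ) : ℝ :=
  mvnKernel H (p.1 - u) - mvnKernel H (p.2 - u)

/-- The normalizing constant of the Mandelbrot–van Ness representation. -/
noncomputable def mvnConst (H : ℝ) : ℝ := ∫ v, (mvnKernel H (v + 1) - mvnKernel H v) ^ 2

lemma measurable_mvnKernel (H : ℝ) : Measurable (mvnKernel H) :=
  Measurable.ite measurableSet_Ioi (measurable_id.pow_const _) measurable_const

lemma mvnKernel_mul {H r : ℝ} (hr : 0 < r) (x : ℝ) :
    mvnKernel H (r * x) = r ^ (H - 1 / 2) * mvnKernel H x := by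
  unfold mvnKernel
  by_cases hx : 0 < x
  · rw [if_pos hx, if_pos (mul_pos hr hx), Real.mul_rpow hr.le hx.le]
  · rw [if_neg hx, if_neg (by simpa [hr] using hx), mul_zero]

lemma mvnKernel_of_nonpos {H x : ℝ} (hx : x ≤ 0) : mvnKernel H x = 0 := if_neg hx.not_gt

lemma sq_mvnKernel_of_pos {H x : ℝ} (hx : 0 < x) : mvnKernel H x ^ 2 = x ^ (2 * H - 1) := by
  rw [mvnKernel, if_pos hx, ← Real.rpow_natCast, ← Real.rpow_mul hx.le]
  congr 1
  push_cast
  ring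

lemma integrableOn_sq_mvnKernel {H : ℝ} (hH : 0 < H) (a b : ℝ) :
    IntegrableOn (fun x => mvnKernel H x ^ 2) (Set.Ioc a b) := by
  have h1 : IntegrableOn (fun x : ℝ => x ^ (2 * H - 1)) (Set.Ioc 0 (max b 0)) := by
    rw [← intervalIntegrable_iff_integrableOn_Ioc_of_le (le_max_right _ _)]
    exact intervalIntegral.intervalIntegrable_rpow' (by linarith)
  have h2 : IntegrableOn (fun x => mvnKernel H x ^ 2) (Set.Ioc 0 (max b 0)) :=
    h1.congr_fun (fun x hx => (sq_mvnKernel_of_pos hx.1).symm) measurableSet_Ioc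
  have h3 : IntegrableOn (fun x => mvnKernel H x ^ 2) (Set.Iic 0) :=
    integrableOn_zero.congr_fun (fun x hx => by simp [mvnKernel_of_nonpos hx]) measurableSet_Iic
  refine (h3.union h2).mono_set fun x hx => ?_
  rcases le_or_gt x 0 with h | h
  · exact Or.inl h
  · exact Or.inr ⟨h, hx.2.trans (le_max_left _ _)⟩

/-- With `x = 1/v` and `|H - 1/2| ≤ 1`, the number `(1 + x)^{H - 1/2}` lies between `(1 + x)^{-1} ≥
1 - x` and `1 + x`. This gains the factor `v^{-2}` which makes the tail integrable for `H < 1`. -/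
lemma sq_mvnKernel_add_one_sub_le {H v : ℝ} (hH : 0 < H) (hH' : H < 1) (hv : 1 < v) :
    (mvnKernel H (v + 1) - mvnKernel H v) ^ 2 ≤ v ^ (2 * H - 3) := by
  have hv0 : 0 < v := by linarith
  have hx : 0 < v⁻¹ := inv_pos.2 hv0
  have e1 : mvnKernel H (v + 1) = v ^ (H - 1 / 2) * (1 + v⁻¹) ^ (H - 1 / 2) := by
    rw [mvnKernel, if_pos (by linarith), ← Real.mul_rpow hv0.le (by positivity)]
    congr 1
    field_simp
  have e2 : mvnKernel H v = v ^ (H - 1 / 2) := if_pos hv0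
  have u1 : (1 + v⁻¹) ^ (H - 1 / 2) ≤ 1 + v⁻¹ :=
    (Real.rpow_le_rpow_of_exponent_le (by linarith) (by linarith)).trans_eq (Real.rpow_one _)
  have u2 : 1 - v⁻¹ ≤ (1 + v⁻¹) ^ (H - 1 / 2) := by
    have : (1 + v⁻¹) ^ (-1 : ℝ) ≤ (1 + v⁻¹) ^ (H - 1 / 2) :=
      Real.rpow_le_rpow_of_exponent_le (by linarith) (by linarith)
    refine le_trans ?_ this
    rw [Real.rpow_neg_one, inv_eq_one_div (1 + v⁻¹), le_div_iff₀ (by positivity)]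
    nlinarith
  have e3 : mvnKernel H (v + 1) - mvnKernel H v
      = v ^ (H - 1 / 2) * ((1 + v⁻¹) ^ (H - 1 / 2) - 1) := by rw [e1, e2]; ring
  have e4 : v ^ (2 * H - 3) = (v ^ (H - 1 / 2)) ^ 2 * (v⁻¹) ^ 2 := by
    rw [← Real.rpow_natCast, ← Real.rpow_mul hv0.le, ← Real.rpow_neg_one, ← Real.rpow_natCast,
      ← Real.rpow_mul hv0.le, ← Real.rpow_add hv0]
    congr 1
    push_cast
    ring
  rw [e3, mul_pow, e4]
  refine mul_le_mul_of_nonneg_left ?_ (by positivity)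
  exact sq_le_sq' (by linarith) (by linarith)

/-- The integrand vanishes below `-1`. The singularities at `-1` and `0` are of order `x^{2H - 1}`,
integrable because `H > 0`; the tail is integrable because `H < 1`. -/
lemma integrable_mvnConst {H : ℝ} (hH : 0 < H) (hH' : H < 1) :
    Integrable (fun v => (mvnKernel H (v + 1) - mvnKernel H v) ^ 2) := by
  have hm : Measurable (fun v => (mvnKernel H (v + 1) - mvnKernel H v) ^ 2) :=
    (((measurable_mvnKernel H).comp (measurable_id.add_const 1)).sub
      (measurable_mvnKernel H)).pow_const 2
  have h1 : IntegrableOn (fun v => (mvnKernel H (v + 1) - mvnKernel H v) ^ 2) (Set.Iic (-1)) :=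
    integrableOn_zero.congr_fun (fun x hx => by
      have : x ≤ -1 := hx
      simp [mvnKernel_of_nonpos (show x + 1 ≤ 0 by linarith),
        mvnKernel_of_nonpos (show x ≤ 0 by linarith)]) measurableSet_Iic
  have h2 : IntegrableOn (fun v => (mvnKernel H (v + 1) - mvnKernel H v) ^ 2) (Set.Ioc (-1) 1) := by
    have hs : IntegrableOn (fun v => mvnKernel H (v + 1) ^ 2) (Set.Ioc (-1) 1) := by
      have := (integrableOn_sq_mvnKernel hH 0 2)
      rw [← intervalIntegrable_iff_integrableOn_Ioc_of_le (by norm_num)] at this ⊢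
      have h := this.comp_add_right 1
      norm_num at h
      exact h
    refine (((hs.add (integrableOn_sq_mvnKernel hH (-1) 1)).const_mul 2)).mono'
      hm.aestronglyMeasurable (ae_of_all _ fun v => ?_)
    rw [Real.norm_of_nonneg (sq_nonneg _)]
    simp only [Pi.add_apply]
    nlinarith [sq_nonneg (mvnKernel H (v + 1) + mvnKernel H v)]
  have h3 : IntegrableOn (fun v => (mvnKernel H (v + 1) - mvnKernel H v) ^ 2) (Set.Ioi 1) := by
    refine (integrableOn_Ioi_rpow_of_lt (a := 2 * H - 3) (by linarith) one_pos).mono'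
      hm.aestronglyMeasurable ?_
    refine (ae_restrict_mem measurableSet_Ioi).mono fun v hv => ?_
    rw [Real.norm_of_nonneg (sq_nonneg _)]
    exact sq_mvnKernel_add_one_sub_le hH hH' hv
  rw [← integrableOn_univ]
  refine ((h1.union h2).union h3).mono_set fun x _ => ?_
  rcases le_or_gt x (-1) with h | h
  · exact Or.inl (Or.inl h)
  rcases le_or_gt x 1 with h' | h'
  · exact Or.inl (Or.inr ⟨h, h'⟩)
  · exact Or.inr h'

lemma sq_mvnInc_mul {H r : ℝ} (hr : 0 < r) (v : ℝ) :
    (mvnKernel H (r * v + r) - mvnKernel H (r * v)) ^ 2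
      = r ^ (2 * H - 1) * (mvnKernel H (v + 1) - mvnKernel H v) ^ 2 := by
  rw [show r * v + r = r * (v + 1) by ring, mvnKernel_mul hr, mvnKernel_mul hr, ← mul_sub, mul_pow,
    ← Real.rpow_natCast (r ^ _), ← Real.rpow_mul hr.le]
  congr 2
  push_cast
  ring

/-- The substitution `u = s - (t - s) v` together with the homogeneity of the kernel reduces every
increment to the unit one. -/
lemma integrable_sq_mvnInc_and_integral {H : ℝ} (hH : 0 < H) (hH' : H < 1) (p : ℝ × ℝ) :
    Integrable (fun u => mvnInc H p u ^ 2) ∧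
      ∫ u, mvnInc H p u ^ 2 = mvnConst H * |p.1 - p.2| ^ (2 * H) := by
  have main : ∀ t s : ℝ, s < t → Integrable (fun u => mvnInc H (t, s) u ^ 2) ∧
      ∫ u, mvnInc H (t, s) u ^ 2 = mvnConst H * |t - s| ^ (2 * H) := by
    intro t s hst
    have hr : 0 < t - s := sub_pos.2 hst
    set F : ℝ → ℝ := fun w => (mvnKernel H (w + (t - s)) - mvnKernel H w) ^ 2 with hF
    have e0 : (fun u => mvnInc H (t, s) u ^ 2) = fun u => F (s - u) := by
      ext u
      simp only [mvnInc, hF]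
      ring_nf
    have e1 : (fun v => F ((t - s) * v)) = fun v =>
        (t - s) ^ (2 * H - 1) * (mvnKernel H (v + 1) - mvnKernel H v) ^ 2 :=
      funext fun v => sq_mvnInc_mul hr v
    have i1 : Integrable F := by
      rw [← integrable_comp_mul_left_iff F hr.ne', e1]
      exact (integrable_mvnConst hH hH').const_mul _
    refine ⟨e0 ▸ i1.comp_sub_left s, ?_⟩
    rw [e0, integral_sub_left_eq_self]
    have := Measure.integral_comp_mul_left F (t - s)
    rw [e1, integral_const_mul, abs_of_pos (inv_pos.2 hr), smul_eq_mul,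
      eq_inv_mul_iff_mul_eq₀ hr.ne'] at this
    rw [← this, mvnConst, abs_of_pos hr, show 2 * H = 1 + (2 * H - 1) by ring, Real.rpow_add hr,
      Real.rpow_one]
    ring_nf
  obtain ⟨t, s⟩ := p
  rcases lt_trichotomy s t with h | h | h
  · exact main t s h
  · subst h
    have : (2 * H) ≠ 0 := by positivity
    simp [mvnInc, this]
  · have e : (fun u => mvnInc H (t, s) u ^ 2) = fun u => mvnInc H (s, t) u ^ 2 := by
      ext u
      simp only [mvnInc]
      ring
    simp only [e, abs_sub_comm t s]
    exact main s t h

/-- Polarization: `incCov` is the same combination of the powers `|·|^{2H}`, so inner products of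
the kernels reproduce the covariance up to the factor `mvnConst H`. -/
lemma mvnInc_mul (H : ℝ) (p q : ℝ × ℝ) (u : ℝ) :
    mvnInc H p u * mvnInc H q u = (mvnInc H (p.1, q.2) u ^ 2 + mvnInc H (p.2, q.1) u ^ 2
      - mvnInc H (p.1, q.1) u ^ 2 - mvnInc H (p.2, q.2) u ^ 2) / 2 := by
  simp only [mvnInc]
  ring

lemma integrable_mvnInc_mul {H : ℝ} (hH : 0 < H) (hH' : H < 1) (p q : ℝ × ℝ) :
    Integrable (fun u => mvnInc H p u * mvnInc H q u) := by
  simp only [mvnInc_mul]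
  have h := fun r => (integrable_sq_mvnInc_and_integral hH hH' r).1
  exact ((((h _).add (h _)).sub (h _)).sub (h _)).div_const 2

lemma integral_mvnInc_mul {H : ℝ} (hH : 0 < H) (hH' : H < 1) (p q : ℝ × ℝ) :
    ∫ u, mvnInc H p u * mvnInc H q u = mvnConst H * incCov H p q := by
  simp only [mvnInc_mul]
  have h := fun r => (integrable_sq_mvnInc_and_integral hH hH' r).1
  have h' := fun r => (integrable_sq_mvnInc_and_integral hH hH' r).2
  rw [integral_div, integral_sub (((h _).fun_add (h _)).sub' (h _)) (h _),
    integral_sub ((h _).fun_add (h _)) (h _), integral_add (h _) (h _)]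
  simp only [h', incCov]
  ring

lemma integrable_sq_mvnInc_combination {H : ℝ} (hH : 0 < H) (hH' : H < 1) (p q : ℝ × ℝ)
    (x y : ℝ) : Integrable (fun u => (x * mvnInc H p u + y * mvnInc H q u) ^ 2) := by
  have h := integrable_mvnInc_mul hH hH'
  refine ((((h p p).const_mul (x ^ 2)).add ((h p q).const_mul (2 * x * y))).add
    ((h q q).const_mul (y ^ 2))).congr (ae_of_all _ fun u => ?_)
  simp only [Pi.add_apply]
  ring

lemma integral_sq_mvnInc_combination {H : ℝ} (hH : 0 < H) (hH' : H < 1) (p q : ℝ × ℝ)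
    (x y : ℝ) : ∫ u, (x * mvnInc H p u + y * mvnInc H q u) ^ 2 =
      mvnConst H * (x ^ 2 * incCov H p p + 2 * x * y * incCov H p q + y ^ 2 * incCov H q q) := by
  have h := integrable_mvnInc_mul hH hH'
  have e : (fun u => (x * mvnInc H p u + y * mvnInc H q u) ^ 2) = fun u =>
      x ^ 2 * (mvnInc H p u * mvnInc H p u) + 2 * x * y * (mvnInc H p u * mvnInc H q u)
        + y ^ 2 * (mvnInc H q u * mvnInc H q u) := by
    ext u
    ring
  rw [e, integral_add (((h p p).const_mul _).fun_add ((h p q).const_mul _)) ((h q q).const_mul _),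
    integral_add ((h p p).const_mul _) ((h p q).const_mul _)]
  simp only [integral_const_mul, integral_mvnInc_mul hH hH']
  ring

/-- One-sided local nondeterminism: the innovation after time `z` in the increment `q`. -/
lemma le_integral_sq_mvnInc_combination {H : ℝ} (hH : 0 < H) (hH' : H < 1) (p q : ℝ × ℝ)
    (x y : ℝ) {z : ℝ} (h1 : p.1 ≤ z) (h2 : p.2 ≤ z) (h3 : q.2 ≤ z) (h4 : z ≤ q.1) :
    y ^ 2 * ((q.1 - z) ^ (2 * H) / (2 * H)) ≤
      ∫ u, (x * mvnInc H p u + y * mvnInc H q u) ^ 2 := by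
  -- The kernels are one-sided: on `(z, q.1)` only the one attached to the time `q.1` is nonzero, so
  -- neither `p` nor the start of `q` can cancel it.
  have e : y ^ 2 * ((q.1 - z) ^ (2 * H) / (2 * H))
      = ∫ u in Set.Ioo z q.1, (x * mvnInc H p u + y * mvnInc H q u) ^ 2 := by
    have : ∀ u ∈ Set.Ioo z q.1, (x * mvnInc H p u + y * mvnInc H q u) ^ 2
        = y ^ 2 * (q.1 - u) ^ (2 * H - 1) := by
      rintro u ⟨hu1, hu2⟩
      rw [← sq_mvnKernel_of_pos (sub_pos.2 hu2)]
      simp only [mvnInc, mvnKernel_of_nonpos (show p.1 - u ≤ 0 by linarith),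
        mvnKernel_of_nonpos (show p.2 - u ≤ 0 by linarith),
        mvnKernel_of_nonpos (show q.2 - u ≤ 0 by linarith)]
      ring
    rw [setIntegral_congr_fun measurableSet_Ioo this, ← integral_Ioc_eq_integral_Ioo,
      ← intervalIntegral.integral_of_le h4, intervalIntegral.integral_const_mul,
      intervalIntegral.integral_comp_sub_left (fun u => u ^ (2 * H - 1)) q.1,
      integral_rpow (Or.inl (by linarith))]
    rw [sub_self, show 2 * H - 1 + 1 = 2 * H by ring, Real.zero_rpow (by positivity), sub_zero]
  rw [e]
  exact setIntegral_le_integral (integrable_sq_mvnInc_combination hH hH' p q x y)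
    (ae_of_all _ fun u => sq_nonneg _)

lemma incCov_self {H : ℝ} (hH : 0 < H) (p : ℝ × ℝ) : incCov H p p = |p.1 - p.2| ^ (2 * H) := by
  have : (2 * H) ≠ 0 := by positivity
  simp only [incCov, sub_self, abs_zero, Real.zero_rpow this, abs_sub_comm p.2 p.1]
  ring

lemma incCov_comm (H : ℝ) (p q : ℝ × ℝ) : incCov H p q = incCov H q p := by
  simp only [incCov, abs_sub_comm p.1, abs_sub_comm p.2]
  ring

/-- The innovation bound for the unit increment with `x = 0` already gives `mvnConst H ≥ 1 / (2H)`.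
-/
lemma mvnConst_pos {H : ℝ} (hH : 0 < H) (hH' : H < 1) : 0 < mvnConst H := by
  have h := le_integral_sq_mvnInc_combination hH hH' (0, 0) (1, 0) 0 1 (z := 0)
    le_rfl le_rfl le_rfl zero_le_one
  rw [integral_sq_mvnInc_combination hH hH', incCov_self hH (1, 0)] at h
  norm_num at h
  have h2 : 0 < 2⁻¹ * H⁻¹ := by positivity
  have h3 := h2.trans_le (by simpa [mul_comm] using h)
  simpa using h3

/-! ### Lower bounds for the determinant of two increments. -/

/-- The determinant of the covariance matrix of two increments. -/
noncomputable def incDet (H : ℝ) (p q : ℝ × ℝ) : ℝ :=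
  incCov H p p * incCov H q q - incCov H p q ^ 2

lemma incDet_comm (H : ℝ) (p q : ℝ × ℝ) : incDet H p q = incDet H q p := by
  rw [incDet, incDet, incCov_comm H p q]
  ring

lemma incCov_self_nonneg {H : ℝ} (hH : 0 < H) (p : ℝ × ℝ) : 0 ≤ incCov H p p := by
  rw [incCov_self hH]
  positivity

lemma incCov_self_pos {H : ℝ} (hH : 0 < H) {p : ℝ × ℝ} (hp : p.1 ≠ p.2) : 0 < incCov H p p := by
  rw [incCov_self hH]
  exact Real.rpow_pos_of_pos (abs_pos.2 (sub_ne_zero.2 hp)) _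

lemma incDet_nonneg {H : ℝ} (hH : 0 < H) (hH' : H < 1) (p q : ℝ × ℝ) : 0 ≤ incDet H p q := by
  have hq : ∀ x y : ℝ, 0 ≤ x ^ 2 * incCov H p p + 2 * x * y * incCov H p q
      + y ^ 2 * incCov H q q := fun x y => by
    have := integral_sq_mvnInc_combination hH hH' p q x y
    have h0 : 0 ≤ ∫ u, (x * mvnInc H p u + y * mvnInc H q u) ^ 2 :=
      integral_nonneg fun _ => sq_nonneg _
    rw [this] at h0
    exact nonneg_of_mul_nonneg_right h0 (mvnConst_pos hH hH')
  have := discrim_le_zero (a := incCov H p p) (b := 2 * incCov H p q) (c := incCov H q q)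
    fun x => by have := hq x 1; nlinarith
  rw [discrim] at this
  rw [incDet]
  linarith

/-- The constant in the local nondeterminism bounds. -/
noncomputable def lndConst (H : ℝ) : ℝ := (2 * H * mvnConst H)⁻¹

lemma lndConst_pos {H : ℝ} (hH : 0 < H) (hH' : H < 1) : 0 < lndConst H := by
  have := mvnConst_pos hH hH'
  unfold lndConst
  positivity

/-- The determinant is the variance of `p` times the conditional variance of `q` given `p`, and the
latter is at least the variance of the innovation of `q` after the time `z`, when `p` has ended. -/
lemma le_incDet_of_le {H : ℝ} (hH : 0 < H) (hH' : H < 1) (p q : ℝ × ℝ) {z : ℝ} (h1 : p.1 ≤ z)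
    (h2 : p.2 ≤ z) (h3 : q.2 ≤ z) (h4 : z ≤ q.1) :
    lndConst H * (incCov H p p * (q.1 - z) ^ (2 * H)) ≤ incDet H p q := by
  rcases eq_or_ne p.1 p.2 with hp | hp
  · have : incCov H p p = 0 := by
      rw [incCov_self hH, hp, sub_self, abs_zero, Real.zero_rpow (by positivity)]
    rw [this, zero_mul, mul_zero]
    exact incDet_nonneg hH hH' p q
  have hpp := incCov_self_pos hH hp
  have hV := mvnConst_pos hH hH'
  -- These coefficients are those of the regression residual of `q` on `p`, multiplied by the
  -- variance of `p`; the quadratic form collapses to variance times determinant.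
  have := le_integral_sq_mvnInc_combination hH hH' p q (- incCov H p q) (incCov H p p) h1 h2 h3 h4
  rw [integral_sq_mvnInc_combination hH hH'] at this
  have e : mvnConst H * ((-incCov H p q) ^ 2 * incCov H p p
      + 2 * -incCov H p q * incCov H p p * incCov H p q + incCov H p p ^ 2 * incCov H q q)
      = (mvnConst H * incCov H p p) * incDet H p q := by
    rw [incDet]
    ring
  rw [e] at this
  have h5 : incCov H p p ^ 2 * ((q.1 - z) ^ (2 * H) / (2 * H)) = (mvnConst H * incCov H p p) *
      (lndConst H * (incCov H p p * (q.1 - z) ^ (2 * H))) := by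
    rw [lndConst]
    field_simp
  rw [h5] at this
  exact le_of_mul_le_mul_left this (by positivity)

lemma incCov_reflect (H : ℝ) (p q : ℝ × ℝ) :
    incCov H (-p.2, -p.1) (-q.2, -q.1) = incCov H p q := by
  simp only [incCov, show ∀ a b : ℝ, -a - -b = -(a - b) from fun a b => by ring, abs_neg]
  ring

/-- The covariance is invariant under `t ↦ -t`, so the part of `q` before `p` begins serves as an
innovation too. Negative times are harmless since the kernels live on the whole line. -/
lemma le_incDet_of_ge {H : ℝ} (hH : 0 < H) (hH' : H < 1) (p q : ℝ × ℝ) {z : ℝ} (h1 : z ≤ p.1)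
    (h2 : z ≤ p.2) (h3 : z ≤ q.1) (h4 : q.2 ≤ z) :
    lndConst H * (incCov H p p * (z - q.2) ^ (2 * H)) ≤ incDet H p q := by
  have := le_incDet_of_le hH hH' (-p.2, -p.1) (-q.2, -q.1) (z := -z) (by simpa) (by simpa)
    (by simpa) (by simpa)
  simp only [incDet, incCov_reflect] at this
  rwa [show -q.2 - -z = z - q.2 by ring] at this

/-! ### Bounds for the kernel in the three configurations of increments. -/

/-- The convex function `x^{-α}` lies above its tangent at `x`. Based at the determinant this bounds
the covariance kernel from above; based at the product of the variances it bounds the kernel from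
below. -/
lemma rpow_neg_tangent_le {α x y : ℝ} (hα : 0 < α) (hx : 0 < x) (hy : 0 < y) :
    x ^ (-α) - y ^ (-α) ≤ α * (y - x) * x ^ (-(α + 1)) := by
  have h1 : 1 - α * (y / x - 1) ≤ (y / x) ^ (-α) := by
    rw [Real.rpow_def_of_pos (by positivity)]
    have h2 := Real.add_one_le_exp (Real.log (y / x) * -α)
    have h3 := Real.log_le_sub_one_of_pos (show 0 < y / x by positivity)
    nlinarith
  have h2 : y ^ (-α) = x ^ (-α) * (y / x) ^ (-α) := by
    rw [← Real.mul_rpow hx.le (by positivity)]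
    congr 1
    field_simp
  have h3 : α * (y - x) * x ^ (-(α + 1)) = x ^ (-α) * (α * (y / x - 1)) := by
    rw [neg_add, Real.rpow_add hx, Real.rpow_neg_one]
    field_simp
  rw [h2, h3]
  nlinarith [Real.rpow_pos_of_pos hx (-α)]

/-- The upper bound for `(x - μ ^ 2) ^ (-α) - x ^ (-α)` in terms of `δ ≤ x - μ ^ 2`. -/
noncomputable def detBound (α δ μ : ℝ) : ℝ := min (δ ^ (-α)) (α * μ ^ 2 * δ ^ (-(α + 1)))

lemma sub_rpow_le_detBound {α δ μ x : ℝ} (hα : 0 < α) (hδ : 0 < δ) (h : δ ≤ x - μ ^ 2) :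
    (x - μ ^ 2) ^ (-α) - x ^ (-α) ≤ detBound α δ μ := by
  have hy : 0 < x - μ ^ 2 := hδ.trans_le h
  have hx : 0 < x := by nlinarith [sq_nonneg μ]
  refine le_min ?_ ?_
  · have := Real.rpow_le_rpow_of_nonpos hδ h (neg_nonpos.2 hα.le)
    have := Real.rpow_pos_of_pos hx (-α)
    linarith
  · refine (rpow_neg_tangent_le hα hy hx).trans ?_
    rw [sub_sub_cancel]
    exact mul_le_mul_of_nonneg_left (Real.rpow_le_rpow_of_nonpos hδ h (by linarith))
      (by positivity)

lemma sub_rpow_nonneg {α μ x : ℝ} (hα : 0 < α) (h : 0 < x - μ ^ 2) :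
    0 ≤ (x - μ ^ 2) ^ (-α) - x ^ (-α) :=
  sub_nonneg.2 <| Real.rpow_le_rpow_of_nonpos h (by nlinarith [sq_nonneg μ]) (by linarith)

/-- Interlaced increments. -/
lemma detBound_le_of_interlaced {H α k a b c δ μ : ℝ} (hH : 0 < H) (hα : 0 < α) (hk : 0 < k)
    (ha : 0 < a) (hb : 0 < b) (hc : 0 < c)
    (h1 : k * ((a + b) ^ (2 * H) * c ^ (2 * H)) ≤ δ)
    (h2 : k * ((b + c) ^ (2 * H) * a ^ (2 * H)) ≤ δ) :
    detBound α δ μ ≤ k ^ (-α) * (a * b * c) ^ (-(4 * H * α / 3)) := by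
  -- The geometric mean of the two lower bounds for `δ` has base `√((a + b) c (b + c) a)`, and this
  -- inequality compares it with `(abc)^{2/3}`. Sixth powers below avoid taking roots.
  have hX : (a * b * c) ^ 4 ≤ ((a + b) * c * ((b + c) * a)) ^ 3 := by
    have e1 : a * b ^ 2 ≤ (a + b) ^ 3 := by
      have : 0 < a ^ 3 + 3 * a ^ 2 * b + 2 * a * b ^ 2 + b ^ 3 := by positivity
      linarith [show (a + b) ^ 3 = a ^ 3 + 3 * a ^ 2 * b + 2 * a * b ^ 2 + b ^ 3 + a * b ^ 2 by ring]
    have e2 : b ^ 2 * c ≤ (b + c) ^ 3 := by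
      have : 0 < b ^ 3 + 2 * b ^ 2 * c + 3 * b * c ^ 2 + c ^ 3 := by positivity
      linarith [show (b + c) ^ 3 = b ^ 3 + 2 * b ^ 2 * c + 3 * b * c ^ 2 + c ^ 3 + b ^ 2 * c by ring]
    calc (a * b * c) ^ 4 = (a * b ^ 2) * (b ^ 2 * c) * (a ^ 3 * c ^ 3) := by ring
      _ ≤ (a + b) ^ 3 * (b + c) ^ 3 * (a ^ 3 * c ^ 3) := by gcongr
      _ = _ := by ring
  have hδ0 : 0 ≤ δ := le_trans (by positivity) h1
  have h3 : (k * (a * b * c) ^ (4 * H / 3)) ^ 6 ≤ δ ^ 6 := by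
    calc (k * (a * b * c) ^ (4 * H / 3)) ^ 6
        = k ^ 6 * ((a * b * c) ^ 4) ^ (2 * H) := by
          rw [mul_pow, ← Real.rpow_natCast ((a * b * c) ^ _), ← Real.rpow_mul (by positivity),
            ← Real.rpow_natCast (a * b * c) 4, ← Real.rpow_mul (by positivity)]
          congr 2
          push_cast
          ring
      _ ≤ k ^ 6 * (((a + b) * c * ((b + c) * a)) ^ 3) ^ (2 * H) := by gcongr
      _ = (k * ((a + b) ^ (2 * H) * c ^ (2 * H))) ^ 3
          * (k * ((b + c) ^ (2 * H) * a ^ (2 * H))) ^ 3 := by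
          rw [← Real.rpow_natCast _ 3, ← Real.rpow_mul (by positivity), mul_comm _ (2 * H),
            Real.rpow_mul (by positivity), Real.rpow_natCast, Real.mul_rpow (by positivity)
            (by positivity), Real.mul_rpow (by positivity) (by positivity),
            Real.mul_rpow (by positivity) (by positivity)]
          ring
      _ ≤ δ ^ 3 * δ ^ 3 := by gcongr
      _ = δ ^ 6 := by ring
  have h4 : k * (a * b * c) ^ (4 * H / 3) ≤ δ :=
    le_of_pow_le_pow_left₀ (by norm_num) hδ0 h3
  refine (min_le_left _ _).trans ?_
  refine (Real.rpow_le_rpow_of_nonpos (by positivity) h4 (by linarith)).trans_eq ?_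
  rw [Real.mul_rpow hk.le (by positivity), ← Real.rpow_mul (by positivity)]
  congr 2
  ring

/-- Disjoint increments. -/
lemma detBound_le_of_disjoint {H α k a b c δ μ : ℝ} (hH : 0 < H) (hα : 1 ≤ α)
    (hαH : 4 * H * α < 3) (hk : 0 < k) (ha : 0 < a) (hb : 0 < b) (hc : 0 < c)
    (h1 : k * (a * c) ^ (2 * H) ≤ δ) (h2 : |μ| ≤ a * c * b ^ (2 * H - 2))
    (h3 : μ ^ 2 ≤ (a * c) ^ (2 * H)) :
    detBound α δ μ ≤ α * k ^ (-(α + 1)) * (a * b * c) ^ (-(4 * H * α / 3)) := by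
  have hac : 0 < a * c := by positivity
  -- With `θ = Hα/3` the target is `μ² ≤ (ac)^{2H + 2θ} b^{-4θ}`: multiplied by `(ac)^{-2H(α + 1)}`
  -- and with `2Hα = 6θ`, it leaves `(abc)^{-4θ}`. The decay bound `h2` gives it if `ac ≤ b²`,
  -- Cauchy–Schwarz `h3` otherwise; in logarithms both are linear.
  have h5 : μ ^ 2 ≤ (a * c) ^ (2 * H + 2 * (H * α / 3)) * b ^ (-(4 * (H * α / 3))) := by
    have hμ : μ ^ 2 ≤ (a * c * b ^ (2 * H - 2)) ^ 2 := sq_le_sq.2 (h2.trans (le_abs_self _))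
    have hH1 : 4 * H < 3 := by nlinarith
    obtain ⟨A, hA⟩ : ∃ A, a * c = Real.exp A := ⟨_, (Real.exp_log hac).symm⟩
    obtain ⟨L, rfl⟩ : ∃ L, b = Real.exp L := ⟨_, (Real.exp_log hb).symm⟩
    rw [hA] at h3 hμ ⊢
    simp only [← Real.exp_mul, ← Real.exp_add, ← Real.exp_nat_mul] at h3 hμ ⊢
    rcases le_total A (2 * L) with h | h
    · refine hμ.trans (Real.exp_le_exp.2 ?_)
      push_cast
      nlinarith [mul_nonneg (show 0 ≤ 2 - 2 * H - 2 * (H * α / 3) by nlinarith) (sub_nonneg.2 h)]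
    · refine h3.trans (Real.exp_le_exp.2 ?_)
      nlinarith [mul_nonneg (show 0 ≤ 2 * (H * α / 3) by positivity) (sub_nonneg.2 h)]
  have hδ0 : 0 ≤ δ := le_trans (by positivity) h1
  refine (min_le_right _ _).trans ?_
  calc α * μ ^ 2 * δ ^ (-(α + 1))
      ≤ α * ((a * c) ^ (2 * H + 2 * (H * α / 3)) * b ^ (-(4 * (H * α / 3)))) *
        (k * (a * c) ^ (2 * H)) ^ (-(α + 1)) := by
        have := Real.rpow_le_rpow_of_nonpos (by positivity) h1 (show -(α + 1) ≤ 0 by linarith)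
        gcongr
    _ = α * k ^ (-(α + 1)) * ((a * c) ^ (2 * H + 2 * (H * α / 3))
          * (a * c) ^ (2 * H * -(α + 1)) * b ^ (-(4 * (H * α / 3)))) := by
        rw [Real.mul_rpow hk.le (by positivity), ← Real.rpow_mul hac.le]
        ring
    _ = _ := by
        rw [← Real.rpow_add hac, show a * b * c = a * c * b by ring, Real.mul_rpow hac.le hb.le]
        ring_nf

/-- With `r = b/x ≤ 1` and `2H ≤ 2`, one has `(1 + r)^{2H} ≤ (1 + r)² ≤ 1 + 3r`. -/
lemma add_rpow_sub_rpow_le {H x b : ℝ} (hH' : H < 1) (hb : 0 < b) (hbx : b ≤ x) :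
    (x + b) ^ (2 * H) - x ^ (2 * H) ≤ 3 * (b * x ^ (2 * H - 1)) := by
  have hx : 0 < x := hb.trans_le hbx
  have e : x + b = x * (1 + b / x) := by field_simp
  have h0 : 0 < b / x := by positivity
  have h1 : b / x ≤ 1 := (div_le_one hx).2 hbx
  have h2 : (1 + b / x) ^ (2 * H) ≤ 1 + 3 * (b / x) := by
    calc (1 + b / x) ^ (2 * H) ≤ (1 + b / x) ^ (2 : ℝ) :=
          Real.rpow_le_rpow_of_exponent_le (by linarith) (by linarith)
      _ = (1 + b / x) ^ 2 := by norm_cast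
      _ ≤ _ := by nlinarith
  rw [e, Real.mul_rpow hx.le (by positivity), Real.rpow_sub_one hx.ne']
  have := mul_le_mul_of_nonneg_left h2 (show 0 ≤ x ^ (2 * H) by positivity)
  calc _ ≤ x ^ (2 * H) * (1 + 3 * (b / x)) - x ^ (2 * H) := by linarith
    _ = _ := by ring

/-- Nested increments; `m ≤ M` are the two outer gaps. -/
lemma detBound_le_of_nested {H α k m M b δ μ : ℝ} (hH : 0 < H) (hα : 1 ≤ α)
    (hαH : 4 * H * α < 3) (hk : 0 < k) (hm : 0 < m) (hmM : m ≤ M) (hb : 0 < b)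
    (h1 : k * (b * M) ^ (2 * H) ≤ δ)
    (h2 : 2 * μ = (m + b) ^ (2 * H) - m ^ (2 * H) + ((M + b) ^ (2 * H) - M ^ (2 * H))) :
    detBound α δ μ ≤ (k ^ (-α) + 9 * α * k ^ (-(α + 1))) * (b * m * M) ^ (-(4 * H * α / 3)) := by
  have hM : 0 < M := hm.trans_le hmM
  have hH1 : 4 * H < 3 := by nlinarith
  rw [add_mul]
  -- If `m² ≤ bM`, the bound `δ^{-α}` alone suffices. Otherwise `b ≤ m`: the inner increment is
  -- short against both outer gaps, its covariance with the outer one is small, and the tangent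
  -- bound is used.
  rcases le_total (m ^ 2) (b * M) with h | h
  · refine (min_le_left _ _).trans (le_trans ?_ (le_add_of_nonneg_right (by positivity)))
    refine (Real.rpow_le_rpow_of_nonpos (by positivity) h1 (by linarith)).trans ?_
    rw [Real.mul_rpow hk.le (by positivity)]
    gcongr
    obtain ⟨A, rfl⟩ : ∃ A, b = Real.exp A := ⟨_, (Real.exp_log hb).symm⟩
    obtain ⟨L, rfl⟩ : ∃ L, m = Real.exp L := ⟨_, (Real.exp_log hm).symm⟩
    obtain ⟨N, rfl⟩ : ∃ N, M = Real.exp N := ⟨_, (Real.exp_log hM).symm⟩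
    simp only [← Real.exp_mul, ← Real.exp_add, ← Real.exp_nat_mul, Real.exp_le_exp] at h ⊢
    push_cast at h
    nlinarith [mul_nonneg (show 0 ≤ H * α by positivity) (sub_nonneg.2 h)]
  · have hbm : b ≤ m := by nlinarith
    have e1 := add_rpow_sub_rpow_le (H := H) (by linarith) hb hbm
    have e2 := add_rpow_sub_rpow_le (H := H) (by linarith) hb (hbm.trans hmM)
    have e3 : 0 ≤ 2 * μ := by
      rw [h2]
      have := Real.rpow_le_rpow hm.le (show m ≤ m + b by linarith) (show 0 ≤ 2 * H by linarith)
      have := Real.rpow_le_rpow hM.le (show M ≤ M + b by linarith) (show 0 ≤ 2 * H by linarith)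
      linarith
    have hμ : μ ^ 2 ≤ 9 / 2 * ((b * m ^ (2 * H - 1)) ^ 2 + (b * M ^ (2 * H - 1)) ^ 2) := by
      have : μ ≤ 3 / 2 * (b * m ^ (2 * H - 1) + b * M ^ (2 * H - 1)) := by linarith
      nlinarith [sq_nonneg (b * m ^ (2 * H - 1) - b * M ^ (2 * H - 1))]
    refine (min_le_right _ _).trans (le_trans ?_ (le_add_of_nonneg_left (by positivity)))
    have hδ := Real.rpow_le_rpow_of_nonpos (by positivity) h1 (show -(α + 1) ≤ 0 by linarith)
    rw [Real.mul_rpow hk.le (by positivity)] at hδ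
    have key : ∀ x, x = m ∨ x = M → (b * x ^ (2 * H - 1)) ^ 2 * ((b * M) ^ (2 * H)) ^ (-(α + 1))
        ≤ (b * m * M) ^ (-(4 * H * α / 3)) := by
      obtain ⟨A, rfl⟩ : ∃ A, b = Real.exp A := ⟨_, (Real.exp_log hb).symm⟩
      obtain ⟨L, rfl⟩ : ∃ L, m = Real.exp L := ⟨_, (Real.exp_log hm).symm⟩
      obtain ⟨N, rfl⟩ : ∃ N, M = Real.exp N := ⟨_, (Real.exp_log hM).symm⟩
      rw [Real.exp_le_exp] at hbm hmM
      have f1 := mul_nonneg (show 0 ≤ 2 - 2 * H - 2 * (H * α) / 3 by nlinarith) (sub_nonneg.2 hbm)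
      have f2 := mul_nonneg (show 0 ≤ 2 * H + 2 * (H * α) / 3 by positivity) (sub_nonneg.2 hmM)
      have f3 := mul_nonneg (show 0 ≤ 2 - 2 * H + 2 * (H * α) / 3 by
        have : 0 < H * α := by positivity
        linarith) (sub_nonneg.2 hmM)
      rintro x (rfl | rfl) <;>
      · simp only [← Real.exp_mul, ← Real.exp_add, ← Real.exp_nat_mul, Real.exp_le_exp]
        push_cast
        linarith
    have hδ0 : 0 ≤ δ := le_trans (by positivity) h1
    have k1 := key m (Or.inl rfl)
    have k2 := key M (Or.inr rfl)
    calc α * μ ^ 2 * δ ^ (-(α + 1))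
        ≤ α * (9 / 2 * ((b * m ^ (2 * H - 1)) ^ 2 + (b * M ^ (2 * H - 1)) ^ 2)) *
          (k ^ (-(α + 1)) * ((b * M) ^ (2 * H)) ^ (-(α + 1))) := by gcongr
      _ = 9 / 2 * α * k ^ (-(α + 1)) *
          ((b * m ^ (2 * H - 1)) ^ 2 * ((b * M) ^ (2 * H)) ^ (-(α + 1))
            + (b * M ^ (2 * H - 1)) ^ 2 * ((b * M) ^ (2 * H)) ^ (-(α + 1))) := by ring
      _ ≤ 9 / 2 * α * k ^ (-(α + 1)) *
          ((b * m * M) ^ (-(4 * H * α / 3)) + (b * m * M) ^ (-(4 * H * α / 3))) := by gcongr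
      _ = _ := by ring

/-- The covariance of disjoint increments. -/
lemma abs_second_difference_rpow_le {H a b c : ℝ} (hH : 0 < H) (hH' : H < 1) (ha : 0 < a)
    (hb : 0 < b) (hc : 0 < c) :
    |(a + b + c) ^ (2 * H) - (a + b) ^ (2 * H) - ((b + c) ^ (2 * H) - b ^ (2 * H))|
      ≤ 2 * (a * c * b ^ (2 * H - 2)) := by
  have d1 : ∀ r x : ℝ, 0 < x → HasDerivAt (fun x : ℝ => x ^ r) (r * x ^ (r - 1)) x := fun r x hx =>
    Real.hasDerivAt_rpow_const (Or.inl hx.ne')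
  -- The mean value inequality is applied twice to the mixed second difference of `x^{2H}`. As `2H -
  -- 2 < 0`, the second derivative is largest at the left end `b`, and `|2H (2H - 1)| ≤ 2`.
  have s1 : ∀ x ∈ Set.Icc b (a + b),
      ‖2 * H * (x + c) ^ (2 * H - 1) - 2 * H * x ^ (2 * H - 1)‖ ≤ 2 * c * b ^ (2 * H - 2) := by
    intro x hx
    have hx0 : 0 < x := hb.trans_le hx.1
    have := Convex.norm_image_sub_le_of_norm_hasDerivWithin_le (s := Set.Icc x (x + c))
      (f := fun x : ℝ => x ^ (2 * H - 1)) (f' := fun y => (2 * H - 1) * y ^ (2 * H - 1 - 1))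
      (C := |2 * H - 1| * b ^ (2 * H - 2))
      (fun y hy => (d1 (2 * H - 1) y (hx0.trans_le hy.1)).hasDerivWithinAt)
      (fun y hy => by
        have hy0 : 0 < y := hx0.trans_le hy.1
        rw [norm_mul, Real.norm_eq_abs, Real.norm_of_nonneg (by positivity),
          show 2 * H - 1 - 1 = 2 * H - 2 by ring]
        exact mul_le_mul_of_nonneg_left
          (Real.rpow_le_rpow_of_nonpos hb (hx.1.trans hy.1) (by linarith)) (abs_nonneg _))
      (convex_Icc _ _) (Set.left_mem_Icc.2 (by linarith)) (Set.right_mem_Icc.2 (by linarith))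
    rw [← mul_sub, norm_mul, Real.norm_of_nonneg (show 0 ≤ 2 * H by linarith)]
    simp only [add_sub_cancel_left, Real.norm_of_nonneg hc.le] at this
    refine (mul_le_mul_of_nonneg_left this (by linarith)).trans ?_
    have h1 : |2 * H - 1| ≤ 1 := abs_le.2 ⟨by linarith, by linarith⟩
    calc 2 * H * (|2 * H - 1| * b ^ (2 * H - 2) * c) = (2 * (H * |2 * H - 1|)) * (c * b ^ (2 * H - 2)) := by ring
      _ ≤ (2 * (1 * 1)) * (c * b ^ (2 * H - 2)) := by gcongr
      _ = _ := by ring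
  have := Convex.norm_image_sub_le_of_norm_hasDerivWithin_le (s := Set.Icc b (a + b))
    (f := fun x : ℝ => (x + c) ^ (2 * H) - x ^ (2 * H))
    (f' := fun x => 2 * H * (x + c) ^ (2 * H - 1) - 2 * H * x ^ (2 * H - 1))
    (fun x hx => by
      have hx0 : 0 < x := hb.trans_le hx.1
      exact (((d1 (2 * H) (x + c) (by linarith)).comp_add_const x c).sub
        (d1 (2 * H) x hx0)).hasDerivWithinAt) s1
    (convex_Icc _ _) (Set.left_mem_Icc.2 (by linarith)) (Set.right_mem_Icc.2 (by linarith))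
  simp only [add_sub_cancel_right, Real.norm_of_nonneg ha.le] at this
  calc _ = ‖(a + b + c) ^ (2 * H) - (a + b) ^ (2 * H) - ((b + c) ^ (2 * H) - b ^ (2 * H))‖ := rfl
    _ ≤ _ := this
    _ = _ := by ring

/-! ### Domination of the kernel by products of gaps. -/

/-- The product of the gaps along the path `x, y, z, w`, raised to the power `-γ`. -/
noncomputable def pathKernel (γ x y z w : ℝ) : ℝ := (|x - y| * |y - z| * |z - w|) ^ (-γ)

/-- The sum of the path kernels over the three orderings of `t, s, t', s'` starting from `s`. -/
noncomputable def halfPathSum (γ : ℝ) (p q : ℝ × ℝ) : ℝ :=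
  pathKernel γ p.2 q.2 p.1 q.1 + pathKernel γ p.2 q.2 q.1 p.1 + pathKernel γ p.2 p.1 q.2 q.1

/-- The sum of the path kernels over the six orderings of `t, s, t', s'`. -/
noncomputable def pathSum (γ : ℝ) (p q : ℝ × ℝ) : ℝ := halfPathSum γ p q + halfPathSum γ q p

lemma pathKernel_nonneg (γ x y z w : ℝ) : 0 ≤ pathKernel γ x y z w := by
  unfold pathKernel
  positivity

lemma halfPathSum_nonneg (γ : ℝ) (p q : ℝ × ℝ) : 0 ≤ halfPathSum γ p q :=
  add_nonneg (add_nonneg (pathKernel_nonneg _ _ _ _ _) (pathKernel_nonneg _ _ _ _ _))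
    (pathKernel_nonneg _ _ _ _ _)

/-- The constant in the domination of the covariance kernel. -/
noncomputable def domConst (H α : ℝ) : ℝ :=
  lndConst H ^ (-α) + 9 * α * lndConst H ^ (-(α + 1))

lemma domConst_nonneg {H α : ℝ} (hH : 0 < H) (hH' : H < 1) (hα : 0 < α) : 0 ≤ domConst H α := by
  have := lndConst_pos hH hH'
  unfold domConst
  positivity

/-- If `p` starts first, the remaining three times leave the disjoint, interlaced and nested
orderings. The condition `4Hα < 3` guards only the bound, since positivity of the determinant is
also needed in the divergent regime. -/
lemma incDet_pos_and_detBound_le_of_lt {H α : ℝ} (hH : 0 < H) (hH' : H < 1) (hα : 1 ≤ α)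
    {p q : ℝ × ℝ} (hp : p.2 < p.1) (hq : q.2 < q.1) (h : p.2 < q.2)
    (h1 : p.1 ≠ q.1) (h2 : p.1 ≠ q.2) :
    0 < incDet H p q ∧ (4 * H * α < 3 →
      detBound α (incDet H p q) (incCov H p q)
        ≤ domConst H α * halfPathSum (4 * H * α / 3) p q) := by
  obtain ⟨t, s⟩ := p
  obtain ⟨t', s'⟩ := q
  simp only at hp hq h h1 h2
  have hk := lndConst_pos hH hH'
  have hα0 : 0 < α := by linarith
  have k1 := pathKernel_nonneg (4 * H * α / 3) s s' t t'
  have k2 := pathKernel_nonneg (4 * H * α / 3) s s' t' t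
  have k3 := pathKernel_nonneg (4 * H * α / 3) s t s' t'
  have hC : ∀ c x, 0 ≤ x → c ≤ domConst H α → c * x ≤ domConst H α * x := fun c x hx hc =>
    mul_le_mul_of_nonneg_right hc hx
  have hC0 := domConst_nonneg hH hH' hα0
  have c1 : lndConst H ^ (-α) ≤ domConst H α := by
    unfold domConst
    have : 0 ≤ 9 * α * lndConst H ^ (-(α + 1)) := by positivity
    linarith
  have c2 : α * lndConst H ^ (-(α + 1)) ≤ domConst H α := by
    unfold domConst
    have : 0 ≤ α * lndConst H ^ (-(α + 1)) := by positivity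
    have : 0 ≤ lndConst H ^ (-α) := by positivity
    linarith
  simp only [halfPathSum]
  rcases lt_or_gt_of_ne h2 with hts | hts
  -- Disjoint: `s < t < s' < t'`.
  · obtain ⟨a, ha, rfl⟩ : ∃ a, 0 < a ∧ t = s + a := ⟨t - s, by linarith, by ring⟩
    obtain ⟨b, hb, rfl⟩ : ∃ b, 0 < b ∧ s' = s + a + b := ⟨s' - (s + a), by linarith, by ring⟩
    obtain ⟨c, hc, rfl⟩ : ∃ c, 0 < c ∧ t' = s + a + b + c := ⟨t' - (s + a + b), by linarith, by ring⟩
    have e1 : incCov H (s + a, s) (s + a, s) = a ^ (2 * H) := by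
      rw [incCov_self hH]; simp [abs_of_pos ha]
    have e2 : incCov H (s + a + b + c, s + a + b) (s + a + b + c, s + a + b) = c ^ (2 * H) := by
      rw [incCov_self hH]; simp [abs_of_pos hc]
    have e3 : 2 * incCov H (s + a, s) (s + a + b + c, s + a + b) =
        (a + b + c) ^ (2 * H) - (a + b) ^ (2 * H) - ((b + c) ^ (2 * H) - b ^ (2 * H)) := by
      simp only [incCov]
      rw [show s + a - (s + a + b) = -b by ring, show s - (s + a + b + c) = -(a + b + c) by ring,
        show s + a - (s + a + b + c) = -(b + c) by ring, show s - (s + a + b) = -(a + b) by ring]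
      simp only [abs_neg]
      rw [abs_of_pos hb, abs_of_pos (show 0 < a + b + c by positivity),
        abs_of_pos (show 0 < b + c by positivity), abs_of_pos (show 0 < a + b by positivity)]
      ring
    have l1 := le_incDet_of_le hH hH' (s + a, s) (s + a + b + c, s + a + b) (z := s + a + b)
      (by simp; linarith) (by simp; linarith) (by simp) (by simp; linarith)
    rw [e1, add_sub_cancel_left, ← Real.mul_rpow ha.le hc.le] at l1
    have hpos := lt_of_lt_of_le (show 0 < lndConst H * (a * c) ^ (2 * H) by positivity) l1
    refine ⟨hpos, fun hαH => ?_⟩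
    have l2 : |incCov H (s + a, s) (s + a + b + c, s + a + b)| ≤ a * c * b ^ (2 * H - 2) := by
      have := abs_second_difference_rpow_le hH hH' ha hb hc
      rw [← e3, abs_mul, abs_two] at this
      linarith
    have l3 : incCov H (s + a, s) (s + a + b + c, s + a + b) ^ 2 ≤ (a * c) ^ (2 * H) := by
      rw [incDet, e1, e2] at hpos
      rw [Real.mul_rpow ha.le hc.le]
      linarith
    have := detBound_le_of_disjoint hH hα hαH hk ha hb hc l1 l2 l3
    have e4 : (a * b * c) ^ (-(4 * H * α / 3))
        = pathKernel (4 * H * α / 3) s (s + a) (s + a + b) (s + a + b + c) := by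
      simp [pathKernel, abs_of_pos ha, abs_of_pos hb, abs_of_pos hc]
    rw [e4] at this
    have := this.trans (hC _ _ k3 c2)
    nlinarith
  · obtain ⟨a, ha, rfl⟩ : ∃ a, 0 < a ∧ s' = s + a := ⟨s' - s, by linarith, by ring⟩
    rcases lt_or_gt_of_ne h1 with htt | htt
    -- Interlaced: `s < s' < t < t'`; each increment has an innovation with respect to the other.
    · obtain ⟨b, hb, rfl⟩ : ∃ b, 0 < b ∧ t = s + a + b := ⟨t - (s + a), by linarith, by ring⟩
      obtain ⟨c, hc, rfl⟩ : ∃ c, 0 < c ∧ t' = s + a + b + c := ⟨t' - (s + a + b), by linarith, by ring⟩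
      have e1 : incCov H (s + a + b, s) (s + a + b, s) = (a + b) ^ (2 * H) := by
        rw [incCov_self hH, show s + a + b - s = a + b by ring, abs_of_pos (by positivity)]
      have e2 : incCov H (s + a + b + c, s + a) (s + a + b + c, s + a) = (b + c) ^ (2 * H) := by
        rw [incCov_self hH, show s + a + b + c - (s + a) = b + c by ring,
          abs_of_pos (by positivity)]
      have l1 := le_incDet_of_le hH hH' (s + a + b, s) (s + a + b + c, s + a) (z := s + a + b)
        (by simp) (by simp; linarith) (by simp; linarith) (by simp; linarith)
      have l2 := le_incDet_of_ge hH hH' (s + a + b + c, s + a) (s + a + b, s) (z := s + a)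
        (by simp; linarith) (by simp) (by simp; linarith) (by simp; linarith)
      rw [e1, add_sub_cancel_left] at l1
      rw [e2, add_sub_cancel_left, incDet_comm] at l2
      refine ⟨lt_of_lt_of_le (by positivity) l1, fun hαH => ?_⟩
      have := detBound_le_of_interlaced (μ := incCov H (s + a + b, s) (s + a + b + c, s + a))
        hH hα0 hk ha hb hc l1 l2
      have e4 : (a * b * c) ^ (-(4 * H * α / 3))
          = pathKernel (4 * H * α / 3) s (s + a) (s + a + b) (s + a + b + c) := by
        simp [pathKernel, abs_of_pos ha, abs_of_pos hb, abs_of_pos hc]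
      rw [e4] at this
      have := this.trans (hC _ _ k1 c1)
      nlinarith
    -- Nested: `s < s' < t' < t`. Conditioning is on the inner increment; the outer one has
    -- innovations on both sides, and the longer outer gap is used as `M`.
    · obtain ⟨b, hb, rfl⟩ : ∃ b, 0 < b ∧ t' = s + a + b := ⟨t' - (s + a), by linarith, by ring⟩
      obtain ⟨c, hc, rfl⟩ : ∃ c, 0 < c ∧ t = s + a + b + c := ⟨t - (s + a + b), by linarith, by ring⟩
      have e2 : incCov H (s + a + b, s + a) (s + a + b, s + a) = b ^ (2 * H) := by
        rw [incCov_self hH]; simp [abs_of_pos hb]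
      have l1 := le_incDet_of_le hH hH' (s + a + b, s + a) (s + a + b + c, s) (z := s + a + b)
        (by simp) (by simp; linarith) (by simp; linarith) (by simp; linarith)
      have l2 := le_incDet_of_ge hH hH' (s + a + b, s + a) (s + a + b + c, s) (z := s + a)
        (by simp; linarith) (by simp) (by simp; linarith) (by simp; linarith)
      rw [e2, add_sub_cancel_left, incDet_comm, ← Real.mul_rpow hb.le hc.le] at l1
      rw [e2, add_sub_cancel_left, incDet_comm, ← Real.mul_rpow hb.le ha.le] at l2
      have hpos := lt_of_lt_of_le (show 0 < lndConst H * (b * c) ^ (2 * H) by positivity) l1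
      refine ⟨hpos, fun hαH => ?_⟩
      have e3 : 2 * incCov H (s + a + b + c, s) (s + a + b, s + a) =
          (a + b) ^ (2 * H) - a ^ (2 * H) + ((c + b) ^ (2 * H) - c ^ (2 * H)) := by
        simp only [incCov]
        rw [show s + a + b + c - (s + a) = c + b by ring, show s - (s + a + b) = -(a + b) by ring,
          show s + a + b + c - (s + a + b) = c by ring, show s - (s + a) = -a by ring]
        simp only [abs_neg]
        rw [abs_of_pos hc, abs_of_pos ha, abs_of_pos (show 0 < c + b by positivity),
          abs_of_pos (show 0 < a + b by positivity)]
        ring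
      have e4 : (a * b * c) ^ (-(4 * H * α / 3))
          = pathKernel (4 * H * α / 3) s (s + a) (s + a + b) (s + a + b + c) := by
        simp [pathKernel, abs_of_pos ha, abs_of_pos hb, abs_of_pos hc]
      have : detBound α (incDet H (s + a + b + c, s) (s + a + b, s + a))
          (incCov H (s + a + b + c, s) (s + a + b, s + a))
          ≤ domConst H α * (a * b * c) ^ (-(4 * H * α / 3)) := by
        rcases le_total a c with hac | hac
        · refine (detBound_le_of_nested hH hα hαH hk ha hac hb l1 e3).trans_eq ?_
          rw [domConst, show b * a * c = a * b * c by ring]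
        · refine (detBound_le_of_nested hH hα hαH hk hc hac hb l2 (e3.trans (add_comm _ _))).trans_eq ?_
          rw [domConst, show b * c * a = a * b * c by ring]
      rw [e4] at this
      nlinarith

/-- Domination of the covariance kernel by path kernels. -/
lemma incDet_pos_and_detBound_le {H α : ℝ} (hH : 0 < H) (hH' : H < 1) (hα : 1 ≤ α)
    {p q : ℝ × ℝ} (hp : p.2 < p.1) (hq : q.2 < q.1) (h1 : p.1 ≠ q.1) (h2 : p.1 ≠ q.2)
    (h3 : p.2 ≠ q.1) (h4 : p.2 ≠ q.2) :
    0 < incDet H p q ∧ (4 * H * α < 3 →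
      detBound α (incDet H p q) (incCov H p q)
        ≤ domConst H α * pathSum (4 * H * α / 3) p q) := by
  have hC0 := domConst_nonneg hH hH' (show 0 < α by linarith)
  rw [pathSum, mul_add]
  rcases lt_or_gt_of_ne h4 with h | h
  · obtain ⟨r1, r2⟩ := incDet_pos_and_detBound_le_of_lt hH hH' hα hp hq h h1 h2
    exact ⟨r1, fun hh => (r2 hh).trans
      (le_add_of_nonneg_right (mul_nonneg hC0 (halfPathSum_nonneg _ _ _)))⟩
  · obtain ⟨r1, r2⟩ := incDet_pos_and_detBound_le_of_lt hH hH' hα hq hp h h1.symm h3.symm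
    rw [incDet_comm, incCov_comm] at r2
    rw [incDet_comm] at r1
    exact ⟨r1, fun hh => (r2 hh).trans
      (le_add_of_nonneg_left (mul_nonneg hC0 (halfPathSum_nonneg _ _ _)))⟩

/-! ### Time measures and integrability of the path kernels. -/

/-- Lebesgue measure on `(0, T]`. -/
noncomputable def timeMeasure (T : ℝ) : Measure ℝ := volume.restrict (Set.Ioc 0 T)

/-- The triangle `0 < s < t ≤ T` of pairs `(t, s)`. -/
def triangle (T : ℝ) : Set (ℝ × ℝ) := {p | 0 < p.2 ∧ p.2 < p.1 ∧ p.1 ≤ T}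

/-- Lebesgue measure on the triangle `0 < s < t ≤ T`. -/
noncomputable def triangleMeasure (T : ℝ) : Measure (ℝ × ℝ) := volume.restrict (triangle T)

instance (T : ℝ) : IsFiniteMeasure (timeMeasure T) := by
  unfold timeMeasure
  infer_instance

lemma measurableSet_triangle (T : ℝ) : MeasurableSet (triangle T) :=
  (measurableSet_lt measurable_const measurable_snd).inter
    ((measurableSet_lt measurable_snd measurable_fst).inter
      (measurableSet_le measurable_fst measurable_const))

lemma triangle_subset (T : ℝ) : triangle T ⊆ Set.Ioc 0 T ×ˢ Set.Ioc 0 T := fun _ hp =>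
  ⟨⟨hp.1.trans hp.2.1, hp.2.2⟩, hp.1, hp.2.1.le.trans hp.2.2⟩

lemma triangleMeasure_le (T : ℝ) : triangleMeasure T ≤ (timeMeasure T).prod (timeMeasure T) := by
  rw [timeMeasure, Measure.prod_restrict, ← Measure.volume_eq_prod]
  exact Measure.restrict_mono (triangle_subset T) le_rfl

instance (T : ℝ) : IsFiniteMeasure (triangleMeasure T) :=
  isFiniteMeasure_of_le _ (triangleMeasure_le T)

lemma triangleMeasure_prod_le (T : ℝ) : (triangleMeasure T).prod (triangleMeasure T) ≤
    ((timeMeasure T).prod (timeMeasure T)).prod ((timeMeasure T).prod (timeMeasure T)) := by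
  simp only [timeMeasure, Measure.prod_restrict, triangleMeasure]
  exact Measure.restrict_mono (Set.prod_mono (triangle_subset T) (triangle_subset T)) le_rfl

lemma integrableOn_abs_rpow {γ : ℝ} (hγ : γ < 1) :
    IntegrableOn (fun x : ℝ => |x| ^ (-γ)) (Set.Ioc (-1) 1) := by
  have h1 : IntervalIntegrable (fun x : ℝ => |x| ^ (-γ)) volume 0 1 := by
    refine (intervalIntegral.intervalIntegrable_rpow' (r := -γ) (by linarith)).congr ?_
    intro x hx
    rw [Set.uIoc_of_le zero_le_one] at hx
    simp [abs_of_pos hx.1]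
  have h2 : IntervalIntegrable (fun x : ℝ => |x| ^ (-γ)) volume (-1) 0 := by
    have := h1.comp_mul_left (c := -1)
    norm_num at this
    exact this.symm
  rw [← intervalIntegrable_iff_integrableOn_Ioc_of_le (by norm_num)]
  exact h2.trans h1

/-- Uniformity in `x` is the point: it allows the vertices of a path to be integrated out one at a
time. For `|x - y| ≥ 1` the integrand is at most `1`. -/
lemma exists_lintegral_abs_sub_rpow_le {γ : ℝ} (hγ0 : 0 ≤ γ) (hγ : γ < 1) (T : ℝ) :
    ∃ M : ℝ≥0∞, M < ∞ ∧
      ∀ x, ∫⁻ y, ENNReal.ofReal (|x - y| ^ (-γ)) ∂timeMeasure T ≤ M := by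
  set g : ℝ → ℝ≥0∞ := fun u => ENNReal.ofReal (|u| ^ (-γ)) with hg
  refine ⟨(∫⁻ u in Set.Ioc (-1) 1, g u) + timeMeasure T Set.univ, ?_, fun x => ?_⟩
  · refine ENNReal.add_lt_top.2 ⟨?_, measure_lt_top _ _⟩
    exact (integrableOn_abs_rpow hγ).lintegral_lt_top
  · calc ∫⁻ y, g (x - y) ∂timeMeasure T
        ≤ ∫⁻ y, ((Set.Ioc (-1) 1).indicator g (x - y) + 1) ∂timeMeasure T := by
          refine lintegral_mono fun y => ?_
          by_cases hy : x - y ∈ Set.Ioc (-1 : ℝ) 1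
          · simp [Set.indicator_of_mem hy]
          · rw [Set.indicator_of_notMem hy, zero_add, ENNReal.ofReal_le_one]
            have h1 : 1 ≤ |x - y| := by
              by_contra! hlt
              rw [abs_lt] at hlt
              exact hy ⟨hlt.1, hlt.2.le⟩
            exact Real.rpow_le_one_of_one_le_of_nonpos h1 (by linarith)
      _ = (∫⁻ y, (Set.Ioc (-1) 1).indicator g (x - y) ∂timeMeasure T)
          + timeMeasure T Set.univ := by
          rw [lintegral_add_right _ measurable_const, lintegral_one]
      _ ≤ (∫⁻ y, (Set.Ioc (-1) 1).indicator g (x - y)) + timeMeasure T Set.univ := by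
          gcongr
          exact Measure.restrict_le_self
      _ = _ := by
          rw [lintegral_sub_left_eq_self, lintegral_indicator measurableSet_Ioc]

/-- Integrability of a function of four times over `(0, T]⁴`. -/
def Integrable4 (T : ℝ) (F : ℝ → ℝ → ℝ → ℝ → ℝ) : Prop :=
  Integrable (fun x : (ℝ × ℝ) × (ℝ × ℝ) => F x.1.1 x.1.2 x.2.1 x.2.2)
    (((timeMeasure T).prod (timeMeasure T)).prod ((timeMeasure T).prod (timeMeasure T)))

/-- In a path of gaps the last vertex occurs in one factor only. Integrating it out costs a constant
`M`, and the procedure is repeated towards the first vertex. -/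
lemma integrable4_pathKernel {γ : ℝ} (hγ0 : 0 ≤ γ) (hγ : γ < 1) (T : ℝ) :
    Integrable4 T (pathKernel γ) := by
  obtain ⟨M, hM, hMle⟩ := exists_lintegral_abs_sub_rpow_le hγ0 hγ T
  set g : ℝ → ℝ≥0∞ := fun u => ENNReal.ofReal (|u| ^ (-γ)) with hg
  have hgm : Measurable g := by
    have : Measurable fun u : ℝ => |u| ^ (-γ) := (measurable_id.abs).pow_const _
    exact this.ennreal_ofReal
  have hgm2 : Measurable fun z : ℝ × ℝ => g (z.1 - z.2) :=
    hgm.comp (measurable_fst.sub measurable_snd)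
  have hm : Measurable fun x : (ℝ × ℝ) × (ℝ × ℝ) => pathKernel γ x.1.1 x.1.2 x.2.1 x.2.2 := by
    unfold pathKernel
    fun_prop
  refine ⟨hm.aestronglyMeasurable, ?_⟩
  rw [hasFiniteIntegral_iff_ofReal (ae_of_all _ fun x => pathKernel_nonneg _ _ _ _ _)]
  have e : ∀ x : (ℝ × ℝ) × (ℝ × ℝ), ENNReal.ofReal (pathKernel γ x.1.1 x.1.2 x.2.1 x.2.2)
      = g (x.1.1 - x.1.2) * (g (x.1.2 - x.2.1) * g (x.2.1 - x.2.2)) := fun x => by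
    simp only [pathKernel, hg]
    rw [Real.mul_rpow (by positivity) (by positivity), Real.mul_rpow (by positivity)
      (by positivity), ENNReal.ofReal_mul (by positivity), ENNReal.ofReal_mul (by positivity),
      mul_assoc]
  simp only [e]
  have m3 : Measurable fun x : (ℝ × ℝ) × (ℝ × ℝ) =>
      g (x.1.1 - x.1.2) * (g (x.1.2 - x.2.1) * g (x.2.1 - x.2.2)) := by fun_prop
  rw [lintegral_prod _ m3.aemeasurable]
  have inner : ∀ y : ℝ, ∫⁻ q : ℝ × ℝ, g (y - q.1) * g (q.1 - q.2)
      ∂((timeMeasure T).prod (timeMeasure T)) ≤ M * M := fun y => by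
    have m2 : Measurable fun q : ℝ × ℝ => g (y - q.1) * g (q.1 - q.2) := by fun_prop
    rw [lintegral_prod _ m2.aemeasurable]
    calc _ ≤ ∫⁻ z, g (y - z) * M ∂timeMeasure T := by
          refine lintegral_mono fun z => ?_
          simp only
          rw [lintegral_const_mul _ (by fun_prop)]
          gcongr
          exact hMle z
      _ = (∫⁻ z, g (y - z) ∂timeMeasure T) * M := lintegral_mul_const _ (by fun_prop)
      _ ≤ M * M := by gcongr; exact hMle y
  have mp : Measurable fun p : ℝ × ℝ => g (p.1 - p.2) * (M * M) := by fun_prop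
  calc _ ≤ ∫⁻ p : ℝ × ℝ, g (p.1 - p.2) * (M * M) ∂((timeMeasure T).prod (timeMeasure T)) := by
        refine lintegral_mono fun p => ?_
        simp only
        rw [lintegral_const_mul _ (by fun_prop)]
        gcongr
        exact inner p.2
    _ = ∫⁻ x, ∫⁻ y, g (x - y) * (M * M) ∂timeMeasure T ∂timeMeasure T :=
        lintegral_prod _ mp.aemeasurable
    _ ≤ ∫⁻ _, M * (M * M) ∂timeMeasure T := by
        refine lintegral_mono fun x => ?_
        simp only
        rw [lintegral_mul_const _ (by fun_prop)]
        gcongr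
        exact hMle x
    _ < ∞ := by
        rw [lintegral_const]
        exact ENNReal.mul_lt_top (ENNReal.mul_lt_top hM (ENNReal.mul_lt_top hM hM))
          (measure_lt_top _ _)

/-- This swap, `swap_left` and `swap_middle` generate all permutations of the four times, so one
ordering of the path yields every ordering in `halfPathSum`. -/
lemma Integrable4.swap_pairs {T : ℝ} {F : ℝ → ℝ → ℝ → ℝ → ℝ} (h : Integrable4 T F) :
    Integrable4 T (fun a b c d => F c d a b) :=
  Integrable.swap h

lemma Integrable4.swap_left {T : ℝ} {F : ℝ → ℝ → ℝ → ℝ → ℝ} (h : Integrable4 T F) :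
    Integrable4 T (fun a b c d => F b a c d) := by
  have hp : MeasurePreserving (Prod.map Prod.swap id : (ℝ × ℝ) × (ℝ × ℝ) → _)
      (((timeMeasure T).prod (timeMeasure T)).prod ((timeMeasure T).prod (timeMeasure T)))
      (((timeMeasure T).prod (timeMeasure T)).prod ((timeMeasure T).prod (timeMeasure T))) :=
    Measure.measurePreserving_swap.prod (MeasurePreserving.id _)
  exact hp.integrable_comp_of_integrable h

lemma Integrable4.swap_middle {T : ℝ} {F : ℝ → ℝ → ℝ → ℝ → ℝ} (h : Integrable4 T F) :
    Integrable4 T (fun a b c d => F a c b d) := by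
  set J := timeMeasure T
  have h1 := measurePreserving_prodAssoc J J (J.prod J)
  have h2 : MeasurePreserving (Prod.map id MeasurableEquiv.prodAssoc.symm : ℝ × (ℝ × (ℝ × ℝ)) → _)
      (J.prod (J.prod (J.prod J))) (J.prod ((J.prod J).prod J)) :=
    (MeasurePreserving.id J).prod (measurePreserving_prodAssoc J J J).symm
  have h3 : MeasurePreserving (Prod.map id (Prod.map Prod.swap id) : ℝ × ((ℝ × ℝ) × ℝ) → _)
      (J.prod ((J.prod J).prod J)) (J.prod ((J.prod J).prod J)) :=
    (MeasurePreserving.id J).prod (Measure.measurePreserving_swap.prod (MeasurePreserving.id _))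
  have h4 : MeasurePreserving (Prod.map id MeasurableEquiv.prodAssoc : ℝ × ((ℝ × ℝ) × ℝ) → _)
      (J.prod ((J.prod J).prod J)) (J.prod (J.prod (J.prod J))) :=
    (MeasurePreserving.id J).prod (measurePreserving_prodAssoc J J J)
  have h5 := (measurePreserving_prodAssoc J J (J.prod J)).symm
  have hp := h5.comp (h4.comp (h3.comp (h2.comp h1)))
  exact hp.integrable_comp_of_integrable h

lemma integrable4_halfPathSum {γ : ℝ} (hγ0 : 0 ≤ γ) (hγ : γ < 1) (T : ℝ) :
    Integrable4 T (fun t s t' s' => halfPathSum γ (t, s) (t', s')) := by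
  have h := integrable4_pathKernel hγ0 hγ T
  have swr : ∀ {F : ℝ → ℝ → ℝ → ℝ → ℝ}, Integrable4 T F → Integrable4 T (fun a b c d => F a b d c) :=
    fun hF => hF.swap_pairs.swap_left.swap_pairs
  have k1 : Integrable4 T (fun t s t' s' => pathKernel γ s s' t t') := by
    have := swr h.swap_middle.swap_left
    exact this
  have k2 : Integrable4 T (fun t s t' s' => pathKernel γ s s' t' t) := by
    have := swr (swr h).swap_middle.swap_left
    exact this
  have k3 : Integrable4 T (fun t s t' s' => pathKernel γ s t s' t') := swr h.swap_left
  exact (k1.add k2).add k3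

lemma integrable_pathSum {γ : ℝ} (hγ0 : 0 ≤ γ) (hγ : γ < 1) (T : ℝ) :
    Integrable (fun x : (ℝ × ℝ) × (ℝ × ℝ) => pathSum γ x.1 x.2)
      ((triangleMeasure T).prod (triangleMeasure T)) := by
  have h := integrable4_halfPathSum hγ0 hγ T
  have : Integrable4 T (fun t s t' s' => pathSum γ (t, s) (t', s')) := h.add h.swap_pairs
  exact Integrable.mono_measure this (triangleMeasure_prod_le T)

/-! ### Gaussian moments of heat kernels by Fourier inversion. -/

lemma heatKernel_nonneg {d : ℕ} {ε : ℝ} (hε : 0 < ε) (x : EuclideanSpace ℝ (Fin d)) :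
    0 ≤ heatKernel ε x := by
  unfold heatKernel
  have := Real.pi_pos
  positivity

lemma heatKernel_le {d : ℕ} {ε : ℝ} (hε : 0 < ε) (x : EuclideanSpace ℝ (Fin d)) :
    heatKernel ε x ≤ (2 * Real.pi * ε) ^ (-(d : ℝ) / 2) := by
  have := Real.pi_pos
  refine mul_le_of_le_one_right (by positivity) (Real.exp_le_one_iff.2 ?_)
  exact div_nonpos_of_nonpos_of_nonneg (neg_nonpos.2 (sq_nonneg _)) (by positivity)

lemma measurable_heatKernel (d : ℕ) (ε : ℝ) :
    Measurable (heatKernel ε : EuclideanSpace ℝ (Fin d) → ℝ) := by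
  unfold heatKernel
  fun_prop

/-- The Gaussian integral with variance `1 / a` and a complex linear term. -/
lemma integral_cexp_quadratic_norm {d : ℕ} {a : ℝ} (ha : 0 < a) (c : ℂ)
    (w : EuclideanSpace ℝ (Fin d)) :
    ∫ v : EuclideanSpace ℝ (Fin d), Complex.exp (-(a / 2 : ℝ) * ‖v‖ ^ 2 + c * (inner ℝ w v : ℝ))
      = ((2 * Real.pi / a) ^ ((d : ℝ) / 2) : ℝ) * Complex.exp (c ^ 2 * ‖w‖ ^ 2 / (2 * a)) := by
  have hb : 0 < ((a / 2 : ℝ) : ℂ).re := by rw [Complex.ofReal_re]; positivity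
  have := Real.pi_pos
  have h := GaussianFourier.integral_cexp_neg_mul_sq_norm_add hb c w
  rw [h, Complex.ofReal_cpow (by positivity), finrank_euclideanSpace_fin]
  congr 2
  · push_cast
    field_simp
  · push_cast
    ring
  · push_cast
    ring

lemma integrable_cexp_quadratic_norm {d : ℕ} {a : ℝ} (ha : 0 < a) :
    Integrable fun v : EuclideanSpace ℝ (Fin d) => Complex.exp (-(a / 2 : ℝ) * ‖v‖ ^ 2) := by
  have hb : 0 < ((a / 2 : ℝ) : ℂ).re := by rw [Complex.ofReal_re]; positivity
  simpa using GaussianFourier.integrable_cexp_neg_mul_sq_norm_add hb 0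
    (0 : EuclideanSpace ℝ (Fin d))

lemma two_pi_rpow_mul_div_rpow {x : ℝ} (hx : 0 < x) (c : ℝ) :
    (2 * Real.pi) ^ (-c) * (2 * Real.pi / x) ^ (c / 2)
      = (2 * Real.pi) ^ (-(c / 2)) * x ^ (-(c / 2)) := by
  have hpi := Real.two_pi_pos
  rw [Real.div_rpow hpi.le hx.le, div_eq_mul_inv ((2 * Real.pi) ^ _), ← Real.rpow_neg hx.le,
    ← mul_assoc, ← Real.rpow_add hpi]
  ring_nf

/-- The Fourier representation of the heat kernel. -/
lemma heatKernel_eq_integral {d : ℕ} {ε : ℝ} (hε : 0 < ε) (x : EuclideanSpace ℝ (Fin d)) :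
    (heatKernel ε x : ℂ) = ((2 * Real.pi) ^ (-(d : ℝ)) : ℝ) *
      ∫ v : EuclideanSpace ℝ (Fin d), Complex.exp (-(ε / 2 : ℝ) * ‖v‖ ^ 2) *
        Complex.exp ((inner ℝ x v : ℝ) * Complex.I) := by
  have hpi := Real.pi_pos
  have h := integral_cexp_quadratic_norm hε Complex.I x
  simp only [Complex.exp_add] at h
  simp only [mul_comm _ Complex.I]
  rw [h, heatKernel, neg_div (2 : ℝ) (d : ℝ)]
  rw [← mul_assoc, ← Complex.ofReal_mul, two_pi_rpow_mul_div_rpow hε,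
    ← Real.mul_rpow (by positivity) hε.le, Complex.ofReal_mul _ (Real.exp _), Complex.ofReal_exp]
  congr 2
  push_cast
  rw [Complex.I_sq]
  ring

/-- Fubini for a random phase. -/
lemma integrable_and_integral_phase {Ω V : Type*} [MeasurableSpace Ω] [MeasurableSpace V]
    {P : Measure Ω} [IsProbabilityMeasure P] {m : Measure V} [SFinite m] {g : V → ℂ}
    (hg : Integrable g m) {θ : Ω × V → ℝ} (hθ : AEMeasurable θ (P.prod m)) :
    Integrable (fun v => g v * ∫ ω, Complex.exp (θ (ω, v) * Complex.I) ∂P) m ∧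
    ∫ ω, ∫ v, g v * Complex.exp (θ (ω, v) * Complex.I) ∂m ∂P =
      ∫ v, g v * ∫ ω, Complex.exp (θ (ω, v) * Complex.I) ∂P ∂m := by
  -- The phase has modulus one, so integrability of `g` alone justifies Fubini.
  have hi : Integrable (fun z : Ω × V => g z.2 * Complex.exp (θ z * Complex.I)) (P.prod m) := by
    refine (hg.comp_snd P).mul_bdd (c := 1) ?_ (ae_of_all _ fun z => ?_)
    · exact (((Complex.measurable_ofReal.comp_aemeasurable hθ).mul_const _).cexp).aestronglyMeasurable
    · rw [Complex.norm_exp_ofReal_mul_I]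
  constructor
  · have := hi.integral_prod_right
    simpa only [integral_const_mul] using this
  · rw [integral_integral_swap hi]
    simp only [integral_const_mul]

/-- The expectation becomes a Gaussian integral of the characteristic function. No density of `X`
enters, so the degenerate case `l = 0` is covered. -/
lemma integral_heatKernel_of_charFun {Ω : Type*} [MeasurableSpace Ω] {P : Measure Ω}
    [IsProbabilityMeasure P] {d : ℕ} {X : Ω → EuclideanSpace ℝ (Fin d)} (hX : AEMeasurable X P)
    {l ε : ℝ} (hl : 0 ≤ l) (hε : 0 < ε)
    (h : ∀ v, ∫ ω, Complex.exp ((inner ℝ (X ω) v : ℝ) * Complex.I) ∂P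
      = Complex.exp (-(l * ‖v‖ ^ 2 : ℝ) / 2)) :
    ∫ ω, heatKernel ε (X ω) ∂P
      = (2 * Real.pi) ^ (-(d : ℝ) / 2) * (ε + l) ^ (-((d : ℝ) / 2)) := by
  have hpi := Real.pi_pos
  rw [neg_div (2 : ℝ) (d : ℝ)]
  have hm : AEMeasurable (fun z : Ω × EuclideanSpace ℝ (Fin d) => (inner ℝ (X z.1) z.2 : ℝ))
      (P.prod volume) := hX.comp_fst.inner measurable_snd.aemeasurable
  have h1 := (integrable_and_integral_phase (integrable_cexp_quadratic_norm (d := d) hε) hm).2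
  simp only [h] at h1
  have h2 : ∀ v : EuclideanSpace ℝ (Fin d), Complex.exp (-(ε / 2 : ℝ) * ‖v‖ ^ 2) *
      Complex.exp (-(l * ‖v‖ ^ 2 : ℝ) / 2)
      = Complex.exp (-((ε + l) / 2 : ℝ) * ‖v‖ ^ 2 + 0 * (inner ℝ (0 : EuclideanSpace ℝ (Fin d)) v : ℝ)) := by
    intro v
    rw [← Complex.exp_add]
    congr 1
    push_cast
    ring
  simp only [h2] at h1
  rw [integral_cexp_quadratic_norm (by linarith)] at h1
  rw [← Complex.ofReal_inj, ← integral_complex_ofReal]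
  simp only [heatKernel_eq_integral hε, integral_const_mul]
  rw [h1]
  simp only [ne_eq, OfNat.ofNat_ne_zero, not_false_eq_true, zero_pow, norm_zero,
    Complex.ofReal_zero, mul_zero, zero_div, Complex.exp_zero, mul_one]
  rw [← Complex.ofReal_mul, two_pi_rpow_mul_div_rpow (by linarith)]

lemma integral_heatKernel_mul_of_charFun {Ω : Type*} [MeasurableSpace Ω] {P : Measure Ω}
    [IsProbabilityMeasure P] {d : ℕ} {X Y : Ω → EuclideanSpace ℝ (Fin d)}
    (hX : AEMeasurable X P) (hY : AEMeasurable Y P)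
    {l r m ε η : ℝ} (hl : 0 ≤ l) (hr : 0 ≤ r) (hm : 0 ≤ l * r - m ^ 2) (hε : 0 < ε) (hη : 0 < η)
    (h : ∀ v w, ∫ ω, Complex.exp ((inner ℝ (X ω) v + inner ℝ (Y ω) w : ℝ) * Complex.I) ∂P
      = Complex.exp (-(l * ‖v‖ ^ 2 + 2 * m * inner ℝ v w + r * ‖w‖ ^ 2 : ℝ) / 2)) :
    ∫ ω, heatKernel ε (X ω) * heatKernel η (Y ω) ∂P
      = (2 * Real.pi) ^ (-(d : ℝ)) * ((ε + l) * (η + r) - m ^ 2) ^ (-((d : ℝ) / 2)) := by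
  have hpi := Real.pi_pos
  have hr' : 0 < η + r := by linarith
  have hdet : 0 < (ε + l) * (η + r) - m ^ 2 := by nlinarith [mul_pos hε hη]
  have hθ : AEMeasurable (fun z : Ω × (EuclideanSpace ℝ (Fin d) × EuclideanSpace ℝ (Fin d)) =>
      (inner ℝ (X z.1) z.2.1 + inner ℝ (Y z.1) z.2.2 : ℝ)) (P.prod volume) :=
    (hX.comp_fst.inner measurable_snd.fst.aemeasurable).fun_add
      (hY.comp_fst.inner measurable_snd.snd.aemeasurable)
  have hg : Integrable (fun z : EuclideanSpace ℝ (Fin d) × EuclideanSpace ℝ (Fin d) => Complex.exp (-(ε / 2 : ℝ) * ‖z.1‖ ^ 2) *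
      Complex.exp (-(η / 2 : ℝ) * ‖z.2‖ ^ 2)) volume :=
    (integrable_cexp_quadratic_norm hε).mul_prod (integrable_cexp_quadratic_norm hη)
  obtain ⟨h0, h1⟩ := integrable_and_integral_phase hg hθ
  simp only [h] at h0 h1
  rw [Measure.volume_eq_prod] at h0 h1
  rw [integral_prod _ h0] at h1
  have h2 : ∀ v w : EuclideanSpace ℝ (Fin d), Complex.exp (-(ε / 2 : ℝ) * ‖v‖ ^ 2) * Complex.exp (-(η / 2 : ℝ) * ‖w‖ ^ 2) *
      Complex.exp (-(l * ‖v‖ ^ 2 + 2 * m * inner ℝ v w + r * ‖w‖ ^ 2 : ℝ) / 2)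
      = Complex.exp (-((ε + l) / 2 : ℝ) * ‖v‖ ^ 2) *
        Complex.exp (-((η + r) / 2 : ℝ) * ‖w‖ ^ 2 + (-m : ℂ) * (inner ℝ v w : ℝ)) := by
    intro v w
    simp only [← Complex.exp_add]
    congr 1
    push_cast
    ring
  simp only [h2, integral_const_mul, integral_cexp_quadratic_norm hr'] at h1
  -- Integrating out `w` by completing the square leaves the Schur complement `((ε + l)(η + r) - m²)
  -- / (η + r)` as the coefficient in `v`.
  have h3 : ∀ v : EuclideanSpace ℝ (Fin d), Complex.exp (-((ε + l) / 2 : ℝ) * ‖v‖ ^ 2) *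
      (((2 * Real.pi / (η + r)) ^ ((d : ℝ) / 2) : ℝ) *
        Complex.exp ((-m : ℂ) ^ 2 * ‖v‖ ^ 2 / (2 * (η + r : ℝ))))
      = ((2 * Real.pi / (η + r)) ^ ((d : ℝ) / 2) : ℝ) *
        Complex.exp (-((((ε + l) * (η + r) - m ^ 2) / (η + r)) / 2 : ℝ) * ‖v‖ ^ 2
          + 0 * (inner ℝ (0 : EuclideanSpace ℝ (Fin d)) v : ℝ)) := by
    intro v
    rw [mul_left_comm, ← Complex.exp_add]
    congr 2
    have : ((η : ℂ) + r) ≠ 0 := by exact_mod_cast hr'.ne'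
    push_cast
    field_simp
    ring
  simp only [h3, integral_const_mul,
    integral_cexp_quadratic_norm (show 0 < ((ε + l) * (η + r) - m ^ 2) / (η + r) by positivity)] at h1
  have h4 : ∀ ω, (heatKernel ε (X ω) : ℂ) * heatKernel η (Y ω) =
      ((2 * Real.pi) ^ (-(d : ℝ)) : ℝ) * ((2 * Real.pi) ^ (-(d : ℝ)) : ℝ) * ∫ z : EuclideanSpace ℝ (Fin d) × EuclideanSpace ℝ (Fin d),
      (Complex.exp (-(ε / 2 : ℝ) * ‖z.1‖ ^ 2) * Complex.exp (-(η / 2 : ℝ) * ‖z.2‖ ^ 2)) *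
      Complex.exp ((inner ℝ (X ω) z.1 + inner ℝ (Y ω) z.2 : ℝ) * Complex.I)
      ∂(volume.prod volume) := by
    intro ω
    rw [heatKernel_eq_integral hε, heatKernel_eq_integral hη, mul_mul_mul_comm,
      ← integral_prod_mul]
    congr 2
    ext z
    rw [Complex.ofReal_add, add_mul, Complex.exp_add]
    ring
  rw [← Complex.ofReal_inj, ← integral_complex_ofReal]
  simp only [Complex.ofReal_mul, h4, integral_const_mul]
  rw [h1]
  simp only [ne_eq, OfNat.ofNat_ne_zero, not_false_eq_true, zero_pow, norm_zero,
    Complex.ofReal_zero, mul_zero, zero_div, Complex.exp_zero, mul_one]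
  simp only [← Complex.ofReal_mul]
  congr 1
  rw [mul_assoc, ← Real.mul_rpow (by positivity) (by positivity)]
  rw [show 2 * Real.pi / (η + r) * (2 * Real.pi / (((ε + l) * (η + r) - m ^ 2) / (η + r)))
    = (2 * Real.pi) ^ (2 : ℝ) / ((ε + l) * (η + r) - m ^ 2) by
      rw [Real.rpow_two]; field_simp]
  rw [Real.div_rpow (by positivity) hdet.le, ← Real.rpow_mul (by positivity), div_eq_mul_inv,
    ← Real.rpow_neg hdet.le, ← mul_assoc, ← mul_assoc, ← Real.rpow_add (by positivity),
    ← Real.rpow_add (by positivity)]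
  ring_nf

/-! ### Increments of fractional Brownian motion. -/

section FractionalBrownianMotion

variable {Ω : Type*} [MeasurableSpace Ω] {P : Measure Ω} {d : ℕ} {H : ℝ}
  {B : ℝ≥0 → Ω → EuclideanSpace ℝ (Fin d)}

lemma IsFractionalBrownianMotion.memLp_eval (hB : IsFractionalBrownianMotion H B P) (t : ℝ≥0)
    (i : Fin d) : MemLp (fun ω => B t ω i) 2 P := by
  have := hB.gaussian.isProbabilityMeasure
  exact ((hB.gaussian.hasGaussianLaw_eval t).map_fun (EuclideanSpace.proj i)).memLp_two

lemma IsFractionalBrownianMotion.memLp_inner (hB : IsFractionalBrownianMotion H B P) (t : ℝ≥0)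
    (v : EuclideanSpace ℝ (Fin d)) : MemLp (fun ω => inner ℝ v (B t ω)) 2 P := by
  have := hB.gaussian.isProbabilityMeasure
  exact ((hB.gaussian.hasGaussianLaw_eval t).map_fun (innerSL ℝ v)).memLp_two

lemma IsFractionalBrownianMotion.integral_inner (hB : IsFractionalBrownianMotion H B P) (t : ℝ≥0)
    (v : EuclideanSpace ℝ (Fin d)) : ∫ ω, inner ℝ v (B t ω) ∂P = 0 := by
  have := hB.gaussian.isProbabilityMeasure
  simp only [PiLp.inner_apply, RCLike.inner_apply, conj_trivial]
  rw [integral_finsetSum _ fun i _ =>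
    ((hB.memLp_eval t i).integrable (by norm_num)).mul_const _]
  simp [integral_mul_const, hB.mean_zero]

lemma IsFractionalBrownianMotion.integral_inner_mul_inner
    (hB : IsFractionalBrownianMotion H B P) (t s : ℝ≥0) (v w : EuclideanSpace ℝ (Fin d)) :
    ∫ ω, inner ℝ v (B t ω) * inner ℝ w (B s ω) ∂P = inner ℝ v w *
      (((t : ℝ) ^ (2 * H) + (s : ℝ) ^ (2 * H) - |(t : ℝ) - (s : ℝ)| ^ (2 * H)) / 2) := by
  simp only [PiLp.inner_apply, RCLike.inner_apply, conj_trivial, Finset.sum_mul_sum]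
  have hi : ∀ i j, Integrable (fun ω => B t ω i * v i * (B s ω j * w j)) P := fun i j => by
    refine (((hB.memLp_eval t i).integrable_mul (hB.memLp_eval s j)).mul_const (v i * w j)).congr
      (ae_of_all _ fun ω => ?_)
    simp only [Pi.mul_apply]
    ring
  rw [integral_finsetSum _ fun i _ => integrable_finsetSum _ fun j _ => hi i j]
  simp only [integral_finsetSum _ fun j _ => hi _ j]
  have h : ∀ i j, ∫ ω, B t ω i * v i * (B s ω j * w j) ∂P = if i = j then w i * v i *
      (((t : ℝ) ^ (2 * H) + (s : ℝ) ^ (2 * H) - |(t : ℝ) - (s : ℝ)| ^ (2 * H)) / 2) else 0 := by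
    intro i j
    have : ∀ ω, B t ω i * v i * (B s ω j * w j) = (B t ω i * B s ω j) * (v i * w j) := fun ω => by
      ring
    simp only [this, integral_mul_const, hB.covariance]
    split_ifs with hij
    · subst hij
      ring
    · ring
  simp only [h, Finset.sum_ite_eq, Finset.mem_univ, if_true, Finset.sum_mul]

lemma IsFractionalBrownianMotion.memLp_inner_sub (hB : IsFractionalBrownianMotion H B P)
    (t s : ℝ≥0) (v : EuclideanSpace ℝ (Fin d)) :
    MemLp (fun ω => inner ℝ v (B t ω - B s ω)) 2 P := by
  simp only [inner_sub_right]
  exact (hB.memLp_inner t v).sub (hB.memLp_inner s v)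

lemma IsFractionalBrownianMotion.integral_inner_sub_mul_inner_sub
    (hB : IsFractionalBrownianMotion H B P) (t s t' s' : ℝ≥0) (v w : EuclideanSpace ℝ (Fin d)) :
    ∫ ω, inner ℝ v (B t ω - B s ω) * inner ℝ w (B t' ω - B s' ω) ∂P
      = inner ℝ v w * incCov H (t, s) (t', s') := by
  have hi : ∀ a b : ℝ≥0, Integrable (fun ω => inner ℝ v (B a ω) * inner ℝ w (B b ω)) P :=
    fun a b => (hB.memLp_inner a v).integrable_mul (hB.memLp_inner b w)
  have e : ∀ ω, inner ℝ v (B t ω - B s ω) * inner ℝ w (B t' ω - B s' ω) =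
      inner ℝ v (B t ω) * inner ℝ w (B t' ω) - inner ℝ v (B t ω) * inner ℝ w (B s' ω)
      - (inner ℝ v (B s ω) * inner ℝ w (B t' ω) - inner ℝ v (B s ω) * inner ℝ w (B s' ω)) := by
    intro ω
    rw [inner_sub_right, inner_sub_right]
    ring
  simp only [e]
  rw [integral_sub ((hi _ _).sub' (hi _ _)) ((hi _ _).sub' (hi _ _)),
    integral_sub (hi _ _) (hi _ _), integral_sub (hi _ _) (hi _ _)]
  simp only [hB.integral_inner_mul_inner, incCov]
  ring

/-- The joint characteristic function of two increments. -/
lemma IsFractionalBrownianMotion.charFun_increments (hB : IsFractionalBrownianMotion H B P)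
    (t s t' s' : ℝ≥0) (v w : EuclideanSpace ℝ (Fin d)) :
    ∫ ω, Complex.exp ((inner ℝ (B t ω - B s ω) v + inner ℝ (B t' ω - B s' ω) w : ℝ)
      * Complex.I) ∂P = Complex.exp (-(incCov H (t, s) (t, s) * ‖v‖ ^ 2
        + 2 * incCov H (t, s) (t', s') * inner ℝ v w
        + incCov H (t', s') (t', s') * ‖w‖ ^ 2 : ℝ) / 2) := by
  have := hB.gaussian.isProbabilityMeasure
  set Z : Ω → ℝ := fun ω => inner ℝ (B t ω - B s ω) v + inner ℝ (B t' ω - B s' ω) w with hZ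
  have hG : HasGaussianLaw Z P := by
    classical
    -- `Z` is a continuous linear functional of four marginals. Viewed as a process over a one-point
    -- index set, it inherits Gaussianity from `B`.
    have : IsGaussianProcess (fun _ : Unit => Z) P := by
      refine hB.gaussian.of_isGaussianProcess fun _ => ?_
      have ht : t ∈ ({t, s, t', s'} : Finset ℝ≥0) := by simp
      have hs : s ∈ ({t, s, t', s'} : Finset ℝ≥0) := by simp
      have ht' : t' ∈ ({t, s, t', s'} : Finset ℝ≥0) := by simp
      have hs' : s' ∈ ({t, s, t', s'} : Finset ℝ≥0) := by simp
      let π : ({t, s, t', s'} : Finset ℝ≥0) → ((({t, s, t', s'} : Finset ℝ≥0) →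
          EuclideanSpace ℝ (Fin d)) →L[ℝ] EuclideanSpace ℝ (Fin d)) :=
        fun i => ContinuousLinearMap.proj i
      refine ⟨{t, s, t', s'}, (innerSL ℝ v).comp (π ⟨t, ht⟩ - π ⟨s, hs⟩)
        + (innerSL ℝ w).comp (π ⟨t', ht'⟩ - π ⟨s', hs'⟩), fun ω => ?_⟩
      simp only [hZ, real_inner_comm]
      rfl
    exact this.hasGaussianLaw_eval ()
  have hZ' : ∀ ω, Z ω = inner ℝ v (B t ω - B s ω) + inner ℝ w (B t' ω - B s' ω) := fun ω => by
    rw [hZ]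
    simp only [real_inner_comm]
  have m1 := hB.memLp_inner_sub t s v
  have m2 := hB.memLp_inner_sub t' s' w
  have hmean : ∫ ω, Z ω ∂P = 0 := by
    simp only [hZ']
    rw [integral_add (m1.integrable (by norm_num)) (m2.integrable (by norm_num))]
    simp only [inner_sub_right]
    rw [integral_sub ((hB.memLp_inner _ _).integrable (by norm_num))
      ((hB.memLp_inner _ _).integrable (by norm_num)),
      integral_sub ((hB.memLp_inner _ _).integrable (by norm_num))
      ((hB.memLp_inner _ _).integrable (by norm_num))]
    simp [hB.integral_inner]
  have hvar : Var[Z; P] = incCov H (t, s) (t, s) * ‖v‖ ^ 2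
        + 2 * incCov H (t, s) (t', s') * inner ℝ v w + incCov H (t', s') (t', s') * ‖w‖ ^ 2 := by
    rw [variance_of_integral_eq_zero hG.aemeasurable hmean]
    have e : ∀ ω, Z ω ^ 2 =
        inner ℝ v (B t ω - B s ω) * inner ℝ v (B t ω - B s ω)
        + 2 * (inner ℝ v (B t ω - B s ω) * inner ℝ w (B t' ω - B s' ω))
        + inner ℝ w (B t' ω - B s' ω) * inner ℝ w (B t' ω - B s' ω) := fun ω => by
      rw [hZ']
      ring
    simp only [e]
    have i1 : Integrable (fun ω => inner ℝ v (B t ω - B s ω) * inner ℝ v (B t ω - B s ω)) P :=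
      m1.integrable_mul m1
    have i2 : Integrable (fun ω => inner ℝ v (B t ω - B s ω) * inner ℝ w (B t' ω - B s' ω)) P :=
      m1.integrable_mul m2
    have i3 : Integrable (fun ω => inner ℝ w (B t' ω - B s' ω) * inner ℝ w (B t' ω - B s' ω)) P :=
      m2.integrable_mul m2
    rw [integral_add (i1.fun_add (i2.const_mul 2)) i3, integral_add i1 (i2.const_mul 2),
      integral_const_mul]
    simp only [hB.integral_inner_sub_mul_inner_sub, real_inner_self_eq_norm_sq]
    ring
  -- The vectors `v`, `w` are already absorbed into `Z`, so the real characteristic function at `1`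
  -- is the joint one at `(v, w)`.
  have hc := hG.charFun_map_eq (1 : ℝ)
  rw [charFun_apply, integral_map hG.aemeasurable (by fun_prop)] at hc
  simp only [RCLike.inner_apply, conj_trivial, mul_one, one_mul] at hc
  rw [hmean, hvar] at hc
  rw [hc]
  congr 1
  push_cast
  ring

lemma IsFractionalBrownianMotion.integral_heatKernel (hB : IsFractionalBrownianMotion H B P)
    (hH : 0 < H) (t s : ℝ≥0) {ε : ℝ} (hε : 0 < ε) :
    ∫ ω, heatKernel ε (B t ω - B s ω) ∂P = (2 * Real.pi) ^ (-(d : ℝ) / 2) *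
      (ε + incCov H (t, s) (t, s)) ^ (-((d : ℝ) / 2)) := by
  have := hB.gaussian.isProbabilityMeasure
  refine integral_heatKernel_of_charFun
    ((hB.gaussian.aemeasurable t).sub (hB.gaussian.aemeasurable s)) (incCov_self_nonneg hH _) hε
    fun v => ?_
  have := hB.charFun_increments t s t s v 0
  simpa using this

lemma IsFractionalBrownianMotion.integral_heatKernel_mul (hB : IsFractionalBrownianMotion H B P)
    (hH : 0 < H) (hH' : H < 1) (t s t' s' : ℝ≥0) {ε η : ℝ} (hε : 0 < ε) (hη : 0 < η) :
    ∫ ω, heatKernel ε (B t ω - B s ω) * heatKernel η (B t' ω - B s' ω) ∂P =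
      (2 * Real.pi) ^ (-(d : ℝ)) * ((ε + incCov H (t, s) (t, s)) *
        (η + incCov H (t', s') (t', s')) - incCov H (t, s) (t', s') ^ 2) ^ (-((d : ℝ) / 2)) := by
  have := hB.gaussian.isProbabilityMeasure
  exact integral_heatKernel_mul_of_charFun
    ((hB.gaussian.aemeasurable t).sub (hB.gaussian.aemeasurable s))
    ((hB.gaussian.aemeasurable t').sub (hB.gaussian.aemeasurable s')) (incCov_self_nonneg hH _)
    (incCov_self_nonneg hH _) (incDet_nonneg hH hH' _ _) hε hη
    fun v w => hB.charFun_increments t s t' s' v w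

end FractionalBrownianMotion

/-! ### First and second moments of the approximations. -/

lemma integral_triangleMeasure {T : ℝ} (hT : 0 ≤ T) {f : ℝ × ℝ → ℝ}
    (hf : Integrable f (triangleMeasure T)) :
    ∫ p, f p ∂triangleMeasure T = ∫ t in (0 : ℝ)..T, ∫ s in (0 : ℝ)..t, f (t, s) := by
  have hi : Integrable ((triangle T).indicator f) volume :=
    (integrable_indicator_iff (measurableSet_triangle T)).2 hf
  rw [triangleMeasure, ← integral_indicator (measurableSet_triangle T), Measure.volume_eq_prod,
    integral_prod _ hi, intervalIntegral.integral_of_le hT,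
    ← integral_indicator measurableSet_Ioc]
  congr 1
  ext t
  by_cases ht : t ∈ Set.Ioc 0 T
  · rw [Set.indicator_of_mem ht, intervalIntegral.integral_of_le ht.1.le,
      integral_Ioc_eq_integral_Ioo, ← integral_indicator measurableSet_Ioo]
    congr 1
    ext s
    have hiff : (t, s) ∈ triangle T ↔ s ∈ Set.Ioo 0 t :=
      ⟨fun h => ⟨h.1, h.2.1⟩, fun h => ⟨h.1, h.2, ht.2⟩⟩
    by_cases hs : s ∈ Set.Ioo 0 t
    · rw [Set.indicator_of_mem hs, Set.indicator_of_mem (hiff.2 hs)]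
    · rw [Set.indicator_of_notMem hs, Set.indicator_of_notMem (mt hiff.1 hs)]
  · rw [Set.indicator_of_notMem ht]
    refine integral_eq_zero_of_ae (ae_of_all _ fun s => ?_)
    refine Set.indicator_of_notMem (fun hp => ht ?_) _
    exact ⟨lt_trans hp.1 hp.2.1, hp.2.2⟩

section BoundedKernels

variable {X Ω : Type*} [MeasurableSpace X] [MeasurableSpace Ω] {ν : Measure X} [IsFiniteMeasure ν]
  {P : Measure Ω} [IsProbabilityMeasure P] {K L : X × Ω → ℝ} {M N : ℝ}

/-- For fixed `ε > 0` the heat kernel is bounded and the measures are finite; square integrability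
and the exchanges of integrals below need nothing more. -/
lemma memLp_integral_of_bounded (hK : Measurable K) (hM : ∀ z, ‖K z‖ ≤ M) :
    MemLp (fun ω => ∫ p, K (p, ω) ∂ν) 2 P := by
  refine MemLp.of_bound ?_ (M * ν.real Set.univ) (ae_of_all _ fun ω => ?_)
  · exact (hK.stronglyMeasurable.integral_prod_left').aestronglyMeasurable
  · exact norm_integral_le_of_norm_le_const (ae_of_all _ fun p => hM _)

lemma integral_integral_of_bounded (hK : Measurable K) (hM : ∀ z, ‖K z‖ ≤ M) :
    ∫ ω, ∫ p, K (p, ω) ∂ν ∂P = ∫ p, ∫ ω, K (p, ω) ∂P ∂ν := by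
  refine integral_integral_swap (f := fun ω p => K (p, ω)) ?_
  exact Integrable.of_bound (hK.comp measurable_swap).aestronglyMeasurable M
    (ae_of_all _ fun z => hM _)

lemma integral_mul_integral_of_bounded (hK : Measurable K) (hM : ∀ z, ‖K z‖ ≤ M)
    (hL : Measurable L) (hN : ∀ z, ‖L z‖ ≤ N) :
    ∫ ω, (∫ p, K (p, ω) ∂ν) * ∫ q, L (q, ω) ∂ν ∂P =
      ∫ x : X × X, ∫ ω, K (x.1, ω) * L (x.2, ω) ∂P ∂(ν.prod ν) := by
  simp only [← integral_prod_mul]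
  refine integral_integral_swap (f := fun ω (x : X × X) => K (x.1, ω) * L (x.2, ω)) ?_
  refine Integrable.of_bound ?_ (M * N) (ae_of_all _ fun z => ?_)
  · exact ((hK.comp (measurable_snd.fst.prodMk measurable_fst)).mul
      (hL.comp (measurable_snd.snd.prodMk measurable_fst))).aestronglyMeasurable
  · exact (norm_mul_le _ _).trans
      (mul_le_mul (hM _) (hN _) (norm_nonneg _) ((norm_nonneg _).trans (hM (z.2.1, z.1))))

end BoundedKernels

/-- The kernel of the covariance of the approximated self-intersection local times. -/
noncomputable def covKernel (H α ε η : ℝ) (x : (ℝ × ℝ) × (ℝ × ℝ)) : ℝ :=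
  ((ε + incCov H x.1 x.1) * (η + incCov H x.2 x.2) - incCov H x.1 x.2 ^ 2) ^ (-α)
    - ((ε + incCov H x.1 x.1) * (η + incCov H x.2 x.2)) ^ (-α)

lemma measurable_incCov (H : ℝ) :
    Measurable fun x : (ℝ × ℝ) × (ℝ × ℝ) => incCov H x.1 x.2 := by
  have h : ∀ {f : (ℝ × ℝ) × (ℝ × ℝ) → ℝ}, Measurable f → Measurable fun x => |f x| ^ (2 * H) :=
    fun hf => hf.abs.pow_const _
  exact ((((h (measurable_fst.fst.sub measurable_snd.snd)).add
    (h (measurable_fst.snd.sub measurable_snd.fst))).sub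
    (h (measurable_fst.fst.sub measurable_snd.fst))).sub
    (h (measurable_fst.snd.sub measurable_snd.snd))).div_const 2

lemma measurable_incCov_self (H : ℝ) : Measurable fun p : ℝ × ℝ => incCov H p p := by
  have h : ∀ {f : ℝ × ℝ → ℝ}, Measurable f → Measurable fun x => |f x| ^ (2 * H) :=
    fun hf => hf.abs.pow_const _
  exact ((((h (measurable_fst.sub measurable_snd)).add
    (h (measurable_snd.sub measurable_fst))).sub
    (h (measurable_fst.sub measurable_fst))).sub
    (h (measurable_snd.sub measurable_snd))).div_const 2

section LocalTime

variable {Ω : Type*} [MeasurableSpace Ω] {P : Measure Ω} {d : ℕ} {H : ℝ}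
  {B : ℝ≥0 → Ω → EuclideanSpace ℝ (Fin d)} {T : ℝ}

/-- The heat kernel evaluated at the increments of a measurable version of `B`. -/
noncomputable def incKernel (hBm : JointlyAEMeasurable B P) (ε : ℝ) (z : (ℝ × ℝ) × Ω) : ℝ :=
  heatKernel ε (AEMeasurable.mk _ hBm (z.1.1, z.2) - AEMeasurable.mk _ hBm (z.1.2, z.2))

lemma measurable_incKernel (hBm : JointlyAEMeasurable B P) (ε : ℝ) :
    Measurable (incKernel hBm ε) := by
  have h := AEMeasurable.measurable_mk hBm
  exact (measurable_heatKernel d ε).comp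
    ((h.comp (measurable_fst.fst.prodMk measurable_snd)).sub
      (h.comp (measurable_fst.snd.prodMk measurable_snd)))

lemma norm_incKernel_le (hBm : JointlyAEMeasurable B P) {ε : ℝ} (hε : 0 < ε)
    (z : (ℝ × ℝ) × Ω) : ‖incKernel hBm ε z‖ ≤ (2 * Real.pi * ε) ^ (-(d : ℝ) / 2) := by
  rw [incKernel, Real.norm_of_nonneg (heatKernel_nonneg hε _)]
  exact heatKernel_le hε _

variable [IsProbabilityMeasure P]

/-- Pathwise use of the measurable version: for almost every `ω` it agrees with `B` at almost every
time, hence the iterated time integrals agree. -/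
lemma ae_approx_eq (hBm : JointlyAEMeasurable B P) (hT : 0 < T) {ε : ℝ} (hε : 0 < ε) :
    approxSelfIntersectionLocalTime B T ε =ᵐ[P]
      fun ω => ∫ p, incKernel hBm ε (p, ω) ∂triangleMeasure T := by
  have h1 := AEMeasurable.ae_eq_mk hBm
  have h2 := Measure.ae_ae_of_ae_prod (Measure.measurePreserving_swap.quasiMeasurePreserving.ae h1)
  filter_upwards [h2] with ω hω
  rw [integral_triangleMeasure hT.le]
  · have hω' : ∀ᵐ t : ℝ, t ∈ Set.Ici (0 : ℝ) →
        B t.toNNReal ω = AEMeasurable.mk _ hBm (t, ω) :=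
      (ae_restrict_iff' measurableSet_Ici).1 hω
    rw [approxSelfIntersectionLocalTime]
    refine intervalIntegral.integral_congr_ae ?_
    filter_upwards [hω'] with t ht hmem
    rw [Set.uIoc_of_le hT.le] at hmem
    refine intervalIntegral.integral_congr_ae ?_
    filter_upwards [hω'] with s hs hmem'
    rw [Set.uIoc_of_le hmem.1.le] at hmem'
    rw [ht hmem.1.le, hs hmem'.1.le]
    rfl
  · exact Integrable.of_bound ((measurable_incKernel hBm ε).comp
      (measurable_id.prodMk measurable_const)).aestronglyMeasurable _
      (ae_of_all _ fun p => norm_incKernel_le hBm hε _)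

/-- The opposite order of quantifiers: for almost every pair of times the versions agree almost
surely, which suffices for expectations at fixed times. -/
lemma ae_triangle_incKernel_eq (hBm : JointlyAEMeasurable B P) :
    ∀ᵐ p ∂triangleMeasure T, 0 < p.2 ∧ p.2 < p.1 ∧ ∀ᵐ ω ∂P, ∀ ε,
      incKernel hBm ε (p, ω) = heatKernel ε (B p.1.toNNReal ω - B p.2.toNNReal ω) := by
  have h1 := Measure.ae_ae_of_ae_prod (AEMeasurable.ae_eq_mk hBm)
  have h2 : ∀ᵐ t ∂timeMeasure T, ∀ᵐ ω ∂P, B t.toNNReal ω = AEMeasurable.mk _ hBm (t, ω) :=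
    ae_mono (Measure.restrict_mono (fun t ht => ht.1.le) le_rfl) h1
  have hle := (triangleMeasure_le T).absolutelyContinuous
  have h3 := hle.ae_le (Measure.quasiMeasurePreserving_fst (ν := timeMeasure T) |>.ae h2)
  have h4 := hle.ae_le (Measure.quasiMeasurePreserving_snd (μ := timeMeasure T) |>.ae h2)
  filter_upwards [h3, h4, ae_restrict_mem (measurableSet_triangle T)] with p hp1 hp2 hp
  refine ⟨hp.1, hp.2.1, ?_⟩
  filter_upwards [hp1, hp2] with ω hω1 hω2 ε
  rw [incKernel, hω1, hω2]

lemma memLp_approx (hBm : JointlyAEMeasurable B P) (hT : 0 < T) {ε : ℝ} (hε : 0 < ε) :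
    MemLp (approxSelfIntersectionLocalTime B T ε) 2 P :=
  (memLp_congr_ae (ae_approx_eq hBm hT hε)).2
    (memLp_integral_of_bounded (measurable_incKernel hBm ε) (norm_incKernel_le hBm hε))

lemma integral_approx (hB : IsFractionalBrownianMotion H B P) (hBm : JointlyAEMeasurable B P)
    (hH : 0 < H) (hT : 0 < T) {ε : ℝ} (hε : 0 < ε) :
    ∫ ω, approxSelfIntersectionLocalTime B T ε ω ∂P = (2 * Real.pi) ^ (-(d : ℝ) / 2) *
      ∫ p, (ε + incCov H p p) ^ (-((d : ℝ) / 2)) ∂triangleMeasure T := by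
  rw [integral_congr_ae (ae_approx_eq hBm hT hε),
    integral_integral_of_bounded (measurable_incKernel hBm ε) (norm_incKernel_le hBm hε),
    ← integral_const_mul]
  refine integral_congr_ae ?_
  filter_upwards [ae_triangle_incKernel_eq hBm] with p hp
  rw [integral_congr_ae (hp.2.2.mono fun ω h => h ε), hB.integral_heatKernel hH _ _ hε,
    Real.coe_toNNReal _ (hp.1.trans hp.2.1).le, Real.coe_toNNReal _ hp.1.le]

lemma integral_approx_mul (hB : IsFractionalBrownianMotion H B P) (hBm : JointlyAEMeasurable B P)
    (hH : 0 < H) (hH' : H < 1) (hT : 0 < T) {ε η : ℝ} (hε : 0 < ε) (hη : 0 < η) :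
    ∫ ω, approxSelfIntersectionLocalTime B T ε ω * approxSelfIntersectionLocalTime B T η ω ∂P =
      (2 * Real.pi) ^ (-(d : ℝ)) * ∫ x, ((ε + incCov H x.1 x.1) * (η + incCov H x.2 x.2)
        - incCov H x.1 x.2 ^ 2) ^ (-((d : ℝ) / 2))
        ∂((triangleMeasure T).prod (triangleMeasure T)) := by
  refine (integral_congr_ae ((ae_approx_eq hBm hT hε).mul (ae_approx_eq hBm hT hη))).trans ?_
  simp only [Pi.mul_apply]
  rw [integral_mul_integral_of_bounded (measurable_incKernel hBm ε) (norm_incKernel_le hBm hε)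
      (measurable_incKernel hBm η) (norm_incKernel_le hBm hη), ← integral_const_mul]
  refine integral_congr_ae ?_
  have h := ae_triangle_incKernel_eq (T := T) hBm
  filter_upwards [Measure.quasiMeasurePreserving_fst (ν := triangleMeasure T) |>.ae h,
    Measure.quasiMeasurePreserving_snd (μ := triangleMeasure T) |>.ae h] with x hp hq
  have e : ∀ᵐ ω ∂P, incKernel hBm ε (x.1, ω) * incKernel hBm η (x.2, ω) =
      heatKernel ε (B x.1.1.toNNReal ω - B x.1.2.toNNReal ω) *
      heatKernel η (B x.2.1.toNNReal ω - B x.2.2.toNNReal ω) := by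
    filter_upwards [hp.2.2, hq.2.2] with ω h1 h2
    rw [h1, h2]
  rw [integral_congr_ae e, hB.integral_heatKernel_mul hH hH' _ _ _ _ hε hη,
    Real.coe_toNNReal _ (hp.1.trans hp.2.1).le, Real.coe_toNNReal _ hp.1.le,
    Real.coe_toNNReal _ (hq.1.trans hq.2.1).le, Real.coe_toNNReal _ hq.1.le]

lemma integrable_rpow_incCov_self (hH : 0 < H) {α ε : ℝ} (hα : 0 ≤ α) (hε : 0 < ε) (T : ℝ) :
    Integrable (fun p => (ε + incCov H p p) ^ (-α)) (triangleMeasure T) := by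
  refine Integrable.of_bound
    (((measurable_incCov_self H).const_add ε).pow_const _).aestronglyMeasurable (ε ^ (-α))
    (ae_of_all _ fun p => ?_)
  have := incCov_self_nonneg hH p
  rw [Real.norm_of_nonneg (by positivity)]
  exact Real.rpow_le_rpow_of_nonpos hε (by linarith) (by linarith)

lemma integrable_rpow_det (hH : 0 < H) (hH' : H < 1) {α ε η : ℝ} (hα : 0 ≤ α) (hε : 0 < ε)
    (hη : 0 < η) (T : ℝ) :
    Integrable (fun x : (ℝ × ℝ) × (ℝ × ℝ) => ((ε + incCov H x.1 x.1) * (η + incCov H x.2 x.2)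
        - incCov H x.1 x.2 ^ 2) ^ (-α)) ((triangleMeasure T).prod (triangleMeasure T)) := by
  have m1 : Measurable fun x : (ℝ × ℝ) × (ℝ × ℝ) => ε + incCov H x.1 x.1 :=
    ((measurable_incCov_self H).comp measurable_fst).const_add ε
  have m2 : Measurable fun x : (ℝ × ℝ) × (ℝ × ℝ) => η + incCov H x.2 x.2 :=
    ((measurable_incCov_self H).comp measurable_snd).const_add η
  refine Integrable.of_bound (((m1.mul m2).sub
    ((measurable_incCov H).pow_const 2)).pow_const _).aestronglyMeasurable ((ε * η) ^ (-α))
    (ae_of_all _ fun x => ?_)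
  have h1 := incCov_self_nonneg hH x.1
  have h2 := incCov_self_nonneg hH x.2
  have h3 := incDet_nonneg hH hH' x.1 x.2
  rw [incDet] at h3
  have h4 : ε * η ≤ (ε + incCov H x.1 x.1) * (η + incCov H x.2 x.2) - incCov H x.1 x.2 ^ 2 := by
    nlinarith [mul_nonneg hε.le h2, mul_nonneg hη.le h1]
  have h5 : 0 < ε * η := by positivity
  rw [Real.norm_of_nonneg (Real.rpow_nonneg (h5.le.trans h4) _)]
  exact Real.rpow_le_rpow_of_nonpos h5 h4 (by linarith)

lemma integrable_rpow_mul_incCov_self (hH : 0 < H) {α ε η : ℝ} (hα : 0 ≤ α) (hε : 0 < ε)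
    (hη : 0 < η) (T : ℝ) : Integrable (fun x : (ℝ × ℝ) × (ℝ × ℝ) =>
      ((ε + incCov H x.1 x.1) * (η + incCov H x.2 x.2)) ^ (-α))
      ((triangleMeasure T).prod (triangleMeasure T)) := by
  refine ((integrable_rpow_incCov_self hH hα hε T).mul_prod
    (integrable_rpow_incCov_self hH hα hη T)).congr (ae_of_all _ fun x => ?_)
  have h1 := incCov_self_nonneg hH x.1
  have h2 := incCov_self_nonneg hH x.2
  simp only
  rw [Real.mul_rpow (by positivity) (by positivity)]

/-- The covariance of the approximated self-intersection local times. -/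
lemma integral_centered_mul_centered (hB : IsFractionalBrownianMotion H B P)
    (hBm : JointlyAEMeasurable B P) (hH : 0 < H) (hH' : H < 1) (hT : 0 < T) {ε η : ℝ}
    (hε : 0 < ε) (hη : 0 < η) :
    ∫ ω, (approxSelfIntersectionLocalTime B T ε ω
        - ∫ ω', approxSelfIntersectionLocalTime B T ε ω' ∂P) *
      (approxSelfIntersectionLocalTime B T η ω
        - ∫ ω', approxSelfIntersectionLocalTime B T η ω' ∂P) ∂P =
      (2 * Real.pi) ^ (-(d : ℝ)) * ∫ x, covKernel H ((d : ℝ) / 2) ε η x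
        ∂((triangleMeasure T).prod (triangleMeasure T)) := by
  have hpi := Real.two_pi_pos
  have l1 := memLp_approx hBm hT hε
  have l2 := memLp_approx hBm hT hη
  have i1 := l1.integrable (by norm_num)
  have i2 := l2.integrable (by norm_num)
  have i12 : Integrable (fun ω => approxSelfIntersectionLocalTime B T ε ω *
    approxSelfIntersectionLocalTime B T η ω) P := l1.integrable_mul l2
  set m := ∫ ω', approxSelfIntersectionLocalTime B T ε ω' ∂P with hm
  set n := ∫ ω', approxSelfIntersectionLocalTime B T η ω' ∂P with hn
  have e : ∀ ω, (approxSelfIntersectionLocalTime B T ε ω - m) *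
      (approxSelfIntersectionLocalTime B T η ω - n) =
      (approxSelfIntersectionLocalTime B T ε ω * approxSelfIntersectionLocalTime B T η ω
      - n * approxSelfIntersectionLocalTime B T ε ω)
      - (m * approxSelfIntersectionLocalTime B T η ω - m * n) := fun ω => by ring
  simp only [e]
  rw [integral_sub (i12.sub' (i1.const_mul n)) ((i2.const_mul m).sub' (integrable_const _)),
    integral_sub i12 (i1.const_mul n), integral_sub (i2.const_mul m) (integrable_const _),
    integral_const_mul, integral_const_mul, ← hm, ← hn]
  simp only [integral_const, probReal_univ, one_smul]
  have e2 : m * n = (2 * Real.pi) ^ (-(d : ℝ)) * ∫ x : (ℝ × ℝ) × (ℝ × ℝ),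
      ((ε + incCov H x.1 x.1) * (η + incCov H x.2 x.2)) ^ (-((d : ℝ) / 2))
      ∂((triangleMeasure T).prod (triangleMeasure T)) := by
    rw [hm, hn, integral_approx hB hBm hH hT hε, integral_approx hB hBm hH hT hη,
      mul_mul_mul_comm, ← integral_prod_mul, ← Real.rpow_add hpi]
    congr 1
    · ring_nf
    · refine integral_congr_ae (ae_of_all _ fun x => ?_)
      have h1 := incCov_self_nonneg hH x.1
      have h2 := incCov_self_nonneg hH x.2
      simp only
      rw [Real.mul_rpow (by positivity) (by positivity)]
  have hα : (0 : ℝ) ≤ (d : ℝ) / 2 := by positivity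
  have j1 := integrable_rpow_det hH hH' hα hε hη T
  have j2 := integrable_rpow_mul_incCov_self hH hα hε hη T
  simp only [covKernel]
  rw [integral_sub j1 j2, mul_sub, ← e2, ← integral_approx_mul hB hBm hH hH' hT hε hη]
  ring

end LocalTime

/-! ### Asymptotics of the mean. -/

/-- The profile `(ε + u ^ {2H}) ^ {-α}` of the expectation. -/
noncomputable def meanProfile (H α ε u : ℝ) : ℝ := (ε + u ^ (2 * H)) ^ (-α)

lemma measurable_meanProfile (H α ε : ℝ) : Measurable (meanProfile H α ε) :=
  ((measurable_id.pow_const _).const_add ε).pow_const _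

lemma meanProfile_nonneg {H α ε u : ℝ} (hε : 0 < ε) (hu : 0 ≤ u) : 0 ≤ meanProfile H α ε u := by
  unfold meanProfile
  positivity

lemma meanProfile_le_rpow {H α ε u : ℝ} (hα : 0 < α) (hε : 0 ≤ ε) (hu : 0 < u) :
    meanProfile H α ε u ≤ u ^ (-(2 * H * α)) := by
  have h := Real.rpow_le_rpow_of_nonpos (show 0 < u ^ (2 * H) by positivity)
    (show u ^ (2 * H) ≤ ε + u ^ (2 * H) by linarith) (show -α ≤ 0 by linarith)
  rwa [← Real.rpow_mul hu.le, mul_neg] at h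

lemma meanProfile_le {H α ε u : ℝ} (hα : 0 < α) (hε : 0 < ε) (hu : 0 ≤ u) :
    meanProfile H α ε u ≤ ε ^ (-α) :=
  Real.rpow_le_rpow_of_nonpos hε (le_add_of_nonneg_right (by positivity)) (by linarith)

lemma tendsto_meanProfile {H u : ℝ} (α : ℝ) (hu : 0 < u) :
    Tendsto (fun ε => meanProfile H α ε u) (𝓝[>] 0) (𝓝 (u ^ (-(2 * H * α)))) := by
  have h1 : Tendsto (fun ε : ℝ => ε + u ^ (2 * H)) (𝓝[>] 0) (𝓝 (0 + u ^ (2 * H))) :=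
    (tendsto_id.mono_left nhdsWithin_le_nhds).add_const _
  have h2 := h1.rpow_const (p := -α) (Or.inl (by rw [zero_add]; positivity))
  rwa [zero_add, ← Real.rpow_mul hu.le, mul_neg] at h2

lemma continuousOn_meanProfile {H : ℝ} (hH : 0 < H) (α : ℝ) {ε : ℝ} (hε : 0 < ε) :
    ContinuousOn (meanProfile H α ε) (Set.Ici 0) := by
  intro u hu
  have hu' : 0 ≤ u := hu
  have h1 : ContinuousAt (fun u : ℝ => ε + u ^ (2 * H)) u :=
    continuousAt_const.add (Real.continuousAt_rpow_const u _ (Or.inr (by positivity)))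
  exact (h1.rpow_const (Or.inl (by positivity))).continuousWithinAt

lemma intervalIntegrable_meanProfile {H : ℝ} (hH : 0 < H) (α : ℝ) {ε a b : ℝ} (hε : 0 < ε)
    (ha : 0 ≤ a) (hb : 0 ≤ b) : IntervalIntegrable (meanProfile H α ε) volume a b :=
  ((continuousOn_meanProfile hH α hε).mono fun _ hx => (le_min ha hb).trans hx.1).intervalIntegrable

lemma integral_triangle_eq {H : ℝ} (hH : 0 < H) {α ε T : ℝ} (hα : 0 ≤ α) (hε : 0 < ε)
    (hT : 0 < T) :
    ∫ p, (ε + incCov H p p) ^ (-α) ∂triangleMeasure T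
      = ∫ t in (0 : ℝ)..T, ∫ u in (0 : ℝ)..t, meanProfile H α ε u := by
  rw [integral_triangleMeasure hT.le (integrable_rpow_incCov_self hH hα hε T)]
  refine intervalIntegral.integral_congr fun t ht => ?_
  rw [Set.uIcc_of_le hT.le] at ht
  have h := intervalIntegral.integral_comp_sub_left (a := 0) (b := t) (meanProfile H α ε) t
  rw [sub_self, sub_zero] at h
  rw [← h]
  refine intervalIntegral.integral_congr fun s hs => ?_
  rw [Set.uIcc_of_le ht.1] at hs
  simp only [meanProfile]
  rw [incCov_self hH, abs_of_nonneg (sub_nonneg.2 hs.2)]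

/-- Scaling of the profile. -/
lemma meanProfile_mul {H : ℝ} (hH : 0 < H) (α : ℝ) {ε z : ℝ} (hε : 0 < ε) (hz : 0 ≤ z) :
    meanProfile H α ε (ε ^ (1 / (2 * H)) * z) = ε ^ (-α) * meanProfile H α 1 z := by
  unfold meanProfile
  rw [Real.mul_rpow (by positivity) hz, ← Real.rpow_mul hε.le, one_div_mul_cancel (by positivity),
    Real.rpow_one, ← Real.mul_rpow hε.le (by positivity)]
  ring_nf

lemma integral_meanProfile_eq {H : ℝ} (hH : 0 < H) (α : ℝ) {ε t : ℝ} (hε : 0 < ε) (ht : 0 ≤ t) :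
    ∫ u in (0 : ℝ)..t, meanProfile H α ε u
      = ε ^ (-α + 1 / (2 * H)) * ∫ z in (0 : ℝ)..(t / ε ^ (1 / (2 * H))), meanProfile H α 1 z := by
  have hk : 0 < ε ^ (1 / (2 * H)) := by positivity
  have h := intervalIntegral.mul_integral_comp_mul_left (f := meanProfile H α ε)
    (a := 0) (b := t / ε ^ (1 / (2 * H))) (ε ^ (1 / (2 * H)))
  rw [mul_zero, mul_div_cancel₀ _ hk.ne'] at h
  rw [← h, Real.rpow_add hε]
  have e : ∫ z in (0 : ℝ)..(t / ε ^ (1 / (2 * H))), meanProfile H α ε (ε ^ (1 / (2 * H)) * z)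
      = ε ^ (-α) * ∫ z in (0 : ℝ)..(t / ε ^ (1 / (2 * H))), meanProfile H α 1 z := by
    rw [← intervalIntegral.integral_const_mul]
    refine intervalIntegral.integral_congr fun z hz => ?_
    rw [Set.uIcc_of_le (by positivity)] at hz
    exact meanProfile_mul hH α hε hz.1
  rw [e]
  ring

lemma integrableOn_meanProfile {H α : ℝ} (hH : 0 < H) (hα : 0 < α) (h : 1 < 2 * H * α) {ε : ℝ}
    (hε : 0 < ε) : IntegrableOn (meanProfile H α ε) (Set.Ioi 0) := by
  rw [← Set.Ioc_union_Ioi_eq_Ioi zero_le_one]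
  refine IntegrableOn.union ?_ ?_
  · rw [← intervalIntegrable_iff_integrableOn_Ioc_of_le zero_le_one]
    exact intervalIntegrable_meanProfile hH α hε le_rfl zero_le_one
  · refine (integrableOn_Ioi_rpow_of_lt (a := -(2 * H * α)) (by linarith) one_pos).mono'
      (measurable_meanProfile H α ε).aestronglyMeasurable ?_
    refine (ae_restrict_mem measurableSet_Ioi).mono fun u hu => ?_
    have hu0 : (0 : ℝ) < u := one_pos.trans hu
    rw [Real.norm_of_nonneg (meanProfile_nonneg hε hu0.le)]
    exact meanProfile_le_rpow hα hε.le hu0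

lemma integral_Ioi_meanProfile {H : ℝ} (hH : 0 < H) (α : ℝ) {ε : ℝ} (hε : 0 < ε) :
    ∫ u in Set.Ioi (0 : ℝ), meanProfile H α ε u
      = ε ^ (-α + 1 / (2 * H)) * ∫ z in Set.Ioi (0 : ℝ), meanProfile H α 1 z := by
  have hk : 0 < ε ^ (1 / (2 * H)) := by positivity
  have h := integral_comp_mul_left_Ioi (meanProfile H α ε) 0 hk
  rw [mul_zero, smul_eq_mul, eq_inv_mul_iff_mul_eq₀ hk.ne'] at h
  rw [← h, Real.rpow_add hε, setIntegral_congr_fun measurableSet_Ioi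
    (fun z hz => meanProfile_mul hH α hε (le_of_lt hz)), integral_const_mul]
  ring

/-- The expectation converges in the subcritical case. -/
lemma exists_tendsto_mean_of_lt_one {H α T : ℝ} (hH : 0 < H) (hα : 0 < α) (h : 2 * H * α < 1) :
    ∃ L, Tendsto (fun ε => ∫ p, (ε + incCov H p p) ^ (-α) ∂triangleMeasure T) (𝓝[>] 0) (𝓝 L) := by
  refine ⟨_, tendsto_integral_filter_of_dominated_convergence
    (fun p : ℝ × ℝ => |p.1 - p.2| ^ (-(2 * H * α))) (f := fun p => |p.1 - p.2| ^ (-(2 * H * α)))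
    ?_ ?_ ?_ ?_⟩
  · exact Eventually.of_forall fun ε =>
      (((measurable_incCov_self H).const_add ε).pow_const _).aestronglyMeasurable
  · filter_upwards [self_mem_nhdsWithin] with ε hε
    have hε' : (0 : ℝ) < ε := hε
    filter_upwards [ae_restrict_mem (measurableSet_triangle T)] with p hp
    have hp' : 0 < |p.1 - p.2| := abs_pos.2 (sub_ne_zero.2 hp.2.1.ne')
    rw [incCov_self hH]
    change ‖meanProfile H α ε |p.1 - p.2|‖ ≤ _
    rw [Real.norm_of_nonneg (meanProfile_nonneg hε' hp'.le)]
    exact meanProfile_le_rpow hα hε'.le hp'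
  · have hm : Measurable fun p : ℝ × ℝ => |p.1 - p.2| ^ (-(2 * H * α)) :=
      ((measurable_fst.sub measurable_snd).abs).pow_const _
    refine Integrable.mono_measure ?_ (triangleMeasure_le T)
    refine ⟨hm.aestronglyMeasurable, ?_⟩
    rw [hasFiniteIntegral_iff_ofReal (ae_of_all _ fun p => by positivity),
      lintegral_prod _ hm.ennreal_ofReal.aemeasurable]
    obtain ⟨M, hM, hMle⟩ := exists_lintegral_abs_sub_rpow_le
      (show 0 ≤ 2 * H * α by positivity) h T
    refine (lintegral_mono fun x => hMle x).trans_lt ?_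
    rw [lintegral_const]
    exact ENNReal.mul_lt_top hM (measure_lt_top _ _)
  · filter_upwards [ae_restrict_mem (measurableSet_triangle T)] with p hp
    simp only [incCov_self hH]
    exact tendsto_meanProfile α (abs_pos.2 (sub_ne_zero.2 hp.2.1.ne'))

lemma continuousOn_primitive_meanProfile {H : ℝ} (hH : 0 < H) (α : ℝ) {ε T : ℝ} (hε : 0 < ε)
    (hT : 0 ≤ T) :
    ContinuousOn (fun t => ∫ u in (0 : ℝ)..t, meanProfile H α ε u) (Set.uIcc 0 T) := by
  have := intervalIntegral.continuousOn_primitive_interval (μ := volume)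
    (f := meanProfile H α ε) (a := 0) (b := T) ?_
  · exact this
  · rw [Set.uIcc_of_le hT]
    exact ((continuousOn_meanProfile hH α hε).mono fun x hx => hx.1).integrableOn_Icc

/-- The expectation in the supercritical case. -/
lemma exists_tendsto_mean_of_one_lt {H α T : ℝ} (hH : 0 < H) (hα : 0 < α) (hT : 0 < T)
    (h : 1 < 2 * H * α) (h2 : 2 * H * α < 2) :
    ∃ L, Tendsto (fun ε => ∫ p, (ε + incCov H p p) ^ (-α) ∂triangleMeasure T
      - T * ((∫ z in Set.Ioi (0 : ℝ), (z ^ (2 * H) + 1) ^ (-α)) * ε ^ (-α + 1 / (2 * H))))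
      (𝓝[>] 0) (𝓝 L) := by
  -- By scaling, the counterterm is exactly `T` times the integral of the profile over `(0, ∞)`, so
  -- the difference is minus the integral of the tails over `(t, ∞)`.
  have key : ∀ ε : ℝ, 0 < ε → ∫ p, (ε + incCov H p p) ^ (-α) ∂triangleMeasure T
      - T * ((∫ z in Set.Ioi (0 : ℝ), (z ^ (2 * H) + 1) ^ (-α)) * ε ^ (-α + 1 / (2 * H)))
      = ∫ t in (0 : ℝ)..T, ((∫ u in (0 : ℝ)..t, meanProfile H α ε u)
        - ∫ u in Set.Ioi (0 : ℝ), meanProfile H α ε u) := by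
    intro ε hε
    rw [integral_triangle_eq hH hα.le hε hT, intervalIntegral.integral_sub
      (continuousOn_primitive_meanProfile hH α hε hT.le).intervalIntegrable
      intervalIntegrable_const, intervalIntegral.integral_const, sub_zero, smul_eq_mul,
      integral_Ioi_meanProfile hH α hε]
    simp only [meanProfile, add_comm (1 : ℝ)]
    ring
  have tail : ∀ ε : ℝ, 0 < ε → ∀ t : ℝ, 0 < t → (∫ u in (0 : ℝ)..t, meanProfile H α ε u)
        - ∫ u in Set.Ioi (0 : ℝ), meanProfile H α ε u
        = - ∫ u in Set.Ioi t, meanProfile H α ε u := by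
    intro ε hε t ht
    have hi := integrableOn_meanProfile hH hα h hε
    rw [intervalIntegral.integral_of_le ht.le, ← Set.Ioc_union_Ioi_eq_Ioi ht.le,
      setIntegral_union (Set.Ioc_disjoint_Ioi le_rfl) measurableSet_Ioi
      (hi.mono_set Set.Ioc_subset_Ioi_self) (hi.mono_set (Set.Ioi_subset_Ioi ht.le))]
    ring
  have dom : ∀ t : ℝ, 0 < t → IntegrableOn (fun u : ℝ => u ^ (-(2 * H * α))) (Set.Ioi t) :=
    fun t ht => integrableOn_Ioi_rpow_of_lt (by linarith) ht
  have ptw : ∀ ε : ℝ, 0 < ε → ∀ t : ℝ, 0 < t → ∀ᵐ u ∂volume.restrict (Set.Ioi t),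
      ‖meanProfile H α ε u‖ ≤ u ^ (-(2 * H * α)) := by
    intro ε hε t ht
    refine (ae_restrict_mem measurableSet_Ioi).mono fun u hu => ?_
    have hu0 : (0 : ℝ) < u := ht.trans hu
    rw [Real.norm_of_nonneg (meanProfile_nonneg hε hu0.le)]
    exact meanProfile_le_rpow hα hε.le hu0
  refine ⟨∫ t in (0 : ℝ)..T, - ∫ u in Set.Ioi t, u ^ (-(2 * H * α)), ?_⟩
  have e : (fun ε => ∫ p, (ε + incCov H p p) ^ (-α) ∂triangleMeasure T
      - T * ((∫ z in Set.Ioi (0 : ℝ), (z ^ (2 * H) + 1) ^ (-α)) * ε ^ (-α + 1 / (2 * H))))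
      =ᶠ[𝓝[>] 0] fun ε => ∫ t in (0 : ℝ)..T, ((∫ u in (0 : ℝ)..t, meanProfile H α ε u)
        - ∫ u in Set.Ioi (0 : ℝ), meanProfile H α ε u) := by
    filter_upwards [self_mem_nhdsWithin] with ε hε using key ε hε
  refine Tendsto.congr' e.symm ?_
  -- The majorant is the tail of `u^{-2Hα}` beyond `t`: finite because `2Hα > 1`, and integrable in
  -- `t` near `0` because `2Hα < 2`.
  refine intervalIntegral.tendsto_integral_filter_of_dominated_convergence
    (fun t => t ^ (-(2 * H * α) + 1) / (2 * H * α - 1)) ?_ ?_ ?_ ?_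
  · filter_upwards [self_mem_nhdsWithin] with ε hε
    exact (intervalIntegrable_iff.1 (((continuousOn_primitive_meanProfile hH α hε
      hT.le).intervalIntegrable).sub intervalIntegrable_const)).aestronglyMeasurable
  · filter_upwards [self_mem_nhdsWithin] with ε hε
    refine ae_of_all _ fun t ht => ?_
    rw [Set.uIoc_of_le hT.le] at ht
    rw [tail ε hε t ht.1, norm_neg]
    refine (norm_integral_le_of_norm_le (dom t ht.1) (ptw ε hε t ht.1)).trans_eq ?_
    rw [integral_Ioi_rpow_of_lt (by linarith) ht.1, neg_div, ← div_neg]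
    congr 1
    ring
  · exact (intervalIntegral.intervalIntegrable_rpow' (by linarith)).div_const _
  · refine ae_of_all _ fun t ht => ?_
    rw [Set.uIoc_of_le hT.le] at ht
    have e2 : (fun ε => (∫ u in (0 : ℝ)..t, meanProfile H α ε u)
        - ∫ u in Set.Ioi (0 : ℝ), meanProfile H α ε u) =ᶠ[𝓝[>] 0]
        fun ε => - ∫ u in Set.Ioi t, meanProfile H α ε u := by
      filter_upwards [self_mem_nhdsWithin] with ε hε using tail ε hε t ht.1
    refine Tendsto.congr' e2.symm (Tendsto.neg ?_)
    refine tendsto_integral_filter_of_dominated_convergence _ ?_ ?_ (dom t ht.1) ?_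
    · exact Eventually.of_forall fun ε => (measurable_meanProfile H α ε).aestronglyMeasurable
    · filter_upwards [self_mem_nhdsWithin] with ε hε using ptw ε hε t ht.1
    · exact (ae_restrict_mem measurableSet_Ioi).mono fun u hu => tendsto_meanProfile α (ht.1.trans hu)

/-- In the critical case the primitive of the profile minus the logarithm is bounded on `[1, ∞)`
and has a limit. -/
lemma exists_bound_and_tendsto_primitive_sub_log {H α : ℝ} (hH : 0 < H) (hα : 0 < α)
    (h : 2 * H * α = 1) : ∃ K c : ℝ,
      (∀ x, 1 ≤ x → |(∫ z in (0 : ℝ)..x, meanProfile H α 1 z) - Real.log x| ≤ K) ∧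
      Tendsto (fun x => (∫ z in (0 : ℝ)..x, meanProfile H α 1 z) - Real.log x) atTop (𝓝 c) := by
  set g : ℝ → ℝ := fun z => z ^ (-(1 : ℝ)) - meanProfile H α 1 z with hg
  have hg0 : ∀ z, 0 < z → 0 ≤ g z := fun z hz => by
    have := meanProfile_le_rpow (H := H) hα zero_le_one hz
    rw [h] at this
    exact sub_nonneg.2 this
  -- The tangent inequality shows that the profile differs from `1/z` by at most a multiple of
  -- `z^{-1 - 2H}`, integrable at infinity; this yields both the bound and the limit.
  have hgle : ∀ z, 0 < z → g z ≤ α * z ^ (-1 - 2 * H) := fun z hz => by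
    have h1 := rpow_neg_tangent_le hα (show 0 < z ^ (2 * H) by positivity)
      (show 0 < 1 + z ^ (2 * H) by positivity)
    rw [add_sub_cancel_right, mul_one, ← Real.rpow_mul hz.le, ← Real.rpow_mul hz.le,
      show 2 * H * -α = -1 by linarith, show 2 * H * -(α + 1) = -1 - 2 * H by linarith] at h1
    exact h1
  have hgm : Measurable g := (measurable_id.pow_const _).sub (measurable_meanProfile H α 1)
  have hgi : IntegrableOn g (Set.Ioi 1) := by
    refine ((integrableOn_Ioi_rpow_of_lt (a := -1 - 2 * H) (by linarith) one_pos).const_mul α).mono'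
      hgm.aestronglyMeasurable ?_
    refine (ae_restrict_mem measurableSet_Ioi).mono fun z hz => ?_
    have hz0 : (0 : ℝ) < z := one_pos.trans hz
    rw [Real.norm_of_nonneg (hg0 z hz0)]
    exact hgle z hz0
  have e : ∀ x, 1 ≤ x → (∫ z in (0 : ℝ)..x, meanProfile H α 1 z) - Real.log x
      = (∫ z in (0 : ℝ)..1, meanProfile H α 1 z) - ∫ z in (1 : ℝ)..x, g z := by
    intro x hx
    have hx0 : 0 < x := by linarith
    have i1 : IntervalIntegrable (fun z : ℝ => z ^ (-(1 : ℝ))) volume 1 x := by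
      refine ContinuousOn.intervalIntegrable fun z hz => ?_
      rw [Set.uIcc_of_le hx] at hz
      exact (Real.continuousAt_rpow_const z _ (Or.inl (by linarith [hz.1]))).continuousWithinAt
    have i2 := intervalIntegrable_meanProfile hH α one_pos zero_le_one hx0.le
    have i3 := intervalIntegrable_meanProfile hH α one_pos le_rfl zero_le_one
    have e1 : ∫ z in (1 : ℝ)..x, z ^ (-(1 : ℝ)) = Real.log x := by
      simp only [Real.rpow_neg_one]
      rw [integral_inv_of_pos one_pos hx0, div_one]
    rw [hg, intervalIntegral.integral_sub i1 i2, e1,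
      ← intervalIntegral.integral_add_adjacent_intervals i3 i2]
    ring
  refine ⟨|∫ z in (0 : ℝ)..1, meanProfile H α 1 z| + ∫ z in Set.Ioi 1, g z,
    (∫ z in (0 : ℝ)..1, meanProfile H α 1 z) - ∫ z in Set.Ioi 1, g z, fun x hx => ?_, ?_⟩
  · rw [e x hx]
    refine (abs_sub _ _).trans (add_le_add le_rfl ?_)
    rw [intervalIntegral.integral_of_le hx, abs_of_nonneg (setIntegral_nonneg measurableSet_Ioc
      fun z hz => hg0 z (one_pos.trans hz.1))]
    exact setIntegral_mono_set hgi ((ae_restrict_mem measurableSet_Ioi).mono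
      fun z hz => hg0 z (one_pos.trans hz)) Set.Ioc_subset_Ioi_self.eventuallyLE
  · have := (intervalIntegral_tendsto_integral_Ioi 1 hgi tendsto_id).const_sub
      (∫ z in (0 : ℝ)..1, meanProfile H α 1 z)
    refine this.congr' ?_
    filter_upwards [eventually_ge_atTop 1] with x hx using (e x hx).symm

/-- The expectation in the critical case. -/
lemma exists_tendsto_mean_of_eq_one {H α T : ℝ} (hH : 0 < H) (hα : 0 < α) (hT : 0 < T)
    (h : 2 * H * α = 1) :
    ∃ L, Tendsto (fun ε => ∫ p, (ε + incCov H p p) ^ (-α) ∂triangleMeasure T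
      - T * (1 / (2 * H) * Real.log (1 / ε))) (𝓝[>] 0) (𝓝 L) := by
  obtain ⟨K, c, hK, hc⟩ := exists_bound_and_tendsto_primitive_sub_log hH hα h
  set G : ℝ → ℝ := fun x => ∫ z in (0 : ℝ)..x, meanProfile H α 1 z with hG
  have hexp : -α + 1 / (2 * H) = 0 := by
    rw [eq_div_of_mul_eq (show 2 * H ≠ 0 by positivity) (show α * (2 * H) = 1 by linarith)]
    ring
  -- When `2Hα = 1` the scaling prefactor is `ε^0`, and the logarithm of the rescaled time splits
  -- into `log t` and exactly the counterterm.
  have hprim : ∀ ε : ℝ, 0 < ε → ∀ t : ℝ, 0 < t → (∫ u in (0 : ℝ)..t, meanProfile H α ε u)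
      - 1 / (2 * H) * Real.log (1 / ε) = (G (t / ε ^ (1 / (2 * H)))
        - Real.log (t / ε ^ (1 / (2 * H)))) + Real.log t := by
    intro ε hε t ht
    rw [integral_meanProfile_eq hH α hε ht.le, hexp, Real.rpow_zero, one_mul,
      Real.log_div ht.ne' (by positivity), Real.log_rpow hε, one_div ε, Real.log_inv]
    ring
  have key : ∀ ε : ℝ, 0 < ε → ∫ p, (ε + incCov H p p) ^ (-α) ∂triangleMeasure T
      - T * (1 / (2 * H) * Real.log (1 / ε))
      = ∫ t in (0 : ℝ)..T, ((∫ u in (0 : ℝ)..t, meanProfile H α ε u)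
        - 1 / (2 * H) * Real.log (1 / ε)) := by
    intro ε hε
    rw [integral_triangle_eq hH hα.le hε hT, intervalIntegral.integral_sub
      (continuousOn_primitive_meanProfile hH α hε hT.le).intervalIntegrable
      intervalIntegrable_const, intervalIntegral.integral_const, sub_zero, smul_eq_mul]
  have hG01 : ∀ x, 0 ≤ x → x ≤ 1 → |G x| ≤ 1 := by
    intro x hx0 hx1
    have h1 := intervalIntegral.norm_integral_le_of_norm_le_const (a := 0) (b := x) (C := 1)
      (f := meanProfile H α 1) fun z hz => by
        rw [Set.uIoc_of_le hx0] at hz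
        rw [Real.norm_of_nonneg (meanProfile_nonneg one_pos hz.1.le)]
        exact (meanProfile_le hα one_pos hz.1.le).trans_eq (Real.one_rpow _)
    rw [sub_zero, one_mul, abs_of_nonneg hx0] at h1
    exact h1.trans hx1
  refine ⟨∫ t in (0 : ℝ)..T, (c + Real.log t), ?_⟩
  have e : (fun ε => ∫ p, (ε + incCov H p p) ^ (-α) ∂triangleMeasure T
      - T * (1 / (2 * H) * Real.log (1 / ε))) =ᶠ[𝓝[>] 0]
      fun ε => ∫ t in (0 : ℝ)..T, ((∫ u in (0 : ℝ)..t, meanProfile H α ε u)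
        - 1 / (2 * H) * Real.log (1 / ε)) := by
    filter_upwards [self_mem_nhdsWithin] with ε hε using key ε hε
  refine Tendsto.congr' e.symm ?_
  have hlog : IntervalIntegrable (fun t => |Real.log t|) volume 0 T :=
    (intervalIntegral.intervalIntegrable_log').abs
  refine intervalIntegral.tendsto_integral_filter_of_dominated_convergence
    (fun t => (|K| + 1) + 2 * |Real.log t|) ?_ ?_ ?_ ?_
  · filter_upwards [self_mem_nhdsWithin] with ε hε
    exact (intervalIntegrable_iff.1 (((continuousOn_primitive_meanProfile hH α hε
      hT.le).intervalIntegrable).sub intervalIntegrable_const)).aestronglyMeasurable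
  -- For `ε ≤ 1` the rescaled time is at least `t`. Where it exceeds `1` the bound `K` applies;
  -- where it is below `1` its logarithm is at most `|log t|` in absolute value, and `|G| ≤ 1`.
  · filter_upwards [Ioc_mem_nhdsGT zero_lt_one] with ε hε
    refine ae_of_all _ fun t ht => ?_
    rw [Set.uIoc_of_le hT.le] at ht
    have hk : 0 < ε ^ (1 / (2 * H)) := Real.rpow_pos_of_pos hε.1 _
    have hk1 : ε ^ (1 / (2 * H)) ≤ 1 := Real.rpow_le_one hε.1.le hε.2 (by positivity)
    rw [hprim ε hε.1 t ht.1, Real.norm_eq_abs]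
    refine (abs_add_le _ _).trans ?_
    have hmain : |G (t / ε ^ (1 / (2 * H))) - Real.log (t / ε ^ (1 / (2 * H)))|
        ≤ (|K| + 1) + |Real.log t| := by
      rcases le_total 1 (t / ε ^ (1 / (2 * H))) with h1 | h1
      · have := (hK _ h1).trans (le_abs_self K)
        have := abs_nonneg (Real.log t)
        linarith
      · have h0 : 0 < t / ε ^ (1 / (2 * H)) := div_pos ht.1 hk
        have h2 : t ≤ t / ε ^ (1 / (2 * H)) := by
          rw [le_div_iff₀ hk]
          nlinarith [ht.1]
        have h3 : |Real.log (t / ε ^ (1 / (2 * H)))| ≤ |Real.log t| := by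
          have h4 := Real.log_le_log ht.1 h2
          have h5 := Real.log_nonpos h0.le h1
          rw [abs_of_nonpos h5, abs_of_nonpos (h4.trans h5)]
          linarith
        have h6 := hG01 _ h0.le h1
        have := abs_sub (G (t / ε ^ (1 / (2 * H)))) (Real.log (t / ε ^ (1 / (2 * H))))
        have := abs_nonneg K
        linarith
    linarith
  · exact intervalIntegrable_const.add (hlog.const_mul 2)
  · refine ae_of_all _ fun t ht => ?_
    rw [Set.uIoc_of_le hT.le] at ht
    have hinf : Tendsto (fun ε : ℝ => t / ε ^ (1 / (2 * H))) (𝓝[>] 0) atTop := by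
      have h1 : Tendsto (fun ε : ℝ => ε ^ (1 / (2 * H))) (𝓝[>] 0) (𝓝[>] 0) := by
        refine tendsto_nhdsWithin_iff.2 ⟨?_, ?_⟩
        · have := (Real.continuousAt_rpow_const 0 (1 / (2 * H)) (Or.inr (by positivity))).tendsto
          rw [Real.zero_rpow (by positivity)] at this
          exact this.mono_left nhdsWithin_le_nhds
        · filter_upwards [self_mem_nhdsWithin] with ε hε
          exact Real.rpow_pos_of_pos hε _
      exact (tendsto_inv_nhdsGT_zero.comp h1).const_mul_atTop ht.1
    refine Tendsto.congr' ?_ ((hc.comp hinf).add_const (Real.log t))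
    filter_upwards [self_mem_nhdsWithin] with ε hε using (hprim ε hε t ht.1).symm

/-! ### Criteria for convergence in `L²`. -/

section L2Convergence

variable {Ω : Type*} [MeasurableSpace Ω] {P : Measure Ω} {F : ℝ → Ω → ℝ}

/-- The family `F` as a family in the Hilbert space `L²`, extended by `0`. -/
noncomputable def toL2Family (hF : ∀ ε, 0 < ε → MemLp (F ε) 2 P) (ε : ℝ) : Lp ℝ 2 P :=
  if h : 0 < ε then (hF ε h).toLp (F ε) else 0

lemma coeFn_toL2Family (hF : ∀ ε, 0 < ε → MemLp (F ε) 2 P) {ε : ℝ} (hε : 0 < ε) :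
    toL2Family hF ε =ᵐ[P] F ε := by
  rw [toL2Family, dif_pos hε]
  exact MemLp.coeFn_toLp _

lemma inner_toL2Family (hF : ∀ ε, 0 < ε → MemLp (F ε) 2 P) {ε η : ℝ} (hε : 0 < ε) (hη : 0 < η) :
    inner ℝ (toL2Family hF ε) (toL2Family hF η) = ∫ ω, F ε ω * F η ω ∂P := by
  rw [L2.inner_def]
  refine integral_congr_ae ?_
  filter_upwards [coeFn_toL2Family hF hε, coeFn_toL2Family hF hη] with ω h1 h2
  rw [h1, h2, RCLike.inner_apply, conj_trivial, mul_comm]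

lemma tendsto_toL2Family_iff (hF : ∀ ε, 0 < ε → MemLp (F ε) 2 P) (Z : Lp ℝ 2 P) :
    Tendsto (toL2Family hF) (𝓝[>] 0) (𝓝 Z) ↔
      Tendsto (fun ε => eLpNorm (fun ω => F ε ω - Z ω) 2 P) (𝓝[>] 0) (𝓝 0) := by
  rw [Lp.tendsto_Lp_iff_tendsto_eLpNorm']
  refine tendsto_congr' ?_
  filter_upwards [self_mem_nhdsWithin] with ε hε
  refine eLpNorm_congr_ae ?_
  filter_upwards [coeFn_toL2Family hF hε] with ω h
  simp [h]

/-- A family in `L²` whose covariances converge jointly converges in `L²`. -/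
lemma convergesInL2_of_tendsto_integral_mul (hF : ∀ ε, 0 < ε → MemLp (F ε) 2 P) {L : ℝ}
    (h : Tendsto (fun x : ℝ × ℝ => ∫ ω, F x.1 ω * F x.2 ω ∂P) (𝓝[>] 0 ×ˢ 𝓝[>] 0) (𝓝 L)) :
    ConvergesInL2 P F := by
  refine ⟨hF, ?_⟩
  have hdiag : Tendsto (fun ε : ℝ => ∫ ω, F ε ω * F ε ω ∂P) (𝓝[>] 0) (𝓝 L) :=
    h.comp (tendsto_id.prodMk tendsto_id)
  have hc : Cauchy (map (toL2Family hF) (𝓝[>] 0)) := by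
    rw [cauchy_map_iff]
    refine ⟨inferInstance, ?_⟩
    rw [tendsto_uniformity_iff_dist_tendsto_zero]
    -- The squared distance of `F ε` and `F η` expands into three covariances, with limit `L - 2L +
    -- L = 0`.
    have h1 : Tendsto (fun x : ℝ × ℝ => ∫ ω, F x.1 ω * F x.1 ω ∂P
        - 2 * ∫ ω, F x.1 ω * F x.2 ω ∂P + ∫ ω, F x.2 ω * F x.2 ω ∂P)
        (𝓝[>] 0 ×ˢ 𝓝[>] 0) (𝓝 (L - 2 * L + L)) :=
      ((hdiag.comp tendsto_fst).sub (h.const_mul 2)).add (hdiag.comp tendsto_snd)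
    have h2 := h1.sqrt
    rw [show L - 2 * L + L = 0 by ring, Real.sqrt_zero] at h2
    refine h2.congr' ?_
    filter_upwards [prod_mem_prod self_mem_nhdsWithin self_mem_nhdsWithin] with x hx
    rw [dist_eq_norm, ← inner_toL2Family hF hx.1 hx.1, ← inner_toL2Family hF hx.1 hx.2,
      ← inner_toL2Family hF hx.2 hx.2, real_inner_self_eq_norm_sq, real_inner_self_eq_norm_sq,
      ← norm_sub_sq_real, Real.sqrt_sq (norm_nonneg _)]
  obtain ⟨Z, hZ⟩ := CompleteSpace.complete hc
  exact ⟨Z, Lp.memLp Z, (tendsto_toL2Family_iff hF Z).1 hZ⟩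

/-- Continuity of the norm; this necessary condition is what fails for `H ≥ 3/(2d)`. -/
lemma ConvergesInL2.exists_tendsto_integral_mul_self (h : ConvergesInL2 P F) :
    ∃ L, Tendsto (fun ε : ℝ => ∫ ω, F ε ω * F ε ω ∂P) (𝓝[>] 0) (𝓝 L) := by
  obtain ⟨hF, Z, hZ, hlim⟩ := h
  have h1 : Tendsto (toL2Family hF) (𝓝[>] 0) (𝓝 (hZ.toLp Z)) := by
    rw [tendsto_toL2Family_iff]
    refine hlim.congr fun ε => eLpNorm_congr_ae ?_
    filter_upwards [hZ.coeFn_toLp] with ω hω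
    rw [hω]
  refine ⟨_, (h1.norm.pow 2).congr' ?_⟩
  filter_upwards [self_mem_nhdsWithin] with ε hε
  rw [← real_inner_self_eq_norm_sq, inner_toL2Family hF hε hε]

lemma ConvergesInL2.add_deterministic [IsProbabilityMeasure P] (h : ConvergesInL2 P F)
    {m : ℝ → ℝ} {a : ℝ} (hm : Tendsto m (𝓝[>] 0) (𝓝 a)) {G : ℝ → Ω → ℝ}
    (hG : ∀ ε, 0 < ε → ∀ ω, G ε ω = F ε ω + m ε) : ConvergesInL2 P G := by
  obtain ⟨hF, Z, hZ, hlim⟩ := h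
  have e : ∀ ε, 0 < ε → G ε = fun ω => F ε ω + m ε := fun ε hε => funext (hG ε hε)
  refine ⟨fun ε hε => e ε hε ▸ (hF ε hε).add (memLp_const _), fun ω => Z ω + a,
    hZ.add (memLp_const _), ?_⟩
  have h2 : Tendsto (fun ε => eLpNorm (fun ω => F ε ω - Z ω) 2 P + ‖m ε - a‖ₑ) (𝓝[>] 0)
      (𝓝 (0 + ‖a - a‖ₑ)) := hlim.add (hm.sub_const a).enorm
  rw [sub_self, enorm_zero, add_zero] at h2
  refine tendsto_of_tendsto_of_tendsto_of_le_of_le' tendsto_const_nhds h2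
    (Eventually.of_forall fun _ => zero_le) ?_
  filter_upwards [self_mem_nhdsWithin] with ε hε
  have e2 : (fun ω => G ε ω - (Z ω + a)) = (fun ω => F ε ω - Z ω) + fun _ => m ε - a := by
    ext ω
    simp only [hG ε hε, Pi.add_apply]
    ring
  rw [e2]
  refine (eLpNorm_add_le ((hF ε hε).sub hZ).aestronglyMeasurable aestronglyMeasurable_const
    (by norm_num)).trans ?_
  rw [eLpNorm_const _ (by norm_num) (IsProbabilityMeasure.ne_zero P)]
  exact add_le_add le_rfl (by simp)

end L2Convergence

/-! ### Joint convergence of the covariances below the threshold. -/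

lemma ae_triangleMeasure_ne (T a : ℝ) :
    ∀ᵐ q ∂triangleMeasure T, a ≠ q.1 ∧ a ≠ q.2 := by
  have h : ∀ᵐ t ∂timeMeasure T, a ≠ t := by
    refine ae_restrict_of_ae ?_
    have := Set.Countable.ae_notMem (Set.countable_singleton a) (volume : Measure ℝ)
    filter_upwards [this] with t ht h
    exact ht (by simp [h])
  have hle := (triangleMeasure_le T).absolutelyContinuous
  filter_upwards [hle.ae_le (Measure.quasiMeasurePreserving_fst (ν := timeMeasure T) |>.ae h),
    hle.ae_le (Measure.quasiMeasurePreserving_snd (μ := timeMeasure T) |>.ae h)] with q h1 h2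
  exact ⟨h1, h2⟩

/-- Almost all pairs of increments are in general position. -/
lemma ae_general_position (T : ℝ) :
    ∀ᵐ x ∂(triangleMeasure T).prod (triangleMeasure T), x.1.2 < x.1.1 ∧ x.2.2 < x.2.1 ∧
      x.1.1 ≠ x.2.1 ∧ x.1.1 ≠ x.2.2 ∧ x.1.2 ≠ x.2.1 ∧ x.1.2 ≠ x.2.2 := by
  have hm : MeasurableSet {x : (ℝ × ℝ) × (ℝ × ℝ) | x.1.1 ≠ x.2.1 ∧ x.1.1 ≠ x.2.2 ∧
      x.1.2 ≠ x.2.1 ∧ x.1.2 ≠ x.2.2} := by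
    refine MeasurableSet.inter ?_ (MeasurableSet.inter ?_ (MeasurableSet.inter ?_ ?_)) <;>
      exact (measurableSet_eq_fun (by fun_prop) (by fun_prop)).compl
  have h1 := (Measure.ae_prod_iff_ae_ae (μ := triangleMeasure T) (ν := triangleMeasure T) hm).2
    (ae_of_all _ fun p => by
      filter_upwards [ae_triangleMeasure_ne T p.1, ae_triangleMeasure_ne T p.2] with q h1 h2
      exact ⟨h1.1, h1.2, h2.1, h2.2⟩)
  have h2 : ∀ᵐ p ∂triangleMeasure T, p ∈ triangle T := ae_restrict_mem (measurableSet_triangle T)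
  filter_upwards [h1, Measure.quasiMeasurePreserving_fst (ν := triangleMeasure T) |>.ae h2,
    Measure.quasiMeasurePreserving_snd (μ := triangleMeasure T) |>.ae h2] with x hx hp hq
  exact ⟨hp.2.1, hq.2.1, hx⟩

lemma measurable_covKernel (H α ε η : ℝ) : Measurable (covKernel H α ε η) := by
  have m1 : Measurable fun x : (ℝ × ℝ) × (ℝ × ℝ) => ε + incCov H x.1 x.1 :=
    ((measurable_incCov_self H).comp measurable_fst).const_add ε
  have m2 : Measurable fun x : (ℝ × ℝ) × (ℝ × ℝ) => η + incCov H x.2 x.2 :=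
    ((measurable_incCov_self H).comp measurable_snd).const_add η
  exact (((m1.mul m2).sub ((measurable_incCov H).pow_const 2)).pow_const _).sub
    ((m1.mul m2).pow_const _)

lemma tendsto_covKernel {H : ℝ} (hH : 0 < H) (α : ℝ) {x : (ℝ × ℝ) × (ℝ × ℝ)}
    (h1 : x.1.1 ≠ x.1.2) (h2 : x.2.1 ≠ x.2.2) (hx : 0 < incDet H x.1 x.2) :
    Tendsto (fun e : ℝ × ℝ => covKernel H α e.1 e.2 x) (𝓝[>] 0 ×ˢ 𝓝[>] 0)
      (𝓝 (covKernel H α 0 0 x)) := by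
  have hle : (𝓝[>] (0 : ℝ) ×ˢ 𝓝[>] (0 : ℝ)) ≤ 𝓝 ((0 : ℝ), (0 : ℝ)) := by
    rw [nhds_prod_eq]
    exact Filter.prod_mono nhdsWithin_le_nhds nhdsWithin_le_nhds
  refine Tendsto.mono_left ?_ hle
  have hc : Continuous fun e : ℝ × ℝ => (e.1 + incCov H x.1 x.1) * (e.2 + incCov H x.2 x.2) := by
    fun_prop
  have hpos : 0 < (0 + incCov H x.1 x.1) * (0 + incCov H x.2 x.2) := by
    rw [zero_add, zero_add]
    exact mul_pos (incCov_self_pos hH h1) (incCov_self_pos hH h2)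
  have hdet : 0 < (0 + incCov H x.1 x.1) * (0 + incCov H x.2 x.2) - incCov H x.1 x.2 ^ 2 := by
    rwa [zero_add, zero_add]
  exact (((hc.sub continuous_const).tendsto ((0 : ℝ), (0 : ℝ))).rpow_const (Or.inl hdet.ne')).sub
    ((hc.tendsto ((0 : ℝ), (0 : ℝ))).rpow_const (Or.inl hpos.ne'))

/-- Regularization only increases the determinant, so bounds through `incDet` are uniform in `ε` and
`η`. -/
lemma incDet_le {H : ℝ} (hH : 0 < H) {ε η : ℝ} (hε : 0 ≤ ε) (hη : 0 ≤ η) (p q : ℝ × ℝ) :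
    incDet H p q ≤ (ε + incCov H p p) * (η + incCov H q q) - incCov H p q ^ 2 := by
  have h1 := incCov_self_nonneg hH p
  have h2 := incCov_self_nonneg hH q
  rw [incDet]
  nlinarith [mul_nonneg hε h2, mul_nonneg hη h1, mul_nonneg hε hη]

lemma covKernel_nonneg {H α : ℝ} (hH : 0 < H) (hα : 0 < α) {ε η : ℝ} (hε : 0 ≤ ε) (hη : 0 ≤ η)
    {x : (ℝ × ℝ) × (ℝ × ℝ)} (hx : 0 < incDet H x.1 x.2) : 0 ≤ covKernel H α ε η x :=
  sub_rpow_nonneg hα (hx.trans_le (incDet_le hH hε hη _ _))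

/-- Joint convergence of the covariances in the range `4 H α < 3`. -/
lemma tendsto_integral_covKernel {H α : ℝ} (hH : 0 < H) (hH' : H < 1) (hα : 1 ≤ α)
    (hαH : 4 * H * α < 3) (T : ℝ) :
    Tendsto (fun e : ℝ × ℝ => ∫ x, covKernel H α e.1 e.2 x
      ∂((triangleMeasure T).prod (triangleMeasure T))) (𝓝[>] 0 ×ˢ 𝓝[>] 0)
      (𝓝 (∫ x, covKernel H α 0 0 x ∂((triangleMeasure T).prod (triangleMeasure T)))) := by
  have hα0 : 0 < α := by linarith
  refine tendsto_integral_filter_of_dominated_convergence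
    (fun x => domConst H α * pathSum (4 * H * α / 3) x.1 x.2) ?_ ?_ ?_ ?_
  · exact Eventually.of_forall fun e => (measurable_covKernel H α _ _).aestronglyMeasurable
  · filter_upwards [prod_mem_prod self_mem_nhdsWithin self_mem_nhdsWithin] with e he
    have he1 : (0 : ℝ) < e.1 := he.1
    have he2 : (0 : ℝ) < e.2 := he.2
    filter_upwards [ae_general_position T] with x hx
    obtain ⟨hpos, hle⟩ := incDet_pos_and_detBound_le hH hH' hα hx.1 hx.2.1 hx.2.2.1 hx.2.2.2.1
      hx.2.2.2.2.1 hx.2.2.2.2.2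
    rw [Real.norm_of_nonneg (covKernel_nonneg hH hα0 he1.le he2.le hpos)]
    exact (sub_rpow_le_detBound hα0 hpos (incDet_le hH he1.le he2.le _ _)).trans (hle hαH)
  · exact (integrable_pathSum (by positivity) (by linarith) T).const_mul _
  · filter_upwards [ae_general_position T] with x hx
    exact tendsto_covKernel hH α hx.1.ne' hx.2.1.ne' (incDet_pos_and_detBound_le hH hH' hα hx.1
      hx.2.1 hx.2.2.1 hx.2.2.2.1 hx.2.2.2.2.1 hx.2.2.2.2.2).1

/-! ### Divergence of the variances from the threshold on. -/

/-- The lower bound for the covariance kernel on interlaced increments of comparable length. -/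
lemma exists_le_covKernel {H α : ℝ} (hH : 0 < H) (hH' : H < 1) (hα : 1 ≤ α) :
    ∃ k, 0 < k ∧ ∀ t s t' s' : ℝ, s < s' → s' < s + (t - s) / 4 → t < t' →
      t' < t + (t - s) / 4 → k * (t - s) ^ (-(4 * H * α)) ≤ covKernel H α 0 0 ((t, s), (t', s')) := by
  have hα0 : 0 < α := by linarith
  -- With `u = t - s`, the differences `t - s'` and `t' - s` are at least `3u/4`, while `t' - t` and
  -- `s' - s` are at most `u/4`; hence the covariance is at least `κ u^{2H}`.
  set κ : ℝ := (3 / 4 : ℝ) ^ (2 * H) - (1 / 4 : ℝ) ^ (2 * H) with hκ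
  have hκ0 : 0 < κ := sub_pos.2 (Real.rpow_lt_rpow (by norm_num) (by norm_num) (by positivity))
  -- Both increments have length at most `2u`, so the product of the variances is at most
  -- `(2u)^{4H}`; this is the source of the power of `2`.
  refine ⟨α * κ ^ 2 * 2 ^ (-(4 * H * (α + 1))), by positivity, fun t s t' s' h1 h2 h3 h4 => ?_⟩
  obtain ⟨u, hu, rfl⟩ : ∃ u, 0 < u ∧ t = s + u := ⟨t - s, by linarith, by ring⟩
  rw [add_sub_cancel_left] at h2 h4 ⊢
  obtain ⟨hdet, -⟩ := incDet_pos_and_detBound_le hH hH' hα (p := (s + u, s)) (q := (t', s'))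
    (by simp; linarith) (by simp; linarith) (by simp; linarith) (by simp; linarith)
    (by simp; linarith) (by simp; linarith)
  have hl : 0 < incCov H (s + u, s) (s + u, s) := incCov_self_pos hH (by simp; linarith)
  have hr : 0 < incCov H (t', s') (t', s') := incCov_self_pos hH (by simp; linarith)
  have hl' : incCov H (s + u, s) (s + u, s) ≤ (2 * u) ^ (2 * H) := by
    rw [incCov_self hH, add_sub_cancel_left, abs_of_pos hu]
    exact Real.rpow_le_rpow hu.le (by linarith) (by positivity)
  have hr' : incCov H (t', s') (t', s') ≤ (2 * u) ^ (2 * H) := by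
    rw [incCov_self hH, abs_of_pos (by simp; linarith)]
    exact Real.rpow_le_rpow (by simp; linarith) (by simp; linarith) (by positivity)
  have hμ : κ * u ^ (2 * H) ≤ incCov H (s + u, s) (t', s') := by
    have e1 : (3 / 4 * u) ^ (2 * H) ≤ |s + u - s'| ^ (2 * H) :=
      Real.rpow_le_rpow (by positivity) (by rw [abs_of_pos] <;> linarith) (by positivity)
    have e2 : (3 / 4 * u) ^ (2 * H) ≤ |s - t'| ^ (2 * H) :=
      Real.rpow_le_rpow (by positivity) (by rw [abs_of_neg] <;> linarith) (by positivity)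
    have e3 : |s + u - t'| ^ (2 * H) ≤ (1 / 4 * u) ^ (2 * H) :=
      Real.rpow_le_rpow (by positivity) (by rw [abs_of_neg] <;> linarith) (by positivity)
    have e4 : |s - s'| ^ (2 * H) ≤ (1 / 4 * u) ^ (2 * H) :=
      Real.rpow_le_rpow (by positivity) (by rw [abs_of_neg] <;> linarith) (by positivity)
    rw [Real.mul_rpow (by norm_num) hu.le] at e1 e2 e3 e4
    simp only [incCov, hκ]
    linarith
  have hx : 0 < incCov H (s + u, s) (s + u, s) * incCov H (t', s') (t', s') := mul_pos hl hr
  have hxle : incCov H (s + u, s) (s + u, s) * incCov H (t', s') (t', s') ≤ (2 * u) ^ (4 * H) := by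
    refine (mul_le_mul hl' hr' hr.le (by positivity)).trans_eq ?_
    rw [← Real.rpow_add (by positivity)]
    ring_nf
  rw [incDet] at hdet
  have htan := rpow_neg_tangent_le hα0 hx hdet
  rw [sub_sub_cancel_left] at htan
  simp only [covKernel, zero_add]
  have hpow := Real.rpow_le_rpow_of_nonpos hx hxle (show -(α + 1) ≤ 0 by linarith)
  have hμ2 : (κ * u ^ (2 * H)) ^ 2 ≤ incCov H (s + u, s) (t', s') ^ 2 := by gcongr
  calc α * κ ^ 2 * 2 ^ (-(4 * H * (α + 1))) * u ^ (-(4 * H * α))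
      = α * (κ * u ^ (2 * H)) ^ 2 * ((2 * u) ^ (4 * H)) ^ (-(α + 1)) := by
        rw [← Real.rpow_mul (by positivity), Real.mul_rpow (by positivity) hu.le, mul_pow,
          ← Real.rpow_natCast (u ^ _), ← Real.rpow_mul hu.le,
          show u ^ (-(4 * H * α)) = u ^ (2 * H * (2 : ℕ)) * u ^ (4 * H * -(α + 1)) by
            rw [← Real.rpow_add hu]; congr 1; push_cast; ring]
        ring_nf
    _ ≤ α * incCov H (s + u, s) (t', s') ^ 2 *
        (incCov H (s + u, s) (s + u, s) * incCov H (t', s') (t', s')) ^ (-(α + 1)) := by gcongr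
    _ ≤ _ := by linarith

lemma lintegral_Ioo_rpow_eq_top {r c : ℝ} (hr : r ≤ -1) (hc : 0 < c) :
    ∫⁻ u in Set.Ioo 0 c, ENNReal.ofReal (u ^ r) = ∞ := by
  by_contra hne
  have hi : IntegrableOn (fun u : ℝ => u ^ r) (Set.Ioo 0 c) := by
    refine ⟨(measurable_id.pow_const _).aestronglyMeasurable, ?_⟩
    rw [hasFiniteIntegral_iff_ofReal]
    · exact lt_top_iff_ne_top.2 hne
    · exact (ae_restrict_mem measurableSet_Ioo).mono fun u hu => Real.rpow_nonneg hu.1.le _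
  rw [intervalIntegral.integrableOn_Ioo_rpow_iff hc] at hi
  linarith

/-- The limiting covariance kernel is not integrable if `3 ≤ 4 H α`. -/
lemma lintegral_covKernel_eq_top {H α T : ℝ} (hH : 0 < H) (hH' : H < 1) (hα : 1 ≤ α)
    (hαH : 3 ≤ 4 * H * α) (hT : 0 < T) :
    ∫⁻ x, ENNReal.ofReal (covKernel H α 0 0 x)
      ∂((triangleMeasure T).prod (triangleMeasure T)) = ∞ := by
  obtain ⟨k, hk, hle⟩ := exists_le_covKernel hH hH' hα
  rw [lintegral_prod _ (measurable_covKernel H α 0 0).ennreal_ofReal.aemeasurable]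
  -- Increments of length below `T/4` starting before `T/2`: the slightly shifted increments in `R`
  -- below then stay in the triangle.
  set S : Set (ℝ × ℝ) := {p | 0 < p.2 ∧ p.2 < T / 2 ∧ p.2 < p.1 ∧ p.1 < p.2 + T / 4} with hS
  have hSm : MeasurableSet S :=
    (measurableSet_lt measurable_const measurable_snd).inter
      ((measurableSet_lt measurable_snd measurable_const).inter
      ((measurableSet_lt measurable_snd measurable_fst).inter
      (measurableSet_lt measurable_fst (measurable_snd.add_const _))))
  have hST : S ⊆ triangle T := fun p hp => ⟨hp.1, hp.2.2.1, by linarith [hp.2.1, hp.2.2.2]⟩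
  have inner : ∀ p ∈ S, ENNReal.ofReal (k / 16) * ENNReal.ofReal ((p.1 - p.2) ^ (2 - 4 * H * α))
      ≤ ∫⁻ q, ENNReal.ofReal (covKernel H α 0 0 (p, q)) ∂triangleMeasure T := by
    rintro ⟨t, s⟩ ⟨hs0, hs1, hst, ht⟩
    simp only at hs0 hs1 hst ht ⊢
    have hu : 0 < t - s := sub_pos.2 hst
    -- Its area `u²/16`, with `u = t - s`, turns `u^{-4Hα}` into `u^{2 - 4Hα}`, not integrable at
    -- `0` exactly when `4Hα ≥ 3`.
    set R : Set (ℝ × ℝ) := Set.Ioo t (t + (t - s) / 4) ×ˢ Set.Ioo s (s + (t - s) / 4) with hR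
    have hRm : MeasurableSet R := measurableSet_Ioo.prod measurableSet_Ioo
    have hRT : R ⊆ triangle T := fun q hq =>
      ⟨hs0.trans hq.2.1, by linarith [hq.2.2, hq.1.1], by linarith [hq.1.2]⟩
    have hvol : triangleMeasure T R = ENNReal.ofReal ((t - s) / 4) * ENNReal.ofReal ((t - s) / 4) := by
      rw [triangleMeasure, Measure.restrict_apply hRm, Set.inter_eq_left.2 hRT, hR,
        Measure.volume_eq_prod, Measure.prod_prod, Real.volume_Ioo, Real.volume_Ioo,
        add_sub_cancel_left, add_sub_cancel_left]
    calc ENNReal.ofReal (k / 16) * ENNReal.ofReal ((t - s) ^ (2 - 4 * H * α))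
        = ENNReal.ofReal (k * (t - s) ^ (-(4 * H * α))) * triangleMeasure T R := by
          rw [hvol, ← ENNReal.ofReal_mul (by positivity), ← ENNReal.ofReal_mul (by positivity),
            ← ENNReal.ofReal_mul (by positivity), sub_eq_add_neg 2, Real.rpow_add hu,
            Real.rpow_two]
          ring_nf
      _ = ∫⁻ _ in R, ENNReal.ofReal (k * (t - s) ^ (-(4 * H * α))) ∂triangleMeasure T := by
          rw [setLIntegral_const]
      _ ≤ ∫⁻ q in R, ENNReal.ofReal (covKernel H α 0 0 ((t, s), q)) ∂triangleMeasure T := by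
          refine setLIntegral_mono' hRm fun q hq => ENNReal.ofReal_le_ofReal ?_
          exact hle t s q.1 q.2 hq.2.1 hq.2.2 hq.1.1 hq.1.2
      _ ≤ _ := setLIntegral_le_lintegral _ _
  rw [eq_top_iff]
  calc (∞ : ℝ≥0∞) = ENNReal.ofReal (k / 16) * ∫⁻ p in S,
        ENNReal.ofReal ((p.1 - p.2) ^ (2 - 4 * H * α)) := by
        have hm : Measurable (S.indicator fun p : ℝ × ℝ =>
            ENNReal.ofReal ((p.1 - p.2) ^ (2 - 4 * H * α))) :=
          (((measurable_fst.sub measurable_snd).pow_const _).ennreal_ofReal).indicator hSm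
        have h1 : ∀ s ∈ Set.Ioo 0 (T / 2), ∫⁻ t, S.indicator (fun p : ℝ × ℝ =>
            ENNReal.ofReal ((p.1 - p.2) ^ (2 - 4 * H * α))) (t, s) = ∞ := by
          intro s hs
          rw [← lintegral_Ioo_rpow_eq_top (r := 2 - 4 * H * α) (by linarith)
            (show 0 < T / 4 by positivity), ← lintegral_indicator measurableSet_Ioo,
            ← lintegral_sub_right_eq_self ((Set.Ioo 0 (T / 4)).indicator fun u : ℝ =>
              ENNReal.ofReal (u ^ (2 - 4 * H * α))) s]
          congr 1
          ext t
          by_cases ht : t - s ∈ Set.Ioo 0 (T / 4)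
          · rw [Set.indicator_of_mem ht, Set.indicator_of_mem]
            exact ⟨hs.1, hs.2, by linarith [ht.1], by linarith [ht.2]⟩
          · rw [Set.indicator_of_notMem ht, Set.indicator_of_notMem]
            exact fun hp => ht ⟨by linarith [hp.2.2.1], by linarith [hp.2.2.2]⟩
        have h2 : ∫⁻ p in S, ENNReal.ofReal ((p.1 - p.2) ^ (2 - 4 * H * α)) = ∞ := by
          rw [← lintegral_indicator hSm, Measure.volume_eq_prod,
            lintegral_prod_symm _ hm.aemeasurable, eq_top_iff]
          refine le_trans ?_ (setLIntegral_le_lintegral (Set.Ioo 0 (T / 2)) _)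
          rw [setLIntegral_congr_fun measurableSet_Ioo h1, setLIntegral_const, Real.volume_Ioo,
            sub_zero, ENNReal.top_mul]
          simpa using hT
        rw [h2, ENNReal.mul_top]
        simpa using hk
    _ = ∫⁻ p in S, ENNReal.ofReal (k / 16) * ENNReal.ofReal ((p.1 - p.2) ^ (2 - 4 * H * α)) := by
        rw [lintegral_const_mul]
        exact ((measurable_fst.sub measurable_snd).pow_const _).ennreal_ofReal
    _ ≤ ∫⁻ p in S, ∫⁻ q, ENNReal.ofReal (covKernel H α 0 0 (p, q)) ∂triangleMeasure T :=
        setLIntegral_mono' hSm inner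
    _ ≤ _ := lintegral_mono_set hST

/-- The variances do not stay bounded if `3 ≤ 4 H α`. -/
lemma not_tendsto_integral_covKernel {H α T : ℝ} (hH : 0 < H) (hH' : H < 1) (hα : 1 ≤ α)
    (hαH : 3 ≤ 4 * H * α) (hT : 0 < T) (L : ℝ)
    (hint : ∀ ε, 0 < ε → Integrable (covKernel H α ε ε)
      ((triangleMeasure T).prod (triangleMeasure T))) :
    ¬ Tendsto (fun ε : ℝ => ∫ x, covKernel H α ε ε x
      ∂((triangleMeasure T).prod (triangleMeasure T))) (𝓝[>] 0) (𝓝 L) := by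
  intro hlim
  have hα0 : 0 < α := by linarith
  obtain ⟨e, hpos, hseq⟩ : ∃ e : ℕ → ℝ, (∀ n, 0 < e n) ∧ Tendsto e atTop (𝓝[>] 0) := by
    have hpos : ∀ n : ℕ, 0 < 1 / ((n : ℝ) + 1) := fun n => Nat.one_div_pos_of_nat
    exact ⟨_, hpos, tendsto_nhdsWithin_iff.2 ⟨tendsto_one_div_add_atTop_nhds_zero_nat,
      Eventually.of_forall hpos⟩⟩
  -- Fatou along `ε = 1/(n + 1)`: the pointwise limit of the nonnegative kernels has infinite
  -- integral, whereas a limit `L` of the variances would bound it by a finite number.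
  have h1 := lintegral_liminf_le (u := (atTop : Filter ℕ)) (μ := (triangleMeasure T).prod (triangleMeasure T))
    (f := fun (n : ℕ) x => ENNReal.ofReal (covKernel H α (e n) (e n) x))
    fun n => (measurable_covKernel H α _ _).ennreal_ofReal
  have hdet : ∀ᵐ x ∂(triangleMeasure T).prod (triangleMeasure T),
      x.1.1 ≠ x.1.2 ∧ x.2.1 ≠ x.2.2 ∧ 0 < incDet H x.1 x.2 := by
    filter_upwards [ae_general_position T] with x hx
    exact ⟨hx.1.ne', hx.2.1.ne', (incDet_pos_and_detBound_le hH hH' hα hx.1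
      hx.2.1 hx.2.2.1 hx.2.2.2.1 hx.2.2.2.2.1 hx.2.2.2.2.2).1⟩
  have h2 : ∫⁻ x, liminf (fun n : ℕ => ENNReal.ofReal
      (covKernel H α (e n) (e n) x)) atTop
      ∂((triangleMeasure T).prod (triangleMeasure T)) = ∞ := by
    rw [← lintegral_covKernel_eq_top hH hH' hα hαH hT]
    refine lintegral_congr_ae ?_
    filter_upwards [hdet] with x hx
    have hx1 := tendsto_covKernel hH α hx.1 hx.2.1 hx.2.2
    have hx2 := hx1.comp (hseq.prodMk hseq)
    have hx3 := ENNReal.tendsto_ofReal hx2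
    simp only [Function.comp_apply] at hx3
    exact hx3.liminf_eq
  have h3 : Tendsto (fun n : ℕ => ∫⁻ x, ENNReal.ofReal
      (covKernel H α (e n) (e n) x)
      ∂((triangleMeasure T).prod (triangleMeasure T))) atTop (𝓝 (ENNReal.ofReal L)) := by
    refine (ENNReal.tendsto_ofReal (hlim.comp hseq)).congr fun n => ?_
    simp only [Function.comp_apply]
    rw [ofReal_integral_eq_lintegral_ofReal (hint _ (hpos n))]
    filter_upwards [hdet] with x hx
    exact covKernel_nonneg hH hα0 (hpos n).le (hpos n).le hx.2.2
  rw [h2, h3.liminf_eq] at h1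
  exact ENNReal.ofReal_ne_top (top_le_iff.1 h1)

/-! ### Conclusion with `α = d/2`. -/

section Main

variable {Ω : Type*} [MeasurableSpace Ω] {P : Measure Ω} [IsProbabilityMeasure P] {d : ℕ} {H T : ℝ}
  {B : ℝ≥0 → Ω → EuclideanSpace ℝ (Fin d)}

lemma memLp_centered (hBm : JointlyAEMeasurable B P) (hT : 0 < T) :
    ∀ ε, 0 < ε → MemLp (fun ω => approxSelfIntersectionLocalTime B T ε ω
      - ∫ ω', approxSelfIntersectionLocalTime B T ε ω' ∂P) 2 P :=
  fun _ hε => (memLp_approx hBm hT hε).sub (memLp_const _)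

/-- Convergence of the centred approximations. -/
lemma convergesInL2_centered (hB : IsFractionalBrownianMotion H B P)
    (hBm : JointlyAEMeasurable B P) (hd : 2 ≤ d) (hH : 0 < H) (hH' : H < 1) (hT : 0 < T)
    (h : H < 3 / (2 * (d : ℝ))) :
    ConvergesInL2 P (fun ε ω => approxSelfIntersectionLocalTime B T ε ω
      - ∫ ω', approxSelfIntersectionLocalTime B T ε ω' ∂P) := by
  have hd' : (2 : ℝ) ≤ d := by exact_mod_cast hd
  rw [lt_div_iff₀ (by positivity)] at h
  refine convergesInL2_of_tendsto_integral_mul (memLp_centered hBm hT)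
    (((tendsto_integral_covKernel hH hH' (show (1 : ℝ) ≤ (d : ℝ) / 2 by linarith)
    (by linarith) T).const_mul ((2 * Real.pi) ^ (-(d : ℝ)))).congr' ?_)
  filter_upwards [prod_mem_prod self_mem_nhdsWithin self_mem_nhdsWithin] with x hx
  exact (integral_centered_mul_centered hB hBm hH hH' hT hx.1 hx.2).symm

lemma integrable_covKernel (hH : 0 < H) (hH' : H < 1) {α ε η : ℝ} (hα : 0 ≤ α) (hε : 0 < ε)
    (hη : 0 < η) (T : ℝ) :
    Integrable (covKernel H α ε η) ((triangleMeasure T).prod (triangleMeasure T)) :=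
  (integrable_rpow_det hH hH' hα hε hη T).sub (integrable_rpow_mul_incCov_self hH hα hε hη T)

/-- Divergence of the centred approximations. -/
lemma not_convergesInL2_centered (hB : IsFractionalBrownianMotion H B P)
    (hBm : JointlyAEMeasurable B P) (hd : 2 ≤ d) (hH : 0 < H) (hH' : H < 1) (hT : 0 < T)
    (h : 3 / (2 * (d : ℝ)) ≤ H) :
    ¬ ConvergesInL2 P (fun ε ω => approxSelfIntersectionLocalTime B T ε ω
      - ∫ ω', approxSelfIntersectionLocalTime B T ε ω' ∂P) := by
  intro hconv
  have hd' : (2 : ℝ) ≤ d := by exact_mod_cast hd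
  rw [div_le_iff₀ (by positivity)] at h
  have hpi : 0 < (2 * Real.pi) ^ (-(d : ℝ)) := Real.rpow_pos_of_pos Real.two_pi_pos _
  obtain ⟨L, hL⟩ := hconv.exists_tendsto_integral_mul_self
  refine not_tendsto_integral_covKernel (α := (d : ℝ) / 2) hH hH' (by linarith) (by linarith) hT
    (((2 * Real.pi) ^ (-(d : ℝ)))⁻¹ * L)
    (fun ε hε => integrable_covKernel hH hH' (by positivity) hε hε T) ?_
  refine (hL.const_mul _).congr' ?_
  filter_upwards [self_mem_nhdsWithin] with ε hε
  rw [integral_centered_mul_centered hB hBm hH hH' hT hε hε, inv_mul_cancel_left₀ hpi.ne']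

/-- The centred approximations may be recentred deterministically. -/
lemma convergesInL2_of_tendsto_mean (hB : IsFractionalBrownianMotion H B P)
    (hBm : JointlyAEMeasurable B P) (hd : 2 ≤ d) (hH : 0 < H) (hH' : H < 1) (hT : 0 < T)
    (h : H < 3 / (2 * (d : ℝ))) {c : ℝ → ℝ} {L : ℝ}
    (hc : Tendsto (fun ε => ∫ p, (ε + incCov H p p) ^ (-((d : ℝ) / 2)) ∂triangleMeasure T - c ε)
      (𝓝[>] 0) (𝓝 L)) {G : ℝ → Ω → ℝ} (hG : ∀ ε ω, G ε ω =
        approxSelfIntersectionLocalTime B T ε ω - (2 * Real.pi) ^ (-(d : ℝ) / 2) * c ε) :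
    ConvergesInL2 P G := by
  refine (convergesInL2_centered hB hBm hd hH hH' hT h).add_deterministic
    (hc.const_mul ((2 * Real.pi) ^ (-(d : ℝ) / 2))) fun ε hε ω => ?_
  rw [hG, integral_approx hB hBm hH hT hε]
  ring

end Main

theorem theorem1 {Ω : Type*} [MeasurableSpace Ω] (P : Measure Ω) [IsProbabilityMeasure P]
    (d : ℕ) (hd : 2 ≤ d) (H : ℝ) (hH : 0 < H) (hH' : H < 1) (T : ℝ) (hT : 0 < T)
    (B : ℝ≥0 → Ω → EuclideanSpace ℝ (Fin d))
    (hB : IsFractionalBrownianMotion H B P) (hBm : JointlyAEMeasurable B P) :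
    -- the approximations are square integrable
    (∀ ε : ℝ, 0 < ε → MemLp (approxSelfIntersectionLocalTime B T ε) 2 P) ∧
    -- (i)
    (H < 1 / (d : ℝ) → ConvergesInL2 P (approxSelfIntersectionLocalTime B T)) ∧
    -- (ii)
    (1 / (d : ℝ) < H → H < 3 / (2 * (d : ℝ)) →
      IntegrableOn (fun z : ℝ => (z ^ (2 * H) + 1) ^ (-(d : ℝ) / 2)) (Set.Ioi 0) ∧
      ConvergesInL2 P (fun ε ω => approxSelfIntersectionLocalTime B T ε ω -
        T * renormalizationConstant H d * ε ^ (-(d : ℝ) / 2 + 1 / (2 * H)))) ∧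
    -- (iii)
    (1 / (d : ℝ) = H → H < 3 / (2 * (d : ℝ)) →
      ConvergesInL2 P (fun ε ω => approxSelfIntersectionLocalTime B T ε ω -
        T / (2 * H * (2 * Real.pi) ^ ((d : ℝ) / 2)) * Real.log (1 / ε))) ∧
    -- (iv)
    (3 / (2 * (d : ℝ)) ≤ H →
      ¬ ConvergesInL2 P (fun ε ω => approxSelfIntersectionLocalTime B T ε ω -
        ∫ ω', approxSelfIntersectionLocalTime B T ε ω' ∂P)) ∧
    -- the renormalized self-intersection local time exists in L² if and only if H < 3/(2d)
    (ConvergesInL2 P (fun ε ω => approxSelfIntersectionLocalTime B T ε ω -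
        ∫ ω', approxSelfIntersectionLocalTime B T ε ω' ∂P) ↔ H < 3 / (2 * (d : ℝ))) := by
  have hd' : (2 : ℝ) ≤ d := by exact_mod_cast hd
  have hd0 : (0 : ℝ) < d := by linarith
  have hα : (0 : ℝ) < (d : ℝ) / 2 := by positivity
  have hneg : -(d : ℝ) / 2 = -((d : ℝ) / 2) := neg_div _ _
  refine ⟨fun ε hε => memLp_approx hBm hT hε, fun h => ?_, fun h1 h2 => ⟨?_, ?_⟩, fun h1 h2 => ?_,
    not_convergesInL2_centered hB hBm hd hH hH' hT, fun hc => ?_,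
    convergesInL2_centered hB hBm hd hH hH' hT⟩
  · have h2 : H < 3 / (2 * (d : ℝ)) := by
      rw [lt_div_iff₀ (by positivity)] at h ⊢
      linarith
    rw [lt_div_iff₀ hd0] at h
    obtain ⟨L, hL⟩ := exists_tendsto_mean_of_lt_one (T := T) hH hα (by linarith)
    refine convergesInL2_of_tendsto_mean hB hBm hd hH hH' hT h2 (c := fun _ => 0)
      (by simpa using hL) fun ε ω => ?_
    rw [mul_zero, sub_zero]
  · rw [div_lt_iff₀ hd0] at h1
    have := integrableOn_meanProfile (α := (d : ℝ) / 2) hH hα (by linarith) one_pos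
    refine this.congr_fun (fun z _ => ?_) measurableSet_Ioi
    simp only [meanProfile, hneg, add_comm]
  · have h3 := h2
    rw [div_lt_iff₀ hd0] at h1
    rw [lt_div_iff₀ (by positivity)] at h2
    -- Here `2Hα = Hd`, and `Hd < 3/2` is stronger than the required `Hd < 2`.
    obtain ⟨L, hL⟩ := exists_tendsto_mean_of_one_lt (α := (d : ℝ) / 2) hH hα hT (by linarith)
      (by linarith)
    refine convergesInL2_of_tendsto_mean hB hBm hd hH hH' hT h3 hL fun ε ω => ?_
    rw [renormalizationConstant, hneg]
    ring
  · have h3 : 2 * H * ((d : ℝ) / 2) = 1 := by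
      rw [← h1]
      field_simp
    obtain ⟨L, hL⟩ := exists_tendsto_mean_of_eq_one hH hα hT h3
    refine convergesInL2_of_tendsto_mean hB hBm hd hH hH' hT h2 hL fun ε ω => ?_
    rw [hneg, Real.rpow_neg Real.two_pi_pos.le]
    ring
  · by_contra! hle
    exact not_convergesInL2_centered hB hBm hd hH hH' hT hle hc
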